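/- **Theorem 1 (Identification of parametric underspread linear systems).** Let $\mathcal H$ be a parametric system with $K_\tau\ge 1$ distinct delays $\tau_i$ and, for each $i$, $K_{\nu,i}\ge 1$ distinct Doppler shifts $\nu_{ij}$ with nonzero attenuation factors $\alpha_{ij}\in\mathbb C$: $$\mathcal H(x)(t)=\sum_{i=1}^{K_\tau}\sum_{j=1}^{K_{\nu,i}}\alpha_{ij}\,x(t-\tau_i)\,e^{j2\pi\nu_{ij}t},\qquad K=\sum_i K_{\nu,i},\qquad K_{\nu,\max}=\max_i K_{\nu,i}.$$ *Probe.* Let $\mathcal W>0$ (angular frequency) and $\mathcal T$ be real, and let $Q\ge 1$ be an upper bound for the number of delays that is known when the probe is designed ($Q=K_\tau$ is allowed). Put $T=4\pi Q/\mathcal W$ and $N=\lfloor\mathcal T/T\rfloor$. The probe is the pulse train $x(t)=\sum_{n=0}^{N-1}x_n\,g(t-nT)$, where $|x_n|>0$ for every $n$ and $g\in L^2(\mathbb R)$ has unit energy and bandwidth $\mathcal W$, in the sense that its Fourier transform satisfies $|G(\omega)|\ge a$ for some $a>0$ and a.e. $|\omega|\le\mathcal W/2$. *Assumptions.* [A1]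 All $(\tau_i,\nu_{ij})$ lie in $[0,\tau_{\max}]\times[-\nu_{\max}/2,\nu_{\max}/2]$. [A2] $\tau_{\max}<T$. [A3] The Doppler modulation is slow: $\nu_{\max}T<1$, and the modulation is taken as constant during each pulse, so that the observed signal is $$y(t)=\sum_{i,j}\sum_{n=0}^{N-1}\alpha_{ij}\,x_n\,e^{j2\pi\nu_{ij}nT}\,g(t-\tau_i-nT).$$ *Computation.* An algorithm is a program of a random access machine over $\mathbb C$ that works in exact arithmetic. It has natural-number registers (with addition, truncated subtraction and comparison) and complex arrays. One step is one arithmetic operation, conjugation, comparison of real parts, test for equality, evaluation of $\arg$, or loop iteration. Computing all roots of a monic polynomial of degree $n$ costs $(n+1)^3$ steps. Then the following hold. 1. There are one program and constants $C,d\in\mathbb N$ with the following property. For all $Q,\mathcal W,\mathcal T,g,(x_n)$ as above there are $2QN$ sampling kernels $h_{m,n}\in L^2(\mathbb R)$ ($0\le m<2Q$, $0\le n<N$) such that, for every parametric system satisfying [A1]–[A3], $K_\tau\le Q$ and $\mathcal T\mathcal W\ge 8\pi Q K_{\nu,\max}$ (that is, $\mathcal T\mathcal W\ge 8\pi K_\tau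 K_{\nu,\max}$ for $Q=K_\tau$), irrespective of where the $(\tau_i,\nu_{ij})$ lie, the program, given $Q$, $N$, $T$, $(x_n)$ and the samples $\langle y,h_{m,n}\rangle$ of the single observation $y$, returns exactly $K$ and the list of all triplets $(\tau_i,\nu_{ij},\alpha_{ij})$ in at most $C(\mathcal T\mathcal W)^d$ steps. 2. For every parametric system, $\mathcal T\mathcal W\ge 2\pi(K+1)^2$ implies $\mathcal T\mathcal W\ge 8\pi K_\tau K_{\nu,\max}$. (So a time–bandwidth product of $2\pi(K+1)^2$ suffices, and the number of steps is then polynomial in $K$.) 3. For every $T$ and $N$: if $g\in L^2(\mathbb R)$ has unit energy and vanishes a.e. outside $[0,T]$, then under [A1] and $\tau_{\max}<T$ the signal $y$ above and the response $\mathcal H(x)$ satisfy $\|\mathcal H(x)-y\|_{L^2}\le 2\pi\,\nu_{\max}T\,\sum_{i,j}|\alpha_{ij}|\sum_{n<N}|x_n|$. 4. If moreover $N\ge1$ and all $x_n\ne0$, then the response determines the system: two parametric systems with $\mathcal H(x)=\mathcal H'(x)$ a.e. have the same set of triplets (here [A1] and $\tau_{\max}<T$ are not needed). -/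

import Mathlib

open MeasureTheory FourierTransform
open scoped ComplexConjugate

noncomputable section

/-! ### Parametric linear systems -/

/-- The parameters of a parametric linear system: `numDelays ≥ 1` distinct delays `τ i`, for each
delay `numDopplers i ≥ 1` distinct Doppler shifts `ν i j`, and for each delay--Doppler pair a
nonzero complex attenuation factor `α i j`. -/
structure ParametricSystem where
  numDelays : ℕ
  numDelays_pos : 0 < numDelays
  numDopplers : Fin numDelays → ℕ
  numDopplers_pos : ∀ i, 0 < numDopplers i
  τ : Fin numDelays → ℝ
  τ_injective : Function.Injective τ
  ν : (i : Fin numDelays) → Fin (numDopplers i) → ℝ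
  ν_injective : ∀ i, Function.Injective (ν i)
  α : (i : Fin numDelays) → Fin (numDopplers i) → ℂ
  α_ne_zero : ∀ i j, α i j ≠ 0

namespace ParametricSystem

/-- The total number `K` of delay--Doppler pairs. -/
def numPairs (H : ParametricSystem) : ℕ := ∑ i, H.numDopplers i

/-- The maximal number of Doppler shifts that share a delay. -/
def maxDopplers (H : ParametricSystem) : ℕ := Finset.univ.sup H.numDopplers

/-- The set of triplets `(τ i, ν i j, α i j)` (with the real entries regarded as complex
numbers). -/
def triplets (H : ParametricSystem) : Set (ℂ × ℂ × ℂ) :=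
  {q | ∃ i j, q = ((H.τ i : ℂ), (H.ν i j : ℂ), H.α i j)}

/-- All delay--Doppler pairs lie in `[0, τmax] × [-νmax/2, νmax/2]`. -/
def SupportedIn (H : ParametricSystem) (τmax νmax : ℝ) : Prop :=
  (∀ i, H.τ i ∈ Set.Icc 0 τmax) ∧ ∀ i j, H.ν i j ∈ Set.Icc (-νmax / 2) (νmax / 2)

/-- The response `H(x)(t) = ∑ i j, α i j * x (t - τ i) * exp (2πi ν i j t)`. -/
def response (H : ParametricSystem) (x : ℝ → ℂ) (t : ℝ) : ℂ :=
  ∑ i, ∑ j, H.α i j * x (t - H.τ i) *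
    Complex.exp (2 * Real.pi * Complex.I * H.ν i j * t)

/-- The response to the pulse train `∑ n < N, x n * g (t - n T)` when the Doppler modulation does
not change during a pulse: the factor `exp (2πi ν t)` on the echo of the `n`-th pulse is
`exp (2πi ν n T)`. -/
def slowResponse (H : ParametricSystem) (g : ℝ → ℂ) (T : ℝ) (N : ℕ) (x : ℕ → ℂ) (t : ℝ) : ℂ :=
  ∑ i, ∑ j, ∑ n ∈ Finset.range N, H.α i j * x n *
    Complex.exp (2 * Real.pi * Complex.I * H.ν i j * (n * T)) * g (t - H.τ i - n * T)

end ParametricSystem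

/-! ### Probing signals -/

/-- The train of `N` pulses `∑ n < N, x n * g (t - n T)`. -/
def pulseTrain (g : ℝ → ℂ) (T : ℝ) (N : ℕ) (x : ℕ → ℂ) (t : ℝ) : ℂ :=
  ∑ n ∈ Finset.range N, x n * g (t - n * T)

/-- The spectrum of the square integrable pulse `g` fills the band `|ω| ≤ W / 2` (angular
frequency, `ω = 2πξ`): there it is essentially bounded away from zero. Here `𝓕` is the Fourier
transform on `L²`. -/
def FillsBand (g : ℝ → ℂ) (hg : MemLp g 2 volume) (W : ℝ) : Prop :=
  ∃ a : ℝ, 0 < a ∧ ∀ᵐ ξ : ℝ, |2 * Real.pi * ξ| ≤ W / 2 →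
    a ≤ ‖(𝓕 (hg.toLp g) : Lp ℂ 2 (volume : Measure ℝ)) ξ‖

/-- The sample `⟨y, h⟩ = ∫ y(t) h(t)^* dt` of the signal `y` with the sampling kernel `h`. -/
def sample (y h : ℝ → ℂ) : ℂ := ∫ t, y t * conj (h t)

/-! ### A random access machine over the complex numbers

A program is a finite piece of code in a structured language with natural-number registers and
two-dimensional arrays of complex numbers. It works in exact arithmetic, and every elementary
operation costs one step. Besides the arithmetic operations, complex conjugation, order and
equality tests, there are the argument of a complex number and the computation of the roots of a
monic polynomial of degree `n` (equivalently, of the eigenvalues of an `n × n` companion matrix),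
which is charged `(n + 1) ^ 3` steps. -/

/-- The memory: registers `nat r` and entries `arr a i j` of the array `a`. -/
structure Store where
  nat : ℕ → ℕ
  arr : ℕ → ℕ → ℕ → ℂ

/-- Expressions for natural numbers (`sub` is truncated subtraction). -/
inductive NatExpr where
  | const (n : ℕ)
  | reg (r : ℕ)
  | add (e f : NatExpr)
  | sub (e f : NatExpr)

/-- Expressions for complex numbers; `entry a i j` reads an entry of the array `a`. -/
inductive ComplexExpr where
  | ofNat (e : NatExpr)
  | imagUnit
  | entry (a : ℕ) (i j : NatExpr)
  | add (u v : ComplexExpr)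
  | sub (u v : ComplexExpr)
  | mul (u v : ComplexExpr)
  | div (u v : ComplexExpr)
  | conjugate (u : ComplexExpr)
  | arg (u : ComplexExpr)

/-- Tests: order of naturals, equality of complex numbers, order of real parts. -/
inductive Test where
  | natLe (e f : NatExpr)
  | eq (u v : ComplexExpr)
  | reLe (u v : ComplexExpr)

/-- Programs. `loop e c` evaluates `e` once and then executes `c` that many times.
`roots a n b` writes the roots, with multiplicity, of the monic polynomial
`X ^ n + ∑ k < n, arr a k 0 * X ^ k` into the entries `arr b 0 0, …, arr b (n - 1) 0`. -/
inductive Program where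
  | skip
  | setReg (r : ℕ) (e : NatExpr)
  | setEntry (a : ℕ) (i j : NatExpr) (u : ComplexExpr)
  | seq (c d : Program)
  | ite (t : Test) (c d : Program)
  | loop (e : NatExpr) (c : Program)
  | roots (a : ℕ) (n : NatExpr) (b : ℕ)

namespace NatExpr

def eval (s : Store) : NatExpr → ℕ
  | const n => n
  | reg r => s.nat r
  | add e f => e.eval s + f.eval s
  | sub e f => e.eval s - f.eval s

/-- The number of steps for the evaluation of an expression. -/
def cost : NatExpr → ℕ
  | const _ => 1
  | reg _ => 1
  | add e f => e.cost + f.cost + 1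
  | sub e f => e.cost + f.cost + 1

end NatExpr

namespace ComplexExpr

def eval (s : Store) : ComplexExpr → ℂ
  | ofNat e => (e.eval s : ℂ)
  | imagUnit => Complex.I
  | entry a i j => s.arr a (i.eval s) (j.eval s)
  | add u v => u.eval s + v.eval s
  | sub u v => u.eval s - v.eval s
  | mul u v => u.eval s * v.eval s
  | div u v => u.eval s / v.eval s
  | conjugate u => conj (u.eval s)
  | arg u => ((u.eval s).arg : ℂ)

/-- The number of steps for the evaluation of an expression. -/
def cost : ComplexExpr → ℕ
  | ofNat e => e.cost + 1
  | imagUnit => 1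
  | entry _ i j => i.cost + j.cost + 1
  | add u v => u.cost + v.cost + 1
  | sub u v => u.cost + v.cost + 1
  | mul u v => u.cost + v.cost + 1
  | div u v => u.cost + v.cost + 1
  | conjugate u => u.cost + 1
  | arg u => u.cost + 1

end ComplexExpr

namespace Test

def Holds (s : Store) : Test → Prop
  | natLe e f => e.eval s ≤ f.eval s
  | eq u v => u.eval s = v.eval s
  | reLe u v => (u.eval s).re ≤ (v.eval s).re

/-- The number of steps for the evaluation of a test. -/
def cost : Test → ℕ
  | natLe e f => e.cost + f.cost + 1
  | eq u v => u.cost + v.cost + 1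
  | reLe u v => u.cost + v.cost + 1

end Test

namespace Store

def setReg (s : Store) (r n : ℕ) : Store :=
  { s with nat := Function.update s.nat r n }

def setEntry (s : Store) (a i j : ℕ) (z : ℂ) : Store :=
  { s with arr := fun a' i' j' => if a' = a ∧ i' = i ∧ j' = j then z else s.arr a' i' j' }

/-- The list, in some order, of the roots with multiplicity of the monic polynomial of degree `n`
whose lower coefficients are the entries `arr a k 0`. -/
def rootList (s : Store) (a n : ℕ) : List ℂ :=
  (Polynomial.X ^ n + ∑ k ∈ Finset.range n,
    Polynomial.C (s.arr a k 0) * Polynomial.X ^ k : Polynomial ℂ).roots.toList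

def setRoots (s : Store) (a n b : ℕ) : Store :=
  { s with arr := fun a' i' j' =>
      if a' = b ∧ i' < n ∧ j' = 0 then (s.rootList a n).getD i' 0 else s.arr a' i' j' }

end Store

open Classical in
/-- The final memory and the number of steps of a program that is started in a given memory. -/
def Program.run : Program → Store → Store × ℕ
  | .skip, s => (s, 1)
  | .setReg r e, s => (s.setReg r (e.eval s), e.cost + 1)
  | .setEntry a i j u, s =>
      (s.setEntry a (i.eval s) (j.eval s) (u.eval s), i.cost + j.cost + u.cost + 1)
  | .seq c d, s =>
      let p := c.run s
      let q := d.run p.1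
      (q.1, p.2 + q.2)
  | .ite t c d, s =>
      let p := if t.Holds s then c.run s else d.run s
      (p.1, t.cost + p.2)
  | .loop e c, s =>
      (fun p : Store × ℕ => ((c.run p.1).1, p.2 + (c.run p.1).2 + 1))^[e.eval s] (s, e.cost + 1)
  | .roots a n b, s =>
      (s.setRoots a (n.eval s) b, n.cost + (n.eval s + 1) ^ 3)

/-- The initial memory: register 0 holds `Q`, register 1 holds `N`, array 0 holds the pulse
interval `T`, array 1 the probing sequence `x 0, …, x (N - 1)`, array 2 the `2Q × N` samples
`c m n`; everything else is zero. -/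
def inputStore (Q N : ℕ) (T : ℝ) (x : ℕ → ℂ) (c : ℕ → ℕ → ℂ) : Store where
  nat r := if r = 0 then Q else if r = 1 then N else 0
  arr a i j :=
    if a = 0 ∧ i = 0 ∧ j = 0 then (T : ℂ)
    else if a = 1 ∧ i < N ∧ j = 0 then x i
    else if a = 2 ∧ i < 2 * Q ∧ j < N then c i j
    else 0

/-- The memory `s` holds the complete description of the system `H`: register 0 holds the number
`K` of delay--Doppler pairs, and the rows `0, …, K - 1` of array 3 list the `K` triplets
`(τ i, ν i j, α i j)`. -/
def Store.Describes (s : Store) (H : ParametricSystem) : Prop :=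
  s.nat 0 = H.numPairs ∧
    {q : ℂ × ℂ × ℂ | ∃ k < H.numPairs, q = (s.arr 3 k 0, s.arr 3 k 1, s.arr 3 k 2)} = H.triplets

end

noncomputable section

/-! ### Reasoning about programs -/

/-! Delays and Doppler shifts both appear as frequencies of exponential sums, and Prony's method
recovers such sums exactly; it is applied twice. Put D = NT and P = QN. The delays lie in [0, T), so
the echo times s = τ_i + nT are distinct points of [0, D), and y is a combination of translates g(t
- s) with weights A_i(n) = x_n Σ_j α_ij exp(2πi ν_ij nT). The band of g splits into 2P frequency
cells of length 1/D. The k-th kernel has the Fourier transform D / conj G on the k-th cell and 0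
elsewhere. By Plancherel it maps g(t - s) to the integral of an exponential over the cell, which is
z^k, z = exp(-2πi s/D), times a nonzero factor that depends on s only (`exists_sampling_kernels`).
The samples are therefore 2P terms of an exponential sum with at most P nodes, and Prony's method
finds every echo of nonzero weight. For a fixed delay, A_i(n)/x_n is an exponential sum in n with
the nodes exp(2πi ν_ij T). Since |ν_ij T| < 1/2, these are distinct and their arguments give ν_ij;
since N ≥ 2 K_νmax, the sum is long enough for the second application.

Prony's method is used in a form that needs no rank decision (`exec_prony`). Polynomials of degree
at most P carry the semidefinite form induced by the P × (P + 1) Hankel matrix. Some monic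
polynomial of degree P vanishes at all nodes and hence lies in the kernel, so the last vector of the
Gram--Schmidt process applied to 1, X, ..., X^P has seminorm 0
(`hankel_apply_eq_zero_of_orthogonal`). A kernel element vanishes at each node of nonzero weight
(`mul_eval_eq_zero_of_nodeSum`). Its other roots are harmless: the Lagrange polynomials of the set
of roots give them weight 0.

The step count is read off from the syntax: all loop lengths and polynomial degrees are linear
expressions in registers that do not change while they are in use (`exists_steps_le`), and these
registers are at most QN ≤ 𝒯W.

The inequality with K is the arithmetic--geometric mean inequality together with K_τ + K_νmax ≤ K +
1. The slow-modulation bound is the Lipschitz bound for exp on the support of each echo. Uniqueness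
from the true response is the linear independence of the time--frequency shifts of a function that
vanishes on a half-line (`eq_zero_of_sum_timeFrequencyShift`): just to the right of the leftmost
point of all shifted supports, only the shifts with the smallest delay contribute, and they sum to a
translate of the function times a trigonometric polynomial, which is nonzero almost everywhere. -/

@[simp] theorem Store.setReg_arr (s : Store) (r n : ℕ) : (s.setReg r n).arr = s.arr := rfl

@[simp] theorem Store.setEntry_nat (s : Store) (a i j : ℕ) (z : ℂ) :
    (s.setEntry a i j z).nat = s.nat := rfl

@[simp] theorem Store.setRoots_nat (s : Store) (a n b : ℕ) : (s.setRoots a n b).nat = s.nat := rfl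

theorem Store.setReg_nat (s : Store) (r n r' : ℕ) :
    (s.setReg r n).nat r' = if r' = r then n else s.nat r' := by
  simp [Store.setReg, Function.update_apply]

@[simp] theorem Store.setReg_nat_self (s : Store) (r n : ℕ) : (s.setReg r n).nat r = n := by
  simp [Store.setReg_nat]

theorem Store.setReg_nat_of_ne (s : Store) {r r' : ℕ} (n : ℕ) (h : r' ≠ r) :
    (s.setReg r n).nat r' = s.nat r' := by
  simp [Store.setReg_nat, h]

theorem Store.setEntry_arr (s : Store) (a i j : ℕ) (z : ℂ) (a' i' j' : ℕ) :
    (s.setEntry a i j z).arr a' i' j' =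
      if a' = a ∧ i' = i ∧ j' = j then z else s.arr a' i' j' := rfl

@[simp] theorem Store.setEntry_arr_self (s : Store) (a i j : ℕ) (z : ℂ) :
    (s.setEntry a i j z).arr a i j = z := by
  simp [Store.setEntry_arr]

theorem Store.setEntry_arr_of_ne (s : Store) {a a' : ℕ} (i j : ℕ) (z : ℂ) (h : a' ≠ a) :
    (s.setEntry a i j z).arr a' = s.arr a' := by
  funext i' j'
  simp [Store.setEntry_arr, h]

theorem Store.setRoots_arr (s : Store) (a n b a' i' j' : ℕ) :
    (s.setRoots a n b).arr a' i' j' =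
      if a' = b ∧ i' < n ∧ j' = 0 then (s.rootList a n).getD i' 0 else s.arr a' i' j' := rfl

namespace Program

/-- The final memory of a program. -/
def exec (c : Program) (s : Store) : Store := (c.run s).1

@[simp] theorem exec_skip (s : Store) : exec .skip s = s := rfl

@[simp] theorem exec_setReg (r : ℕ) (e : NatExpr) (s : Store) :
    exec (.setReg r e) s = s.setReg r (e.eval s) := rfl

@[simp] theorem exec_setEntry (a : ℕ) (i j : NatExpr) (u : ComplexExpr) (s : Store) :
    exec (.setEntry a i j u) s = s.setEntry a (i.eval s) (j.eval s) (u.eval s) := rfl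

@[simp] theorem exec_seq (c d : Program) (s : Store) : exec (.seq c d) s = d.exec (c.exec s) := rfl

@[simp] theorem exec_roots (a : ℕ) (n : NatExpr) (b : ℕ) (s : Store) :
    exec (.roots a n b) s = s.setRoots a (n.eval s) b := rfl

open Classical in
theorem exec_ite (t : Test) (c d : Program) (s : Store) :
    exec (.ite t c d) s = if t.Holds s then c.exec s else d.exec s := by
  by_cases h : t.Holds s <;> simp [exec, run, h]

theorem exec_ite_of_holds {t : Test} (c d : Program) {s : Store} (h : t.Holds s) :
    exec (.ite t c d) s = c.exec s := by
  simp [exec_ite, h]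

theorem exec_ite_of_not_holds {t : Test} (c d : Program) {s : Store} (h : ¬ t.Holds s) :
    exec (.ite t c d) s = d.exec s := by
  simp [exec_ite, h]

theorem iterate_loop_fst (c : Program) (k : ℕ) (p : Store × ℕ) :
    ((fun p : Store × ℕ => ((c.run p.1).1, p.2 + (c.run p.1).2 + 1))^[k] p).1 =
      c.exec^[k] p.1 := by
  induction k generalizing p with
  | zero => rfl
  | succ k ih => rw [Function.iterate_succ_apply, ih, Function.iterate_succ_apply]; rfl

theorem exec_loop (e : NatExpr) (c : Program) (s : Store) :
    exec (.loop e c) s = c.exec^[e.eval s] s :=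
  iterate_loop_fst c _ (s, e.cost + 1)

/-- Whether a program contains an assignment to the register `r`. -/
def writesReg : Program → ℕ → Bool
  | .setReg r' _, r => r == r'
  | .seq c d, r => c.writesReg r || d.writesReg r
  | .ite _ c d, r => c.writesReg r || d.writesReg r
  | .loop _ c, r => c.writesReg r
  | _, _ => false

/-- Whether a program contains an assignment to an entry of the array `a`. -/
def writesArr : Program → ℕ → Bool
  | .setEntry a' _ _ _, a => a == a'
  | .seq c d, a => c.writesArr a || d.writesArr a
  | .ite _ c d, a => c.writesArr a || d.writesArr a
  | .loop _ c, a => c.writesArr a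
  | .roots _ _ b, a => a == b
  | _, _ => false

/-- The criterion is decidable from the code, so for a concrete program the fact that a register
survives is closed by `rfl`. The same holds for arrays in `exec_arr`. -/
theorem exec_nat (c : Program) {r : ℕ} (h : c.writesReg r = false) (s : Store) :
    (c.exec s).nat r = s.nat r := by
  induction c generalizing s with
  | setReg r' e =>
    simp only [writesReg, beq_eq_false_iff_ne] at h
    exact Store.setReg_nat_of_ne _ _ h
  | seq c d hc hd =>
    simp only [writesReg, Bool.or_eq_false_iff] at h
    rw [exec_seq, hd h.2, hc h.1]
  | ite t c d hc hd =>
    simp only [writesReg, Bool.or_eq_false_iff] at h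
    rw [exec_ite]
    split_ifs
    exacts [hc h.1 s, hd h.2 s]
  | loop e c hc =>
    rw [exec_loop]
    generalize e.eval s = k
    induction k generalizing s with
    | zero => rfl
    | succ k ih => rw [Function.iterate_succ_apply, ih, hc h]
  | _ => rfl

theorem exec_arr (c : Program) {a : ℕ} (h : c.writesArr a = false) (s : Store) :
    (c.exec s).arr a = s.arr a := by
  induction c generalizing s with
  | setEntry a' i j u =>
    simp only [writesArr, beq_eq_false_iff_ne] at h
    exact Store.setEntry_arr_of_ne _ _ _ _ h
  | seq c d hc hd =>
    simp only [writesArr, Bool.or_eq_false_iff] at h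
    rw [exec_seq, hd h.2, hc h.1]
  | ite t c d hc hd =>
    simp only [writesArr, Bool.or_eq_false_iff] at h
    rw [exec_ite]
    split_ifs
    exacts [hc h.1 s, hd h.2 s]
  | loop e c hc =>
    rw [exec_loop]
    generalize e.eval s = k
    induction k generalizing s with
    | zero => rfl
    | succ k ih => rw [Function.iterate_succ_apply, ih, hc h]
  | roots a' n b =>
    simp only [writesArr, beq_eq_false_iff_ne] at h
    funext i j
    simp [Store.setRoots_arr, h]
  | _ => rfl

/-! ### Polynomial running time -/

end Program

/-- All registers that occur in the expression have an index below `b`. -/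
def NatExpr.regsBelow (b : ℕ) : NatExpr → Bool
  | const _ => true
  | reg r => decide (r < b)
  | add e f => e.regsBelow b && f.regsBelow b
  | sub e f => e.regsBelow b && f.regsBelow b

theorem NatExpr.exists_eval_le {b : ℕ} (e : NatExpr) (h : e.regsBelow b) :
    ∃ C, ∀ (s : Store) (M : ℕ), 1 ≤ M → (∀ r < b, s.nat r ≤ M) → e.eval s ≤ C * M := by
  induction e with
  | const n => exact ⟨n, fun s M hM _ => Nat.le_mul_of_pos_right n hM⟩
  | reg r =>
    simp only [regsBelow, decide_eq_true_eq] at h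
    exact ⟨1, fun s M _ hs => by simpa [eval] using hs r h⟩
  | add e f he hf =>
    simp only [regsBelow, Bool.and_eq_true] at h
    obtain ⟨C, hC⟩ := he h.1
    obtain ⟨D, hD⟩ := hf h.2
    refine ⟨C + D, fun s M hM hs => ?_⟩
    rw [add_mul]
    exact add_le_add (hC s M hM hs) (hD s M hM hs)
  | sub e f he hf =>
    simp only [regsBelow, Bool.and_eq_true] at h
    obtain ⟨C, hC⟩ := he h.1
    exact ⟨C, fun s M hM hs => (Nat.sub_le _ _).trans (hC s M hM hs)⟩

namespace Program

/-- The registers with an index below `b` are never written, and the numbers of loop iterations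
and the degrees of the polynomials depend on these registers only. -/
def sizesBelow (b : ℕ) : Program → Bool
  | .setReg r _ => decide (b ≤ r)
  | .seq c d => c.sizesBelow b && d.sizesBelow b
  | .ite _ c d => c.sizesBelow b && d.sizesBelow b
  | .loop e c => e.regsBelow b && c.sizesBelow b
  | .roots _ n _ => n.regsBelow b
  | _ => true

theorem writesReg_of_sizesBelow {b : ℕ} (c : Program) (h : c.sizesBelow b) {r : ℕ} (hr : r < b) :
    c.writesReg r = false := by
  induction c with
  | setReg r' e =>
    simp only [sizesBelow, decide_eq_true_eq] at h
    simp only [writesReg, beq_eq_false_iff_ne]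
    omega
  | seq c d hc hd =>
    simp only [sizesBelow, Bool.and_eq_true] at h
    simp [writesReg, hc h.1, hd h.2]
  | ite t c d hc hd =>
    simp only [sizesBelow, Bool.and_eq_true] at h
    simp [writesReg, hc h.1, hd h.2]
  | loop e c hc =>
    simp only [sizesBelow, Bool.and_eq_true] at h
    exact hc h.2
  | _ => rfl

theorem mul_pow_le_mul_pow {C D M d e : ℕ} (hM : 1 ≤ M) (hC : C ≤ D) (hd : d ≤ e) :
    C * M ^ d ≤ D * M ^ e :=
  Nat.mul_le_mul hC (Nat.pow_le_pow_right hM hd)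

/-- Induction on the code: since the registers that control sizes never change, every loop length is
at most a constant times M, and each nested loop raises the exponent by one. The condition is
syntactic, so `rfl` verifies it for the actual programs. -/
theorem exists_steps_le {b : ℕ} (c : Program) (h : c.sizesBelow b) :
    ∃ C d, ∀ (s : Store) (M : ℕ), 1 ≤ M → (∀ r < b, s.nat r ≤ M) → (c.run s).2 ≤ C * M ^ d := by
  induction c with
  | skip => exact ⟨1, 0, fun s M _ _ => by simp [run]⟩
  | setReg r e => exact ⟨e.cost + 1, 0, fun s M _ _ => by simp [run]⟩
  | setEntry a i j u => exact ⟨i.cost + j.cost + u.cost + 1, 0, fun s M _ _ => by simp [run]⟩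
  | seq c d hc hd =>
    simp only [sizesBelow, Bool.and_eq_true] at h
    obtain ⟨C, m, hC⟩ := hc h.1
    obtain ⟨D, n, hD⟩ := hd h.2
    refine ⟨C + D, m + n, fun s M hM hs => ?_⟩
    have h1 := (hC s M hM hs).trans (mul_pow_le_mul_pow hM le_rfl (Nat.le_add_right m n))
    have h2 := (hD (c.exec s) M hM fun r hr => by
      rw [exec_nat c (writesReg_of_sizesBelow c h.1 hr)]
      exact hs r hr).trans (mul_pow_le_mul_pow hM le_rfl (Nat.le_add_left n m))
    rw [add_mul]
    exact add_le_add h1 h2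
  | ite t c d hc hd =>
    simp only [sizesBelow, Bool.and_eq_true] at h
    obtain ⟨C, m, hC⟩ := hc h.1
    obtain ⟨D, n, hD⟩ := hd h.2
    refine ⟨t.cost + C + D, m + n, fun s M hM hs => ?_⟩
    have h1 := (hC s M hM hs).trans (mul_pow_le_mul_pow hM le_rfl (Nat.le_add_right m n))
    have h2 := (hD s M hM hs).trans (mul_pow_le_mul_pow hM le_rfl (Nat.le_add_left n m))
    have h3 : t.cost ≤ t.cost * M ^ (m + n) := Nat.le_mul_of_pos_right _ (Nat.pow_pos hM)
    rw [add_mul, add_mul]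
    simp only [run]
    split_ifs <;> omega
  | loop e c hc =>
    simp only [sizesBelow, Bool.and_eq_true] at h
    obtain ⟨C, m, hC⟩ := hc h.2
    obtain ⟨D, hD⟩ := e.exists_eval_le h.1
    refine ⟨e.cost + 1 + D * (C + 1), m + 1, fun s M hM hs => ?_⟩
    have key : ∀ (k : ℕ) (p : Store × ℕ), (∀ r < b, p.1.nat r ≤ M) →
        ((fun p : Store × ℕ => ((c.run p.1).1, p.2 + (c.run p.1).2 + 1))^[k] p).2 ≤
          p.2 + k * (C * M ^ m + 1) := by
      intro k
      induction k with
      | zero => intro p _; simp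
      | succ k ih =>
        intro p hp
        rw [Function.iterate_succ_apply]
        refine (ih _ fun r hr => ?_).trans ?_
        · exact (exec_nat c (writesReg_of_sizesBelow c h.2 hr) p.1).le.trans (hp r hr)
        · have := hC p.1 M hM hp
          simp only
          rw [add_mul k 1]
          omega
    have h1 : 1 ≤ M ^ m := Nat.pow_pos hM
    have h2 : 1 ≤ M ^ (m + 1) := Nat.pow_pos hM
    calc ((loop e c).run s).2
        ≤ e.cost + 1 + e.eval s * (C * M ^ m + 1) := key _ (s, e.cost + 1) hs
      _ ≤ (e.cost + 1) * M ^ (m + 1) + D * M * ((C + 1) * M ^ m) := by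
        refine add_le_add (Nat.le_mul_of_pos_right _ h2) (Nat.mul_le_mul (hD s M hM hs) ?_)
        rw [add_mul]
        omega
      _ = (e.cost + 1 + D * (C + 1)) * M ^ (m + 1) := by ring
  | roots a n b' =>
    obtain ⟨D, hD⟩ := n.exists_eval_le h
    refine ⟨n.cost + (D + 1) ^ 3, 3, fun s M hM hs => ?_⟩
    have h1 : n.eval s + 1 ≤ (D + 1) * M := by
      have := hD s M hM hs
      rw [add_mul]
      omega
    calc n.cost + (n.eval s + 1) ^ 3
        ≤ n.cost * M ^ 3 + ((D + 1) * M) ^ 3 :=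
          add_le_add (Nat.le_mul_of_pos_right _ (Nat.pow_pos hM)) (Nat.pow_le_pow_left h1 3)
      _ = _ := by ring

/-! ### Counting loops -/

/-- Execute `c` for the values `0, …, e - 1` of the register `i`. -/
def forLoop (i : ℕ) (e : NatExpr) (c : Program) : Program :=
  .seq (.setReg i (.const 0)) (.loop e (.seq c (.setReg i (.add (.reg i) (.const 1)))))

/-- The rule of loop invariants. The step may also use that every register and array that the body
does not write still has its initial content, so invariants mention only what changes. -/
theorem exec_forLoop_induct (Inv : ℕ → Store → Prop) {i : ℕ} {e : NatExpr} {c : Program}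
    {s : Store} {n : ℕ} (he : e.eval (s.setReg i 0) = n) (hi : c.writesReg i = false)
    (h0 : Inv 0 (s.setReg i 0))
    (step : ∀ k s', k < n → s'.nat i = k →
      (∀ r, r ≠ i → c.writesReg r = false → s'.nat r = s.nat r) →
      (∀ a, c.writesArr a = false → s'.arr a = s.arr a) →
      Inv k s' → Inv (k + 1) ((c.exec s').setReg i (k + 1))) :
    Inv n ((forLoop i e c).exec s) := by
  have key : ∀ k, k ≤ n → ∀ s', s' = (exec (.seq c (.setReg i (.add (.reg i) (.const 1)))))^[k]
      (s.setReg i 0) → s'.nat i = k ∧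
      (∀ r, r ≠ i → c.writesReg r = false → s'.nat r = s.nat r) ∧
      (∀ a, c.writesArr a = false → s'.arr a = s.arr a) ∧ Inv k s' := by
    intro k
    induction k with
    | zero =>
      rintro - s' rfl
      exact ⟨by simp, fun r hr _ => by simp [Store.setReg_nat, hr], fun a _ => by simp, h0⟩
    | succ k ih =>
      rintro hk s' rfl
      rw [Function.iterate_succ_apply']
      obtain ⟨h1, h2, h3, h4⟩ := ih (Nat.le_of_succ_le hk) _ rfl
      set s' := (exec (.seq c (.setReg i (.add (.reg i) (.const 1)))))^[k] (s.setReg i 0)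
      have hex : exec (.seq c (.setReg i (.add (.reg i) (.const 1)))) s' =
          (c.exec s').setReg i (k + 1) := by
        simp [NatExpr.eval, exec_nat c hi, h1]
      rw [hex]
      refine ⟨by simp, fun r hr hw => ?_, fun a ha => ?_, step k s' hk h1 h2 h3 h4⟩
      · rw [Store.setReg_nat_of_ne _ _ hr, exec_nat c hw, h2 r hr hw]
      · rw [Store.setReg_arr, exec_arr c ha, h3 a ha]
  have := (key n le_rfl _ rfl).2.2.2
  simpa [forLoop, exec_loop, NatExpr.eval, he] using this

/-- A counting loop that fills the entries `(p k, q k)` of the array `a` with the values `F k`. -/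
theorem exec_forLoop_setEntry {i : ℕ} {e : NatExpr} {a : ℕ} {I J : NatExpr} {u : ComplexExpr}
    {s : Store} {n : ℕ} (p q : ℕ → ℕ) (F : ℕ → ℂ) (he : e.eval (s.setReg i 0) = n)
    (hinj : ∀ k < n, ∀ l < k, ¬ (p k = p l ∧ q k = q l))
    (hI : ∀ k s', k < n → s'.nat i = k → (∀ r, r ≠ i → s'.nat r = s.nat r) →
      I.eval s' = p k ∧ J.eval s' = q k)
    (hu : ∀ k s', k < n → s'.nat i = k → (∀ r, r ≠ i → s'.nat r = s.nat r) →
      (∀ b, b ≠ a → s'.arr b = s.arr b) →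
      (∀ i' j', (∀ l < k, ¬ (i' = p l ∧ j' = q l)) → s'.arr a i' j' = s.arr a i' j') →
      u.eval s' = F k) :
    (∀ k < n, ((forLoop i e (.setEntry a I J u)).exec s).arr a (p k) (q k) = F k) ∧
    ∀ i' j', (∀ l < n, ¬ (i' = p l ∧ j' = q l)) →
      ((forLoop i e (.setEntry a I J u)).exec s).arr a i' j' = s.arr a i' j' := by
  refine exec_forLoop_induct (fun n' s' => (∀ k < n', s'.arr a (p k) (q k) = F k) ∧
    ∀ i' j', (∀ l < n', ¬ (i' = p l ∧ j' = q l)) → s'.arr a i' j' = s.arr a i' j')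
    he rfl ⟨by simp, by simp⟩ ?_
  rintro k s' hk h1 h2 h3 ⟨h4, h5⟩
  have h2' : ∀ r, r ≠ i → s'.nat r = s.nat r := fun r hr => h2 r hr rfl
  obtain ⟨hp, hq⟩ := hI k s' hk h1 h2'
  -- By `h5` the entries not yet overwritten keep their initial values; this admits expressions that
  -- read the array being filled, as in-place updates do.
  have hF := hu k s' hk h1 h2' (fun b hb => h3 b (by simpa [writesArr] using hb)) h5
  simp only [exec_setEntry, Store.setReg_arr, hp, hq, hF, Store.setEntry_arr]
  constructor
  · intro l hl
    rcases Nat.lt_succ_iff_lt_or_eq.1 hl with hl | rfl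
    · have := hinj k hk l hl
      rw [if_neg (fun hh => this ⟨hh.2.1.symm, hh.2.2.symm⟩)]
      exact h4 l hl
    · simp
  · intro i' j' hl
    rw [if_neg (fun hh => hl k (Nat.lt_succ_self k) hh.2)]
    exact h5 i' j' fun l hl' => hl l (hl'.trans (Nat.lt_succ_self k))

end Program

/-! ### Exponential sums and Hankel matrices -/

section Hankel

open Polynomial

/-- The functional `p ↦ ∑ i, b i * p (z i)`. -/
def nodeSum {ι : Type*} [Fintype ι] (z b : ι → ℂ) : ℂ[X] →ₗ[ℂ] ℂ :=
  ∑ i, b i • Polynomial.leval (z i)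

theorem nodeSum_apply {ι : Type*} [Fintype ι] (z b : ι → ℂ) (p : ℂ[X]) :
    nodeSum z b p = ∑ i, b i * p.eval (z i) := by
  simp [nodeSum]

/-- The inner product of the images of two polynomials under the Hankel matrix with `P` rows. -/
def hankelInner (P : ℕ) (Λ : ℂ[X] →ₗ[ℂ] ℂ) (p q : ℂ[X]) : ℂ :=
  ∑ m ∈ Finset.range P, conj (Λ (X ^ m * p)) * Λ (X ^ m * q)

variable {P : ℕ} {Λ : ℂ[X] →ₗ[ℂ] ℂ}

theorem hankelInner_sub_right (p q r : ℂ[X]) :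
    hankelInner P Λ p (q - r) = hankelInner P Λ p q - hankelInner P Λ p r := by
  simp [hankelInner, mul_sub, Finset.sum_sub_distrib]

theorem hankelInner_sub_left (p q r : ℂ[X]) :
    hankelInner P Λ (p - q) r = hankelInner P Λ p r - hankelInner P Λ q r := by
  simp [hankelInner, mul_sub, sub_mul, Finset.sum_sub_distrib]

theorem hankelInner_smul_right (c : ℂ) (p q : ℂ[X]) :
    hankelInner P Λ p (c • q) = c * hankelInner P Λ p q := by
  simp [hankelInner, Finset.mul_sum, mul_left_comm]

theorem hankelInner_smul_left (c : ℂ) (p q : ℂ[X]) :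
    hankelInner P Λ (c • p) q = conj c * hankelInner P Λ p q := by
  simp [hankelInner, Finset.mul_sum, mul_assoc]

/-- The form is only semidefinite; its null vectors are exactly the kernel of the Hankel matrix, so
a vanishing seminorm is as good as a kernel element. -/
theorem hankelInner_self_eq_zero {p : ℂ[X]} :
    hankelInner P Λ p p = 0 ↔ ∀ m < P, Λ (X ^ m * p) = 0 := by
  constructor
  · intro h m hm
    have h1 : ∑ m ∈ Finset.range P, ‖Λ (X ^ m * p)‖ ^ 2 = 0 := by
      have : ((∑ m ∈ Finset.range P, ‖Λ (X ^ m * p)‖ ^ 2 : ℝ) : ℂ) = 0 := by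
        rw [← h, hankelInner]
        push_cast
        exact Finset.sum_congr rfl fun m _ => (Complex.conj_mul' _).symm
      exact_mod_cast this
    have := (Finset.sum_eq_zero_iff_of_nonneg (fun _ _ => by positivity)).1 h1 m
      (Finset.mem_range.2 hm)
    simpa using this
  · intro h
    exact Finset.sum_eq_zero fun m hm => by simp [h m (Finset.mem_range.1 hm)]

theorem hankelInner_eq_zero_of_left {p : ℂ[X]} (h : ∀ m < P, Λ (X ^ m * p) = 0) (q : ℂ[X]) :
    hankelInner P Λ p q = 0 :=
  Finset.sum_eq_zero fun m hm => by simp [h m (Finset.mem_range.1 hm)]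

/-- Subtracting the projection makes a polynomial orthogonal. -/
theorem hankelInner_sub_projection (p q : ℂ[X]) :
    hankelInner P Λ p (q - (hankelInner P Λ p q / hankelInner P Λ p p) • p) = 0 := by
  rw [hankelInner_sub_right, hankelInner_smul_right]
  -- If `p` is a null vector, it is orthogonal to everything and the coefficient is irrelevant, so
  -- the program may divide by zero here.
  by_cases h : hankelInner P Λ p p = 0
  · rw [hankelInner_eq_zero_of_left (hankelInner_self_eq_zero.1 h), h]
    simp
  · rw [div_mul_cancel₀ _ h, sub_self]

/-- The last of `P + 1` orthogonalised monic polynomials lies in the kernel of the Hankel matrix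
if this kernel contains a monic polynomial of degree `P`. -/
theorem hankel_apply_eq_zero_of_orthogonal {p : ℕ → ℂ[X]} (hm : ∀ k ≤ P, (p k).Monic)
    (hd : ∀ k ≤ P, (p k).natDegree = k) (ho : ∀ j < P, hankelInner P Λ (p j) (p P) = 0)
    {q : ℂ[X]} (hqm : q.Monic) (hqd : q.natDegree = P) (hq : ∀ m < P, Λ (X ^ m * q) = 0) :
    ∀ m < P, Λ (X ^ m * p P) = 0 := by
  -- The monic polynomials of degrees 0, ..., P - 1 span all polynomials of degree below P; peel off
  -- the leading term.
  have key : ∀ d ≤ P, ∀ r : ℂ[X], r.degree < d → hankelInner P Λ r (p P) = 0 := by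
    intro d
    induction d with
    | zero =>
      intro _ r hr
      have : r = 0 := by simpa using hr
      subst this
      exact hankelInner_eq_zero_of_left (by simp) _
    | succ d ih =>
      intro hdP r hr
      have h1 : (r - r.coeff d • p d).degree < d := by
        rw [Polynomial.degree_lt_iff_coeff_zero] at hr ⊢
        intro m hm'
        have hpd := hd d (by omega)
        rcases hm'.eq_or_lt with rfl | hlt
        · have : (p d).coeff d = 1 := by simpa [Monic, leadingCoeff, hpd] using hm d (by omega)
          simp [this]
        · have h2 : (p d).coeff m = 0 := Polynomial.coeff_eq_zero_of_natDegree_lt (by omega)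
          simp [h2, hr m hlt]
      have h2 := ih (by omega) _ h1
      rw [hankelInner_sub_left, hankelInner_smul_left, ho d (by omega)] at h2
      simpa using h2
  rw [← hankelInner_self_eq_zero]
  -- Now `p P = (p P - q) + q`: the first summand has degree below P and is orthogonal to `p P`, the
  -- second lies in the kernel. Hence `p P` is orthogonal to itself.
  have h1 : (p P - q).degree < (P : ℕ) := by
    have hP := hd P le_rfl
    have h2 : (p P).degree = P := by rw [Polynomial.degree_eq_natDegree (hm P le_rfl).ne_zero, hP]
    have h3 : q.degree = P := by rw [Polynomial.degree_eq_natDegree hqm.ne_zero, hqd]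
    rw [← h2]
    exact Polynomial.degree_sub_lt_left (h2.trans h3.symm) (hm P le_rfl).ne_zero
      (by rw [(hm P le_rfl).leadingCoeff, hqm.leadingCoeff])
  have h2 := key P le_rfl _ h1
  rwa [hankelInner_sub_left, hankelInner_eq_zero_of_left hq, sub_zero] at h2

variable {ι : Type*} [Fintype ι] {z b : ι → ℂ}

/-- If `card ι ≤ P`, an element of the kernel of the Hankel matrix vanishes at the nodes. -/
theorem mul_eval_eq_zero_of_nodeSum (hz : Function.Injective z) (hP : Fintype.card ι ≤ P)
    {p : ℂ[X]} (hp : ∀ m < P, nodeSum z b (X ^ m * p) = 0) (i : ι) : b i * p.eval (z i) = 0 := by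
  classical
  -- Linear combinations of the P kernel equations test the weights b_j p(z_j) against every
  -- polynomial of degree below P.
  have key : ∀ r : ℂ[X], r.natDegree < P → ∑ j, b j * p.eval (z j) * r.eval (z j) = 0 := by
    intro r hr
    have h1 : nodeSum z b (r * p) = 0 := by
      rw [r.as_sum_range_C_mul_X_pow, Finset.sum_mul, map_sum]
      refine Finset.sum_eq_zero fun m hm => ?_
      rw [mul_assoc, ← Polynomial.smul_eq_C_mul, map_smul, hp m, smul_zero]
      have := Finset.mem_range.1 hm
      omega
    rw [← h1, nodeSum_apply]
    exact Finset.sum_congr rfl fun j _ => by rw [Polynomial.eval_mul]; ring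
  -- The test polynomial that vanishes at all nodes but the i-th has degree card ι - 1 < P.
  set r : ℂ[X] := ∏ j ∈ Finset.univ.erase i, (X - C (z j)) with hr
  have hdeg : r.natDegree < P := by
    rw [hr, Polynomial.natDegree_prod_of_monic _ _ fun j _ => monic_X_sub_C _]
    simp only [natDegree_X_sub_C, Finset.sum_const, smul_eq_mul, mul_one]
    rw [Finset.card_erase_of_mem (Finset.mem_univ i), Finset.card_univ]
    have : 0 < Fintype.card ι := Fintype.card_pos_iff.2 ⟨i⟩
    omega
  have h1 := key r hdeg
  rw [Finset.sum_eq_single i] at h1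
  · have h2 : r.eval (z i) ≠ 0 := by
      rw [hr, Polynomial.eval_prod, Finset.prod_ne_zero_iff]
      intro j hj
      simpa [sub_eq_zero] using fun h => (Finset.ne_of_mem_erase hj) (hz h).symm
    exact (mul_eq_zero.1 h1).resolve_right h2
  · intro j _ hj
    have : r.eval (z j) = 0 := by
      rw [hr, Polynomial.eval_prod]
      exact Finset.prod_eq_zero (Finset.mem_erase.2 ⟨hj, Finset.mem_univ j⟩) (by simp)
    rw [this, mul_zero]
  · simp

/-- A monic polynomial of degree `P` that vanishes at all nodes. -/
theorem exists_monic_nodeSum_eq_zero (z b : ι → ℂ) (hP : Fintype.card ι ≤ P) :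
    ∃ q : ℂ[X], q.Monic ∧ q.natDegree = P ∧ ∀ m < P, nodeSum z b (X ^ m * q) = 0 := by
  classical
  have hm : (∏ j, (X - C (z j))).Monic := monic_prod_of_monic _ _ fun j _ => monic_X_sub_C _
  -- The power of X only pads the degree to P.
  refine ⟨X ^ (P - Fintype.card ι) * ∏ j, (X - C (z j)), (monic_X_pow _).mul hm, ?_, ?_⟩
  · rw [(monic_X_pow _).natDegree_mul hm, natDegree_X_pow,
      natDegree_prod_of_monic _ _ fun j _ => monic_X_sub_C _]
    simp
    omega
  · intro m _
    rw [nodeSum_apply]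
    refine Finset.sum_eq_zero fun i _ => ?_
    have : (∏ j, (X - C (z j))).eval (z i) = 0 := by
      rw [eval_prod]
      exact Finset.prod_eq_zero (Finset.mem_univ i) (by simp)
    simp [this]

/-- The factor `(u - r) / (v - r)` of a Lagrange polynomial for the node `v`; there is no factor
for `r = v`. -/
def lagrangeFactor (v r u : ℂ) : ℂ := open Classical in if r = v then 1 else (u - r) / (v - r)

theorem lagrangeFactor_self (v r : ℂ) : lagrangeFactor v r v = 1 := by
  unfold lagrangeFactor
  split_ifs with h
  · rfl
  · exact div_self (sub_ne_zero.2 (Ne.symm h))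

theorem lagrangeFactor_eq_zero {v r : ℂ} (h : r ≠ v) : lagrangeFactor v r r = 0 := by
  simp [lagrangeFactor, h]

/-- The Lagrange polynomials isolate the weight of a node. -/
theorem sum_mul_prod_lagrangeFactor (hz : Function.Injective z) {r : ℕ → ℂ}
    (hr : ∀ i, b i ≠ 0 → ∃ m < P, r m = z i) (v : ℂ) :
    (∀ i, z i = v →
      ∑ j, b j * ∏ m ∈ Finset.range P, lagrangeFactor v (r m) (z j) = b i) ∧
    ((∀ i, z i ≠ v) →
      ∑ j, b j * ∏ m ∈ Finset.range P, lagrangeFactor v (r m) (z j) = 0) := by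
  -- A node of nonzero weight other than v occurs among the r_m and annihilates the product; nodes
  -- of weight zero need not occur, and repetitions do no harm.
  have key : ∀ j, z j ≠ v → b j * ∏ m ∈ Finset.range P, lagrangeFactor v (r m) (z j) = 0 := by
    intro j hj
    by_cases hb : b j = 0
    · simp [hb]
    · obtain ⟨m, hm, hrm⟩ := hr j hb
      rw [Finset.prod_eq_zero (Finset.mem_range.2 hm), mul_zero]
      rw [hrm]
      exact lagrangeFactor_eq_zero hj
  constructor
  · rintro i rfl
    rw [Finset.sum_eq_single i]
    · simp [lagrangeFactor_self]
    · intro j _ hj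
      exact key j fun h => hj (hz h)
    · simp
  · intro h
    exact Finset.sum_eq_zero fun j _ => key j (h j)

end Hankel

/-! ### Prony's method as a program

The program `prony rP o` reads the numbers `c 0, …, c (2P - 1)` from array 10, where `P` is the
content of register `rP`, and writes candidates for the nodes into array 11 and their weights into
array 12. The counters are the registers 10 to 12, and the arrays 20 to 23 are work space. -/

namespace Program

/-- Row `k` of array 20 becomes the `k`-th Hankel column followed by the coefficients of `X ^ k`. -/
def hankelRow (rP : ℕ) : Program :=
  .seq (forLoop 12 (.reg rP) (.setEntry 20 (.reg 10) (.reg 12)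
      (.entry 10 (.add (.reg 10) (.reg 12)) (.const 0)))) <|
  .seq (forLoop 12 (.add (.reg rP) (.const 1)) (.setEntry 20 (.reg 10) (.add (.reg rP) (.reg 12))
      (.ofNat (.const 0)))) <|
  .setEntry 20 (.reg 10) (.add (.reg rP) (.reg 10)) (.ofNat (.const 1))

/-- The inner products of row `j` with row `k` and with itself. -/
def hankelDots (rP : ℕ) : Program :=
  .seq (.setEntry 21 (.const 0) (.const 0) (.ofNat (.const 0))) <|
  .seq (.setEntry 21 (.const 0) (.const 1) (.ofNat (.const 0))) <|
  forLoop 12 (.reg rP) <|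
    .seq (.setEntry 21 (.const 0) (.const 0) (.add (.entry 21 (.const 0) (.const 0))
      (.mul (.conjugate (.entry 20 (.reg 11) (.reg 12))) (.entry 20 (.reg 10) (.reg 12)))))
    (.setEntry 21 (.const 0) (.const 1) (.add (.entry 21 (.const 0) (.const 1))
      (.mul (.conjugate (.entry 20 (.reg 11) (.reg 12))) (.entry 20 (.reg 11) (.reg 12)))))

/-- Subtract the projection to row `j` from row `k`. -/
def hankelSubtract (rP : ℕ) : Program :=
  forLoop 12 (.add (.add (.reg rP) (.reg rP)) (.const 1)) <|
    .setEntry 20 (.reg 10) (.reg 12) (.sub (.entry 20 (.reg 10) (.reg 12))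
      (.mul (.div (.entry 21 (.const 0) (.const 0)) (.entry 21 (.const 0) (.const 1)))
        (.entry 20 (.reg 11) (.reg 12))))

/-- Gram--Schmidt orthogonalisation of row `k` against the rows above. -/
def hankelReduce (rP : ℕ) : Program :=
  forLoop 11 (.add (.reg rP) (.const 1)) <|
    .ite (.natLe (.add (.reg 11) (.const 1)) (.reg 10))
      (.seq (hankelDots rP) (hankelSubtract rP)) .skip

/-- Gram--Schmidt orthogonalisation of the Hankel columns. -/
def gramSchmidt (rP : ℕ) : Program :=
  forLoop 10 (.add (.reg rP) (.const 1)) (.seq (hankelRow rP) (hankelReduce rP))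

end Program

open Polynomial in
/-- The entries of a row of array 20: the image of a polynomial under the Hankel matrix, followed
by the coefficients. -/
def hankelEntry (P : ℕ) (Λ : ℂ[X] →ₗ[ℂ] ℂ) (p : ℂ[X]) (m : ℕ) : ℂ :=
  if m < P then Λ (X ^ m * p) else p.coeff (m - P)

theorem hankelEntry_sub_smul (P : ℕ) (Λ : Polynomial ℂ →ₗ[ℂ] ℂ) (p q : Polynomial ℂ) (c : ℂ)
    (m : ℕ) : hankelEntry P Λ (q - c • p) m = hankelEntry P Λ q m - c * hankelEntry P Λ p m := by
  unfold hankelEntry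
  split_ifs <;> simp [mul_sub]

/-- Row `k` of array 20 represents the polynomial `p`. -/
def Store.HasRow (s : Store) (P : ℕ) (Λ : Polynomial ℂ →ₗ[ℂ] ℂ) (k : ℕ) (p : Polynomial ℂ) :
    Prop :=
  ∀ m < 2 * P + 1, s.arr 20 k m = hankelEntry P Λ p m

theorem Store.HasRow.congr {s s' : Store} {P : ℕ} {Λ : Polynomial ℂ →ₗ[ℂ] ℂ} {k : ℕ}
    {p : Polynomial ℂ} (h : s.HasRow P Λ k p) (h' : s'.arr 20 k = s.arr 20 k) :
    s'.HasRow P Λ k p := fun m hm => by rw [h', h m hm]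

namespace Program

variable {rP P : ℕ} {Λ : Polynomial ℂ →ₗ[ℂ] ℂ} {s : Store}

open Polynomial in
theorem exec_hankelRow (hr : rP < 10) (hP : s.nat rP = P) {k : ℕ} (hk : s.nat 10 = k) (hkP : k ≤ P)
    (hc : ∀ m < 2 * P, s.arr 10 m 0 = Λ (X ^ m)) :
    ((hankelRow rP).exec s).HasRow P Λ k (X ^ k) ∧
      ∀ i, i ≠ k → ((hankelRow rP).exec s).arr 20 i = s.arr 20 i := by
  have hr12 : rP ≠ 12 := by omega
  set s1 := (forLoop 12 (.reg rP) (.setEntry 20 (.reg 10) (.reg 12)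
      (.entry 10 (.add (.reg 10) (.reg 12)) (.const 0)))).exec s with hs1
  obtain ⟨h1, h2⟩ := exec_forLoop_setEntry (s := s) (i := 12) (e := .reg rP) (a := 20)
    (I := .reg 10) (J := .reg 12) (u := .entry 10 (.add (.reg 10) (.reg 12)) (.const 0)) (n := P)
    (fun _ => k) (fun m => m) (fun m => Λ (X ^ m * X ^ k))
    (by simp [NatExpr.eval, Store.setReg_nat, hr12, hP]) (by intro m _ l hl h; omega)
    (by
      intro m s' _ hm hs'
      simp [NatExpr.eval, hm, hs' 10 (by decide), hk])
    (by
      intro m s' hmP hm hs' ha _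
      rw [ComplexExpr.eval, ha 10 (by decide)]
      simp only [NatExpr.eval, hm, hs' 10 (by decide), hk]
      rw [hc _ (by omega), ← pow_add, add_comm])
  rw [← hs1] at h1 h2
  have hn1 : ∀ r, r ≠ 12 → s1.nat r = s.nat r := fun r hr =>
    exec_nat _ (by simp [forLoop, writesReg, hr]) s
  set s2 := (forLoop 12 (.add (.reg rP) (.const 1)) (.setEntry 20 (.reg 10)
    (.add (.reg rP) (.reg 12)) (.ofNat (.const 0)))).exec s1 with hs2
  obtain ⟨h3, h4⟩ := exec_forLoop_setEntry (s := s1) (i := 12) (e := .add (.reg rP) (.const 1))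
    (a := 20) (I := .reg 10) (J := .add (.reg rP) (.reg 12)) (u := .ofNat (.const 0)) (n := P + 1)
    (fun _ => k) (fun m => P + m) (fun _ => 0)
    (by simp [NatExpr.eval, Store.setReg_nat, hr12, hn1, hP]) (by intro m _ l hl h; omega)
    (by
      intro m s' _ hm hs'
      simp [NatExpr.eval, hm, hs' 10 (by decide), hs' rP hr12, hn1 10 (by decide), hn1 rP hr12,
        hk, hP])
    (by
      intro m s' hmP hm hs' ha _
      simp [ComplexExpr.eval, NatExpr.eval])
  rw [← hs2] at h3 h4
  have hn2 : ∀ r, r ≠ 12 → s2.nat r = s.nat r := fun r hr =>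
    (exec_nat _ (by simp [forLoop, writesReg, hr]) s1).trans (hn1 r hr)
  have hex : (hankelRow rP).exec s = s2.setEntry 20 k (P + k) 1 := by
    simp [hankelRow, ← hs1, ← hs2, NatExpr.eval, ComplexExpr.eval, hn2, hr12, hP, hk]
  rw [hex]
  constructor
  · intro m hm
    simp only [Store.setEntry_arr, true_and, hankelEntry]
    by_cases hmP : m < P
    · rw [if_neg (by omega), if_pos hmP, h4 k m (by intro l _ h; omega), h1 m hmP]
    · obtain ⟨l, rfl⟩ := Nat.exists_eq_add_of_le (not_lt.1 hmP)
      rw [if_neg hmP, h3 l (by omega), Nat.add_sub_cancel_left, coeff_X_pow]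
      simp
  · intro i hi
    funext m
    rw [Store.setEntry_arr, if_neg (by tauto), h4 i m (by tauto), h2 i m (by tauto)]

theorem exec_hankelDots (hr : rP < 10) (hP : s.nat rP = P) {j k : ℕ} (hk : s.nat 10 = k)
    (hj : s.nat 11 = j) {p q : Polynomial ℂ} (hp : s.HasRow P Λ j p) (hq : s.HasRow P Λ k q) :
    ((hankelDots rP).exec s).arr 21 0 0 = hankelInner P Λ p q ∧
      ((hankelDots rP).exec s).arr 21 0 1 = hankelInner P Λ p p := by
  have hr12 : rP ≠ 12 := by omega
  rw [hankelDots, exec_seq, exec_seq]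
  set s1 := exec _ (exec _ s) with hs1
  have hn1 : s1.nat = s.nat := rfl
  have ha1 : ∀ a, a ≠ 21 → s1.arr a = s.arr a := fun a ha => by
    rw [hs1, exec_arr _ (by simp [writesArr, ha]), exec_arr _ (by simp [writesArr, ha])]
  have h0 : s1.arr 21 0 0 = 0 ∧ s1.arr 21 0 1 = 0 := by
    simp [hs1, Store.setEntry_arr, NatExpr.eval, ComplexExpr.eval]
  refine exec_forLoop_induct (fun n s' =>
    s'.arr 21 0 0 = ∑ m ∈ Finset.range n, conj (Λ (.X ^ m * p)) * Λ (.X ^ m * q) ∧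
    s'.arr 21 0 1 = ∑ m ∈ Finset.range n, conj (Λ (.X ^ m * p)) * Λ (.X ^ m * p))
    (by simp [NatExpr.eval, Store.setReg_nat, hr12, hn1, hP]) rfl (by simpa using h0) ?_
  rintro m s' hm h1 h2 h3 ⟨h4, h5⟩
  have e1 : s'.nat 10 = k := by rw [h2 10 (by decide) rfl, hn1, hk]
  have e2 : s'.nat 11 = j := by rw [h2 11 (by decide) rfl, hn1, hj]
  have e3 : s'.arr 20 j m = Λ (.X ^ m * p) := by
    rw [h3 20 rfl, ha1 20 (by decide), hp m (by omega), hankelEntry, if_pos hm]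
  have e4 : s'.arr 20 k m = Λ (.X ^ m * q) := by
    rw [h3 20 rfl, ha1 20 (by decide), hq m (by omega), hankelEntry, if_pos hm]
  simp [Store.setEntry_arr, NatExpr.eval, ComplexExpr.eval, e1, e2, h1, e3, e4, h4, h5,
    Finset.sum_range_succ]

theorem exec_hankelSubtract (hr : rP < 10) (hP : s.nat rP = P) {j k : ℕ} (hk : s.nat 10 = k)
    (hj : s.nat 11 = j) {p q : Polynomial ℂ} (hp : s.HasRow P Λ j p)
    (hq : s.HasRow P Λ k q) :
    ((hankelSubtract rP).exec s).HasRow P Λ k (q - (s.arr 21 0 0 / s.arr 21 0 1) • p) ∧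
      ∀ i, i ≠ k → ((hankelSubtract rP).exec s).arr 20 i = s.arr 20 i := by
  have hr12 : rP ≠ 12 := by omega
  obtain ⟨h1, h2⟩ := exec_forLoop_setEntry (s := s) (i := 12)
    (e := .add (.add (.reg rP) (.reg rP)) (.const 1)) (a := 20)
    (I := .reg 10) (J := .reg 12) (u := .sub (.entry 20 (.reg 10) (.reg 12))
      (.mul (.div (.entry 21 (.const 0) (.const 0)) (.entry 21 (.const 0) (.const 1)))
        (.entry 20 (.reg 11) (.reg 12)))) (n := 2 * P + 1)
    (fun _ => k) (fun m => m)
    (fun m => hankelEntry P Λ (q - (s.arr 21 0 0 / s.arr 21 0 1) • p) m)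
    (by simp [NatExpr.eval, Store.setReg_nat, hr12, hP]; omega) (by intro m _ l hl h; omega)
    (by
      intro m s' _ hm hs'
      simp [NatExpr.eval, hm, hs' 10 (by decide), hk])
    (by
      intro m s' hmP hm hs' ha hs20
      have e1 : s'.arr 20 k m = hankelEntry P Λ q m := by
        rw [hs20 k m (by intro l hl h; omega), hq m hmP]
      have e2 : s'.arr 20 j m = hankelEntry P Λ p m := by
        rw [hs20 j m (by intro l hl h; omega), hp m hmP]
      simp [ComplexExpr.eval, NatExpr.eval, hm, hs' 10 (by decide), hs' 11 (by decide), hk, hj,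
        e1, e2, ha 21 (by decide), hankelEntry_sub_smul])
  exact ⟨h1, fun i hi => funext fun m => h2 i m (by tauto)⟩

open Polynomial in
-- This is the modified Gram--Schmidt process: the inner product is taken with the partly reduced
-- row. Subtracting a multiple of p_j keeps the orthogonality to the earlier p_i, because p_i and
-- p_j are orthogonal, and keeps the polynomial monic of degree k, because p_j has degree j < k.
theorem exec_hankelReduce (hr : rP < 10) (hP : s.nat rP = P) {k : ℕ} (hk : s.nat 10 = k)
    (hkP : k ≤ P) {p : ℕ → ℂ[X]} (hp : ∀ j < k, s.HasRow P Λ j (p j))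
    (hm : ∀ j < k, (p j).Monic) (hd : ∀ j < k, (p j).natDegree = j)
    (ho : ∀ j < k, ∀ i < j, hankelInner P Λ (p i) (p j) = 0) (hq : s.HasRow P Λ k (X ^ k)) :
    (∃ q : ℂ[X], q.Monic ∧ q.natDegree = k ∧ (∀ j < k, hankelInner P Λ (p j) q = 0) ∧
      ((hankelReduce rP).exec s).HasRow P Λ k q) ∧
      ∀ i, i ≠ k → ((hankelReduce rP).exec s).arr 20 i = s.arr 20 i := by
  have hr11 : rP ≠ 11 := by omega
  have hr12 : rP ≠ 12 := by omega
  have key := exec_forLoop_induct (s := s) (i := 11) (e := .add (.reg rP) (.const 1)) (n := P + 1)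
    (c := .ite (.natLe (.add (.reg 11) (.const 1)) (.reg 10))
      (.seq (hankelDots rP) (hankelSubtract rP)) .skip)
    (fun n s' => (∃ q : ℂ[X], q.Monic ∧ q.natDegree = k ∧
      (∀ j < k, j < n → hankelInner P Λ (p j) q = 0) ∧ s'.HasRow P Λ k q) ∧
      ∀ i, i ≠ k → s'.arr 20 i = s.arr 20 i)
    (by simp [NatExpr.eval, Store.setReg_nat, hr11, hP]) rfl
    ⟨⟨X ^ k, monic_X_pow k, natDegree_X_pow k, by simp, hq⟩, by simp⟩ (by
      rintro j s' hj h1 h2 h3 ⟨⟨q, hqm, hqd, hqo, hqs⟩, hrest⟩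
      have e1 : s'.nat 10 = k := by rw [h2 10 (by decide) rfl, hk]
      have e2 : s'.nat rP = P := by
        rw [h2 rP hr11 (by
          simp [writesReg, hankelDots, hankelSubtract, forLoop, hr12]), hP]
      -- The loop runs over all j ≤ P and skips j ≥ k, because a length read from the counter `k`
      -- would violate `sizesBelow`.
      by_cases hjk : j < k
      · rw [exec_ite_of_holds _ _ (by simp [Test.Holds, NatExpr.eval, h1, e1]; omega), exec_seq]
        have hpj : s'.HasRow P Λ j (p j) := (hp j hjk).congr (hrest j hjk.ne)
        obtain ⟨d1, d2⟩ := exec_hankelDots hr e2 e1 h1 hpj hqs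
        set s2 := (hankelDots rP).exec s' with hs2
        have ha2 : s2.arr 20 = s'.arr 20 := exec_arr _ rfl _
        obtain ⟨f1, f2⟩ := exec_hankelSubtract (s := s2) (Λ := Λ) (P := P) (k := k) (j := j)
          (p := p j) (q := q) hr
          (by rw [hs2, exec_nat _ (by simp [hankelDots, writesReg, forLoop, hr12]), e2])
          (by rw [hs2, exec_nat _ rfl, e1]) (by rw [hs2, exec_nat _ rfl, h1])
          (hpj.congr (by rw [ha2])) (hqs.congr (by rw [ha2]))
        rw [d1, d2] at f1
        have hdeg : ((hankelInner P Λ (p j) q / hankelInner P Λ (p j) (p j)) • p j).degree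
            < q.degree := by
          refine (degree_smul_le _ _).trans_lt ?_
          rw [degree_eq_natDegree hqm.ne_zero, degree_eq_natDegree (hm j hjk).ne_zero, hqd,
            hd j hjk]
          exact_mod_cast hjk
        refine ⟨⟨_, hqm.sub_of_left hdeg, ?_, ?_, f1.congr (by simp)⟩, ?_⟩
        · rw [natDegree_eq_of_degree_eq (degree_sub_eq_left_of_degree_lt hdeg), hqd]
        · intro i hik hij
          rcases Nat.lt_succ_iff_lt_or_eq.1 hij with hij | rfl
          · rw [hankelInner_sub_right, hankelInner_smul_right, hqo i hik hij, ho j hjk i hij]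
            simp
          · exact hankelInner_sub_projection _ _
        · intro i hi
          rw [Store.setReg_arr, f2 i hi, ha2, hrest i hi]
      · rw [exec_ite_of_not_holds _ _ (by simp [Test.Holds, NatExpr.eval, h1, e1]; omega)]
        refine ⟨⟨q, hqm, hqd, fun i hi _ => hqo i hi (by omega), hqs.congr (by simp)⟩, ?_⟩
        simpa using hrest)
  obtain ⟨⟨q, hqm, hqd, hqo, hqs⟩, hrest⟩ := key
  exact ⟨⟨q, hqm, hqd, fun j hj => hqo j hj (by omega), hqs⟩, hrest⟩

open Polynomial in
theorem exec_gramSchmidt (hr : rP < 10) (hP : s.nat rP = P)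
    (hc : ∀ m < 2 * P, s.arr 10 m 0 = Λ (X ^ m)) :
    ∃ p : ℕ → ℂ[X], (∀ k ≤ P, (p k).Monic) ∧ (∀ k ≤ P, (p k).natDegree = k) ∧
      (∀ j < P, hankelInner P Λ (p j) (p P) = 0) ∧
      ((gramSchmidt rP).exec s).HasRow P Λ P (p P) := by
  have hr10 : rP ≠ 10 := by omega
  have hr11 : rP ≠ 11 := by omega
  have hr12 : rP ≠ 12 := by omega
  have key := exec_forLoop_induct (s := s) (i := 10) (e := .add (.reg rP) (.const 1)) (n := P + 1)
    (c := .seq (hankelRow rP) (hankelReduce rP))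
    (fun n s' => ∃ p : ℕ → ℂ[X], (∀ k < n, (p k).Monic) ∧ (∀ k < n, (p k).natDegree = k) ∧
      (∀ j < n, ∀ i < j, hankelInner P Λ (p i) (p j) = 0) ∧ ∀ k < n, s'.HasRow P Λ k (p k))
    (by simp [NatExpr.eval, Store.setReg_nat, hr10, hP]) rfl ⟨0, by simp⟩ (by
      rintro k s' hk h1 h2 h3 ⟨p, hm, hd, ho, hp⟩
      have e2 : s'.nat rP = P := by
        rw [h2 rP hr10 (by
          simp [writesReg, hankelRow, hankelReduce, hankelDots, hankelSubtract, forLoop, hr12,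
            hr11]), hP]
      obtain ⟨f1, f2⟩ := exec_hankelRow (s := s') (Λ := Λ) hr e2 h1 (by omega)
        (by rw [h3 10 rfl]; exact hc)
      rw [exec_seq]
      set s2 := (hankelRow rP).exec s' with hs2
      obtain ⟨⟨q, hqm, hqd, hqo, hqs⟩, hrest⟩ := exec_hankelReduce (s := s2) (Λ := Λ) (P := P)
        (k := k) (p := p) hr
        (by rw [hs2, exec_nat _ (by simp [hankelRow, writesReg, forLoop, hr12]), e2])
        (by rw [hs2, exec_nat _ rfl, h1]) (by omega)
        (fun j hj => (hp j hj).congr (f2 j hj.ne)) hm hd ho f1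
      refine ⟨Function.update p k q, ?_, ?_, ?_, ?_⟩
      · intro i hi
        rcases Nat.lt_succ_iff_lt_or_eq.1 hi with hi | rfl
        · rw [Function.update_of_ne hi.ne]; exact hm i hi
        · simpa using hqm
      · intro i hi
        rcases Nat.lt_succ_iff_lt_or_eq.1 hi with hi | rfl
        · rw [Function.update_of_ne hi.ne]; exact hd i hi
        · simpa using hqd
      · intro j hj i hij
        rcases Nat.lt_succ_iff_lt_or_eq.1 hj with hj | rfl
        · rw [Function.update_of_ne hj.ne, Function.update_of_ne (by omega)]
          exact ho j hj i hij
        · rw [Function.update_self, Function.update_of_ne hij.ne]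
          exact hqo i hij
      · intro i hi
        rcases Nat.lt_succ_iff_lt_or_eq.1 hi with hi | rfl
        · rw [Function.update_of_ne hi.ne]
          exact (hp i hi).congr (by rw [Store.setReg_arr, hrest i hi.ne, f2 i hi.ne])
        · rw [Function.update_self]
          exact hqs.congr (by simp))
  obtain ⟨p, hm, hd, ho, hp⟩ := key
  exact ⟨p, fun k hk => hm k (by omega), fun k hk => hd k (by omega),
    fun j hj => ho P (by omega) j hj, hp P (by omega)⟩

end Program

/-! ### Prony's method: nodes as roots, weights by Lagrange polynomials -/

namespace Program

/-- The roots of the last orthogonalised polynomial. -/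
def hankelRoots (rP : ℕ) : Program :=
  .seq (forLoop 12 (.reg rP) (.setEntry 22 (.reg 12) (.const 0)
      (.entry 20 (.reg rP) (.add (.reg rP) (.reg 12)))))
    (.roots 22 (.reg rP) 11)

/-- Apply to the sequence in array 23 the Lagrange factor for the nodes `l` and `m`. -/
def applyFactor (rP : ℕ) : Program :=
  .ite (.eq (.entry 11 (.reg 11) (.const 0)) (.entry 11 (.reg 10) (.const 0))) .skip <|
    forLoop 12 (.reg rP) <| .setEntry 23 (.reg 12) (.const 0) <|
      .div (.sub (.entry 23 (.add (.reg 12) (.const 1)) (.const 0))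
          (.mul (.entry 11 (.reg 11) (.const 0)) (.entry 23 (.reg 12) (.const 0))))
        (.sub (.entry 11 (.reg 10) (.const 0)) (.entry 11 (.reg 11) (.const 0)))

/-- The weight of the node `l`, multiplied by the `o`-th power of the node. -/
def nodeWeight (rP : ℕ) (o : NatExpr) : Program :=
  .seq (forLoop 12 (.add (.reg rP) (.const 1)) (.setEntry 23 (.reg 12) (.const 0)
      (.entry 10 (.add (.reg 12) o) (.const 0)))) <|
  .seq (forLoop 11 (.reg rP) (applyFactor rP)) <|
  .setEntry 12 (.reg 10) (.const 0) (.entry 23 (.const 0) (.const 0))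

/-- Prony's method. -/
def prony (rP : ℕ) (o : NatExpr) : Program :=
  .seq (gramSchmidt rP) <| .seq (hankelRoots rP) <| forLoop 10 (.reg rP) (nodeWeight rP o)

variable {rP P : ℕ} {s : Store}

open Polynomial in
-- Only completeness of the list of roots is needed: repeated roots and roots that are not nodes are
-- dealt with when the weights are computed and the output is inserted.
theorem exec_hankelRoots {Λ : ℂ[X] →ₗ[ℂ] ℂ} (hr : rP < 10) (hP : s.nat rP = P) {p : ℂ[X]}
    (hp : s.HasRow P Λ P p) (hm : p.Monic) (hd : p.natDegree = P) {v : ℂ} (hv : p.eval v = 0) :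
    ∃ l < P, ((hankelRoots rP).exec s).arr 11 l 0 = v := by
  have hr12 : rP ≠ 12 := by omega
  set s1 := (forLoop 12 (.reg rP) (.setEntry 22 (.reg 12) (.const 0)
      (.entry 20 (.reg rP) (.add (.reg rP) (.reg 12))))).exec s with hs1
  obtain ⟨h1, -⟩ := exec_forLoop_setEntry (s := s) (i := 12) (e := .reg rP) (a := 22)
    (I := .reg 12) (J := .const 0) (u := .entry 20 (.reg rP) (.add (.reg rP) (.reg 12))) (n := P)
    (fun m => m) (fun _ => 0) (fun m => p.coeff m)
    (by simp [NatExpr.eval, Store.setReg_nat, hr12, hP]) (by intro m _ l hl h; omega)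
    (by
      intro m s' _ hm hs'
      simp [NatExpr.eval, hm])
    (by
      intro m s' hmP hm hs' ha _
      rw [ComplexExpr.eval, ha 20 (by decide)]
      simp only [NatExpr.eval, hm, hs' rP hr12, hP]
      rw [hp _ (by omega), hankelEntry, if_neg (by omega), Nat.add_sub_cancel_left])
  rw [← hs1] at h1
  have hP1 : s1.nat rP = P := (exec_nat _ (by simp [forLoop, writesReg, hr12]) s).trans hP
  have hroot : s1.rootList 22 P = p.roots.toList := by
    rw [Store.rootList]
    congr 2
    conv_rhs => rw [hm.as_sum, hd]
    congr 1
    exact Finset.sum_congr rfl fun m hm => by rw [h1 m (Finset.mem_range.1 hm)]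
  have hmem : v ∈ p.roots.toList := by
    rw [Multiset.mem_toList, mem_roots hm.ne_zero]
    exact hv
  obtain ⟨l, hl, hlv⟩ := List.mem_iff_getElem.1 hmem
  have hlP : l < P := by
    refine hl.trans_le ?_
    rw [Multiset.length_toList, ← hd]
    exact p.card_roots'
  refine ⟨l, hlP, ?_⟩
  have hex : (hankelRoots rP).exec s = s1.setRoots 22 P 11 := by
    simp [hankelRoots, ← hs1, NatExpr.eval, hP1]
  rw [hex, Store.setRoots_arr, if_pos ⟨rfl, hlP, rfl⟩, hroot, List.getD_eq_getElem _ _ hl, hlv]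

variable {ι : Type*} [Fintype ι] {z b : ι → ℂ}

/-- On sequences k ↦ z^k the shift S is multiplication by z, so (S - r)/(v - r) multiplies the
coefficient of each node by its Lagrange factor. Each factor uses up the last valid entry: of the P
+ 1 initial entries, entry 0 is the one left after P factors. The initial segment is read at offset
o' and ends at index P + o', which requires o' < P and yields the factor z^o'. -/
theorem exec_nodeWeight {o : NatExpr} {o' : ℕ} (hr : rP < 10) (hP : s.nat rP = P) {l : ℕ}
    (hl : s.nat 10 = l) (ho : ∀ s : Store, s.nat rP = P → o.eval s = o') (hoP : o' < P)
    (hc : ∀ m < 2 * P, s.arr 10 m 0 = ∑ i, b i * z i ^ m) :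
    ((nodeWeight rP o).exec s).arr 12 l 0 = ∑ i, b i * z i ^ o' *
        ∏ m ∈ Finset.range P, lagrangeFactor (s.arr 11 l 0) (s.arr 11 m 0) (z i) ∧
      ∀ i j, i ≠ l → ((nodeWeight rP o).exec s).arr 12 i j = s.arr 12 i j := by
  have hr12 : rP ≠ 12 := by omega
  have hr11 : rP ≠ 11 := by omega
  set s1 := (forLoop 12 (.add (.reg rP) (.const 1)) (.setEntry 23 (.reg 12) (.const 0)
      (.entry 10 (.add (.reg 12) o) (.const 0)))).exec s with hs1
  obtain ⟨h1, -⟩ := exec_forLoop_setEntry (s := s) (i := 12) (e := .add (.reg rP) (.const 1))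
    (a := 23) (I := .reg 12) (J := .const 0) (u := .entry 10 (.add (.reg 12) o) (.const 0))
    (n := P + 1) (fun m => m) (fun _ => 0) (fun m => ∑ i, b i * z i ^ o' * z i ^ m)
    (by simp [NatExpr.eval, Store.setReg_nat, hr12, hP]) (by intro m _ l hl h; omega)
    (by
      intro m s' _ hm hs'
      simp [NatExpr.eval, hm])
    (by
      intro m s' hmP hm hs' ha _
      rw [ComplexExpr.eval, ha 10 (by decide)]
      simp only [NatExpr.eval, hm, ho s' (by rw [hs' rP hr12, hP])]
      rw [hc _ (by omega)]
      exact Finset.sum_congr rfl fun i _ => by ring)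
  rw [← hs1] at h1
  have hn1 : ∀ r, r ≠ 12 → s1.nat r = s.nat r := fun r hr =>
    exec_nat _ (by simp [forLoop, writesReg, hr]) s
  have ha1 : ∀ a, a ≠ 23 → s1.arr a = s.arr a := fun a ha =>
    exec_arr _ (by simp [forLoop, writesArr, ha]) s
  set s2 := (forLoop 11 (.reg rP) (applyFactor rP)).exec s1 with hs2
  have h2 := exec_forLoop_induct (s := s1) (i := 11) (e := .reg rP) (n := P) (c := applyFactor rP)
    (fun n s' => ∀ k, k + n ≤ P → s'.arr 23 k 0 = ∑ i, b i * z i ^ o' * z i ^ k *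
        ∏ m ∈ Finset.range n, lagrangeFactor (s.arr 11 l 0) (s.arr 11 m 0) (z i))
    (by simp [NatExpr.eval, Store.setReg_nat, hr11, hn1 rP hr12, hP]) rfl
    (by
      intro k hk
      simpa using h1 k (by omega)) (by
      intro m s' hm g1 g2 g3 g4
      have e1 : s'.nat rP = P := by
        rw [g2 rP hr11 (by simp [applyFactor, writesReg, forLoop, hr12]), hn1 rP hr12, hP]
      have e2 : s'.nat 10 = l := by rw [g2 10 (by decide) rfl, hn1 10 (by decide), hl]
      have e3 : s'.arr 11 = s.arr 11 := by rw [g3 11 rfl, ha1 11 (by decide)]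
      intro k hk
      simp only [Finset.prod_range_succ, Store.setReg_arr]
      by_cases heq : s.arr 11 m 0 = s.arr 11 l 0
      · rw [applyFactor, exec_ite_of_holds _ _ (by
          simp [Test.Holds, ComplexExpr.eval, NatExpr.eval, g1, e2, e3, heq]), exec_skip,
          g4 k (by omega)]
        simp [lagrangeFactor, heq]
      · rw [applyFactor, exec_ite_of_not_holds _ _ (by
          simp [Test.Holds, ComplexExpr.eval, NatExpr.eval, g1, e2, e3, heq])]
        obtain ⟨f1, -⟩ := exec_forLoop_setEntry (s := s') (i := 12) (e := .reg rP)
          (a := 23) (I := .reg 12) (J := .const 0)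
          (u := .div (.sub (.entry 23 (.add (.reg 12) (.const 1)) (.const 0))
              (.mul (.entry 11 (.reg 11) (.const 0)) (.entry 23 (.reg 12) (.const 0))))
            (.sub (.entry 11 (.reg 10) (.const 0)) (.entry 11 (.reg 11) (.const 0))))
          (n := P) (fun m => m) (fun _ => 0)
          (fun k => (s'.arr 23 (k + 1) 0 - s.arr 11 m 0 * s'.arr 23 k 0) /
            (s.arr 11 l 0 - s.arr 11 m 0))
          (by simp [NatExpr.eval, Store.setReg_nat, hr12, e1]) (by intro m _ l hl h; omega)
          (by
            intro m s' _ hm hs'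
            simp [NatExpr.eval, hm])
          (by
            intro k s'' hkP hk hs'' ha h23
            simp only [ComplexExpr.eval, NatExpr.eval, hk, hs'' 11 (by decide), g1,
              hs'' 10 (by decide), e2, ha 11 (by decide), e3]
            -- At counter k, the entries k and k + 1 have not been overwritten yet, so the update in
            -- place uses the old sequence.
            rw [h23 (k + 1) 0 (by intro l hl h; omega), h23 k 0 (by intro l hl h; omega)])
        rw [f1 k (by omega), g4 k (by omega), g4 (k + 1) (by omega), Finset.mul_sum,
          ← Finset.sum_sub_distrib, Finset.sum_div]
        refine Finset.sum_congr rfl fun i _ => ?_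
        have hne : s.arr 11 l 0 - s.arr 11 m 0 ≠ 0 := sub_ne_zero.2 (Ne.symm heq)
        rw [lagrangeFactor, if_neg heq]
        field_simp
        ring)
  rw [← hs2] at h2
  have hex : (nodeWeight rP o).exec s = s2.setEntry 12 l 0 (s2.arr 23 0 0) := by
    have : s2.nat 10 = l := by rw [hs2, exec_nat _ rfl, hn1 10 (by decide), hl]
    simp [nodeWeight, ← hs1, ← hs2, NatExpr.eval, ComplexExpr.eval, this]
  have ha2 : s2.arr 12 = s.arr 12 := by rw [hs2, exec_arr _ rfl, ha1 12 (by decide)]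
  rw [hex]
  constructor
  · rw [Store.setEntry_arr_self, h2 0 (by omega)]
    simp
  · intro i j hi
    rw [Store.setEntry_arr, if_neg (by tauto), ha2]

/-- Prony's method finds the nodes with a nonzero weight. -/
theorem exec_prony {o : NatExpr} {o' : ℕ} (hr : rP < 10) (hP : s.nat rP = P)
    (ho : ∀ s : Store, s.nat rP = P → o.eval s = o') (hoP : o' < P)
    (hz : Function.Injective z) (hcard : Fintype.card ι ≤ P)
    (hc : ∀ m < 2 * P, s.arr 10 m 0 = ∑ i, b i * z i ^ m) (v w : ℂ) (hw : w ≠ 0) :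
    (∃ l < P, ((prony rP o).exec s).arr 11 l 0 = v ∧ ((prony rP o).exec s).arr 12 l 0 = w) ↔
      ∃ i, z i = v ∧ b i * z i ^ o' = w := by
  have hr12 : rP ≠ 12 := by omega
  have hr11 : rP ≠ 11 := by omega
  have hr10 : rP ≠ 10 := by omega
  obtain ⟨p, hm, hd, hort, hrow⟩ := exec_gramSchmidt (Λ := nodeSum z b) hr hP (by
    intro m hm
    rw [hc m hm, nodeSum_apply]
    simp)
  obtain ⟨q, hqm, hqd, hq⟩ := exists_monic_nodeSum_eq_zero z b hcard
  have hker := hankel_apply_eq_zero_of_orthogonal hm hd hort hqm hqd hq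
  have hzero := mul_eval_eq_zero_of_nodeSum hz hcard hker
  set s1 := (gramSchmidt rP).exec s with hs1
  have hw1 : (gramSchmidt rP).writesReg rP = false := by
    simp [gramSchmidt, writesReg, forLoop, hankelRow, hankelReduce, hankelDots, hankelSubtract,
      hr10, hr11, hr12]
  have hP1 : s1.nat rP = P := by rw [hs1, exec_nat _ hw1, hP]
  have hroots : ∀ i, b i ≠ 0 → ∃ l < P, ((hankelRoots rP).exec s1).arr 11 l 0 = z i := fun i hi =>
    exec_hankelRoots hr hP1 hrow (hm P le_rfl) (hd P le_rfl)
      ((mul_eq_zero.1 (hzero i)).resolve_left hi)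
  set s2 := (hankelRoots rP).exec s1 with hs2
  have hP2 : s2.nat rP = P := by
    rw [hs2, exec_nat _ (by simp [hankelRoots, writesReg, forLoop, hr12]), hP1]
  have hc2 : s2.arr 10 = s.arr 10 := by rw [hs2, exec_arr _ rfl, hs1, exec_arr _ rfl]
  have key := exec_forLoop_induct (s := s2) (i := 10) (e := .reg rP) (n := P)
    (c := nodeWeight rP o)
    (fun n s' => ∀ l < n, s'.arr 12 l 0 = ∑ i, b i * z i ^ o' *
        ∏ m ∈ Finset.range P, lagrangeFactor (s2.arr 11 l 0) (s2.arr 11 m 0) (z i))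
    (by simp [NatExpr.eval, Store.setReg_nat, hr10, hP2]) rfl (by simp) (by
      intro l s' hl h1 h2 h3 h4
      obtain ⟨f1, f2⟩ := exec_nodeWeight (s := s') (z := z) (b := b) hr
        (by
          rw [h2 rP hr10 (by
            simp [nodeWeight, applyFactor, writesReg, forLoop, hr12, hr11]), hP2])
        h1 ho hoP (by rw [h3 10 rfl, hc2]; exact hc)
      intro k hk
      rw [Store.setReg_arr]
      rcases Nat.lt_succ_iff_lt_or_eq.1 hk with hk | rfl
      · rw [f2 k 0 hk.ne, h4 k hk]
      · rw [f1, h3 11 rfl])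
  have hex : (prony rP o).exec s = (forLoop 10 (.reg rP) (nodeWeight rP o)).exec s2 := rfl
  have h11 : ((prony rP o).exec s).arr 11 = s2.arr 11 := by rw [hex, exec_arr _ rfl]
  rw [← hex] at key
  rw [h11]
  have hlag := sum_mul_prod_lagrangeFactor (b := fun i => b i * z i ^ o') (P := P)
    (r := fun m => s2.arr 11 m 0) hz (fun i hi => hroots i (left_ne_zero_of_mul hi))
  constructor
  · rintro ⟨l, hl, rfl, hlw⟩
    rw [key l hl] at hlw
    -- A root that is not a node receives the weight 0, contrary to w ≠ 0.
    by_contra! hcon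
    by_cases hex : ∃ i, z i = s2.arr 11 l 0
    · obtain ⟨i, hi⟩ := hex
      exact hcon i hi (((hlag _).1 i hi).symm.trans hlw)
    · push Not at hex
      exact hw (hlw.symm.trans ((hlag _).2 hex))
  · rintro ⟨i, rfl, hi⟩
    obtain ⟨l, hl, hlz⟩ := hroots i (left_ne_zero_of_mul (hi.trans_ne hw))
    refine ⟨l, hl, hlz, ?_⟩
    rw [key l hl, hlz]
    exact ((hlag _).1 i rfl).trans hi

end Program

/-! ### Lists of triplets -/

/-- The `k`-th row of array 3. -/
def Store.row (s : Store) (k : ℕ) : ℂ × ℂ × ℂ := (s.arr 3 k 0, s.arr 3 k 1, s.arr 3 k 2)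

/-- The rows of array 3 below register 20 list the elements of `S` without repetition, and the
other rows have third entry zero. -/
structure Store.Lists (s : Store) (S : Set (ℂ × ℂ × ℂ)) : Prop where
  eq_image : S = s.row '' Set.Iio (s.nat 20)
  injOn : Set.InjOn s.row (Set.Iio (s.nat 20))
  eq_zero : ∀ k, s.nat 20 ≤ k → s.arr 3 k 2 = 0

theorem Store.Lists.congr {s s' : Store} {S : Set (ℂ × ℂ × ℂ)} (h : s.Lists S)
    (hn : s'.nat 20 = s.nat 20) (ha : s'.arr 3 = s.arr 3) : s'.Lists S := by
  have hrow : s'.row = s.row := by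
    funext k
    simp [Store.row, ha]
  exact ⟨by rw [hrow, hn]; exact h.eq_image, by rw [hrow, hn]; exact h.injOn,
    by rw [ha, hn]; exact h.eq_zero⟩

theorem Store.Lists.ncard {s : Store} {S : Set (ℂ × ℂ × ℂ)} (h : s.Lists S) :
    S.ncard = s.nat 20 := by
  rw [h.eq_image, h.injOn.ncard_image, Set.ncard_eq_toFinset_card']
  simp

namespace Program

/-- Set the flag, register 21, if row `k` agrees with the candidate in array 4. -/
def compareRow : Program :=
  .ite (.eq (.entry 3 (.reg 12) (.const 0)) (.entry 4 (.const 0) (.const 0)))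
    (.ite (.eq (.entry 3 (.reg 12) (.const 1)) (.entry 4 (.const 0) (.const 1)))
      (.ite (.eq (.entry 3 (.reg 12) (.const 2)) (.entry 4 (.const 0) (.const 2)))
        (.setReg 21 (.const 1)) .skip) .skip) .skip

/-- Append the candidate in array 4 to the list. -/
def appendRow : Program :=
  .seq (.setEntry 3 (.reg 20) (.const 0) (.entry 4 (.const 0) (.const 0))) <|
  .seq (.setEntry 3 (.reg 20) (.const 1) (.entry 4 (.const 0) (.const 1))) <|
  .seq (.setEntry 3 (.reg 20) (.const 2) (.entry 4 (.const 0) (.const 2))) <|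
  .setReg 20 (.add (.reg 20) (.const 1))

/-- Append the candidate in array 4 unless it is in the list already. -/
def insertRow : Program :=
  .seq (.setReg 21 (.const 0)) <| .seq (forLoop 12 (.reg 2) compareRow) <|
  .ite (.natLe (.const 1) (.reg 21)) .skip appendRow

variable {s : Store}

theorem exec_compareRow {k : ℕ} (hk : s.nat 12 = k) (q : ℂ × ℂ × ℂ)
    (hq : q = (s.arr 4 0 0, s.arr 4 0 1, s.arr 4 0 2)) :
    (compareRow.exec s).nat 21 = open Classical in if s.row k = q then 1 else s.nat 21 := by
  subst hq
  simp only [compareRow, exec_ite, Test.Holds, ComplexExpr.eval, NatExpr.eval, hk, Store.row,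
    Prod.mk.injEq, exec_setReg, exec_skip]
  split_ifs with h1 h2 h3 <;> simp_all

/-- The comparison runs over P rows instead of the current length of the list, since register 20
changes and may not bound a loop under `sizesBelow`. Rows beyond the list have third entry 0 and
cannot match a candidate whose third entry is nonzero. -/
theorem exec_insertRow {S : Set (ℂ × ℂ × ℂ)} (hS : s.Lists S) {P : ℕ} (hP : s.nat 2 = P)
    (hcount : s.nat 20 ≤ P) {q : ℂ × ℂ × ℂ} (hq : q = (s.arr 4 0 0, s.arr 4 0 1, s.arr 4 0 2))
    (hq0 : q.2.2 ≠ 0) : (insertRow.exec s).Lists (insert q S) := by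
  set s0 := s.setReg 21 0 with hs0
  have key := exec_forLoop_induct (s := s0) (i := 12) (e := .reg 2) (n := P) (c := compareRow)
    (fun n s' => 1 ≤ s'.nat 21 ↔ ∃ k < n, s.row k = q)
    (by simp [NatExpr.eval, Store.setReg_nat, hs0, hP]) rfl
    (by simp [Store.setReg_nat, hs0]) (by
      intro k s' hk h1 h2 h3 h4
      have hrow : s'.row k = s.row k := by simp [Store.row, h3 3 rfl, hs0]
      rw [Store.setReg_nat_of_ne _ _ (by decide), exec_compareRow h1 q
        (by rw [h3 4 rfl, hs0]; exact hq), hrow]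
      split_ifs with h
      · exact ⟨fun _ => ⟨k, Nat.lt_succ_self k, h⟩, fun _ => le_rfl⟩
      · rw [h4]
        constructor
        · rintro ⟨l, hl, h'⟩
          exact ⟨l, by omega, h'⟩
        · rintro ⟨l, hl, h'⟩
          rcases Nat.lt_succ_iff_lt_or_eq.1 hl with hl | rfl
          · exact ⟨l, hl, h'⟩
          · exact absurd h' h)
  set s1 := (forLoop 12 (.reg 2) compareRow).exec s0 with hs1
  have hn : s1.nat 20 = s.nat 20 := by rw [hs1, exec_nat _ rfl, hs0]; rfl
  have ha : ∀ a, s1.arr a = s.arr a := fun a => by rw [hs1, exec_arr _ rfl, hs0]; rfl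
  have hmem : q ∈ S ↔ ∃ k < P, s.row k = q := by
    rw [hS.eq_image]
    constructor
    · rintro ⟨k, hk, h⟩
      exact ⟨k, lt_of_lt_of_le hk hcount, h⟩
    · rintro ⟨k, _, h⟩
      refine ⟨k, ?_, h⟩
      by_contra hk
      have := hS.eq_zero k (not_lt.1 hk)
      exact hq0 (by rw [← h]; exact this)
  have hex : insertRow.exec s =
      (Program.ite (.natLe (.const 1) (.reg 21)) .skip appendRow).exec s1 := rfl
  rw [hex]
  by_cases hqS : q ∈ S
  · rw [exec_ite_of_holds _ _ (by
      simp only [Test.Holds, NatExpr.eval]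
      exact key.2 (hmem.1 hqS)), exec_skip, Set.insert_eq_of_mem hqS]
    exact hS.congr hn (ha 3)
  · rw [exec_ite_of_not_holds _ _ (by
      simp only [Test.Holds, NatExpr.eval]
      exact fun h => hqS (hmem.2 (key.1 h)))]
    set s2 := appendRow.exec s1 with hs2
    have hn2 : s2.nat 20 = s.nat 20 + 1 := by
      simp [hs2, appendRow, NatExpr.eval, hn]
    have harr : ∀ k j, s2.arr 3 k j = if k = s.nat 20 ∧ j < 3 then s.arr 4 0 j else s.arr 3 k j := by
      intro k j
      simp only [hs2, appendRow, exec_seq, exec_setEntry, exec_setReg, Store.setReg_arr,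
        Store.setEntry_arr, NatExpr.eval, ComplexExpr.eval, Store.setEntry_nat, hn, ha]
      by_cases hk : k = s.nat 20
      · by_cases hj : j < 3
        · interval_cases j <;> simp [hk]
        · simp [hj, show j ≠ 0 by omega, show j ≠ 1 by omega, show j ≠ 2 by omega]
      · simp [hk]
    have hrow_lt : ∀ k < s.nat 20, s2.row k = s.row k := by
      intro k hk
      simp [Store.row, harr, hk.ne]
    have hrow_eq : s2.row (s.nat 20) = q := by
      simp [Store.row, harr, hq]
    have hIio : Set.Iio (s.nat 20 + 1) = insert (s.nat 20) (Set.Iio (s.nat 20)) := by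
      ext k
      simp
    have himage : s2.row '' Set.Iio (s.nat 20) = S := by
      rw [hS.eq_image]
      exact Set.image_congr fun k hk => hrow_lt k hk
    refine ⟨?_, ?_, ?_⟩
    · rw [hn2, hIio, Set.image_insert_eq, hrow_eq, himage]
    · rw [hn2, hIio, Set.injOn_insert (by simp), himage, hrow_eq]
      exact ⟨fun k hk l hl h => hS.injOn hk hl (by
        rwa [hrow_lt k hk, hrow_lt l hl] at h), hqS⟩
    · intro k hk
      rw [hn2] at hk
      rw [harr, if_neg (by omega), hS.eq_zero k (by omega)]

/-! ### The Doppler shifts of one delay -/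

/-- The expression for `2π`. -/
def twoPi : ComplexExpr :=
  .mul (.ofNat (.const 2)) (.arg (.sub (.ofNat (.const 0)) (.ofNat (.const 1))))

theorem eval_twoPi (s : Store) : twoPi.eval s = 2 * Real.pi := by
  simp [twoPi, ComplexExpr.eval, NatExpr.eval, Complex.arg_neg_one]

/-- Collect in array 10 the weights of the pulses with the delay in array 16, divided by the
entries of the probing sequence. -/
def collectPulses : Program :=
  forLoop 15 (.reg 1) <| .seq (.setEntry 10 (.reg 15) (.const 0) (.ofNat (.const 0))) <|
    forLoop 16 (.reg 2) <|
      .ite (.eq (.entry 14 (.reg 16) (.const 0)) (.ofNat (.const 0))) .skip <|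
      .ite (.eq (.entry 13 (.reg 16) (.const 0)) (.add (.entry 16 (.const 0) (.const 0))
          (.mul (.ofNat (.reg 15)) (.entry 0 (.const 0) (.const 0)))))
        (.setEntry 10 (.reg 15) (.const 0)
          (.div (.entry 14 (.reg 16) (.const 0)) (.entry 1 (.reg 15) (.const 0)))) .skip

/-- The two hypotheses on A say that a stored nonzero weight at time τ + nT can only be A n, and
that a nonzero A n is stored. Roots that carry no echo have weight 0 and are skipped, and a pulse
that is not found has A n = 0, which is the default value written first. -/
theorem exec_collectPulses {N P : ℕ} (hN : s.nat 1 = N) (hP : s.nat 2 = P) {τ T : ℂ}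
    (hτ : s.arr 16 0 0 = τ) (hT : s.arr 0 0 0 = T) {A : ℕ → ℂ}
    (hA : ∀ n < N, ∀ l < P, s.arr 14 l 0 ≠ 0 → s.arr 13 l 0 = τ + n * T → s.arr 14 l 0 = A n)
    (hA' : ∀ n < N, A n ≠ 0 → ∃ l < P, s.arr 14 l 0 ≠ 0 ∧ s.arr 13 l 0 = τ + n * T) :
    ∀ n < N, (collectPulses.exec s).arr 10 n 0 = A n / s.arr 1 n 0 := by
  classical
  refine exec_forLoop_induct (fun k s' => ∀ n < k, s'.arr 10 n 0 = A n / s.arr 1 n 0)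
    (by simp [NatExpr.eval, Store.setReg_nat, hN]) rfl (by simp) ?_
  intro n s' hn h1 h2 h3 h4
  set s1 := exec (.setEntry 10 (.reg 15) (.const 0) (.ofNat (.const 0))) s' with hs1
  have hs1' : s1 = s'.setEntry 10 n 0 0 := by
    simp [hs1, NatExpr.eval, ComplexExpr.eval, h1]
  have key := exec_forLoop_induct (s := s1) (i := 16) (e := .reg 2) (n := P)
    (c := .ite (.eq (.entry 14 (.reg 16) (.const 0)) (.ofNat (.const 0))) .skip <|
      .ite (.eq (.entry 13 (.reg 16) (.const 0)) (.add (.entry 16 (.const 0) (.const 0))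
          (.mul (.ofNat (.reg 15)) (.entry 0 (.const 0) (.const 0)))))
        (.setEntry 10 (.reg 15) (.const 0)
          (.div (.entry 14 (.reg 16) (.const 0)) (.entry 1 (.reg 15) (.const 0)))) .skip)
    (fun k s'' => (s''.arr 10 n 0 = if ∃ l < k, s.arr 14 l 0 ≠ 0 ∧ s.arr 13 l 0 = τ + n * T then
        A n / s.arr 1 n 0 else 0) ∧ ∀ m, m ≠ n → s''.arr 10 m 0 = s'.arr 10 m 0)
    (by simp [NatExpr.eval, Store.setReg_nat, hs1', h2 2 (by decide) rfl, hP]) rfl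
    (by
      refine ⟨by simp [hs1'], fun m hm => ?_⟩
      rw [Store.setReg_arr, hs1', Store.setEntry_arr, if_neg (by tauto)]) (by
      rintro k s'' hk g1 g2 g3 ⟨g4, g5⟩
      have e : ∀ a, a ≠ 10 → s''.arr a = s.arr a := fun a ha => by
        rw [g3 a (by simpa [writesArr] using ha), hs1', Store.setEntry_arr_of_ne _ _ _ _ ha,
          h3 a (by simpa [writesArr, forLoop] using ha)]
      have e15 : s''.nat 15 = n := by rw [g2 15 (by decide) rfl, hs1']; exact h1
      have hsplit : (∃ l < k + 1, s.arr 14 l 0 ≠ 0 ∧ s.arr 13 l 0 = τ + n * T) ↔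
          (∃ l < k, s.arr 14 l 0 ≠ 0 ∧ s.arr 13 l 0 = τ + n * T) ∨
            (s.arr 14 k 0 ≠ 0 ∧ s.arr 13 k 0 = τ + n * T) := by
        constructor
        · rintro ⟨l, hl, h⟩
          rcases Nat.lt_succ_iff_lt_or_eq.1 hl with hl | rfl
          exacts [.inl ⟨l, hl, h⟩, .inr h]
        · rintro (⟨l, hl, h⟩ | h)
          exacts [⟨l, by omega, h⟩, ⟨k, by omega, h⟩]
      by_cases c1 : s.arr 14 k 0 = 0
      · rw [exec_ite_of_holds _ _ (by
          simp [Test.Holds, ComplexExpr.eval, NatExpr.eval, g1, e 14 (by decide), c1]), exec_skip]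
        simp only [hsplit, Store.setReg_arr, c1, ne_eq, not_true_eq_false, false_and, or_false]
        exact ⟨g4, g5⟩
      rw [exec_ite_of_not_holds _ _ (by
          simp [Test.Holds, ComplexExpr.eval, NatExpr.eval, g1, e 14 (by decide), c1])]
      by_cases c2 : s.arr 13 k 0 = τ + n * T
      · rw [exec_ite_of_holds _ _ (by
          simp [Test.Holds, ComplexExpr.eval, NatExpr.eval, g1, e 13 (by decide),
            e 16 (by decide), e 0 (by decide), e15, c2, hτ, hT])]
        simp only [exec_setEntry, NatExpr.eval, ComplexExpr.eval, Store.setReg_arr, e15, g1,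
          e 14 (by decide), e 1 (by decide)]
        rw [Store.setEntry_arr_self, if_pos ⟨k, by omega, c1, c2⟩, hA n hn k hk c1 c2]
        refine ⟨rfl, fun m hm => ?_⟩
        rw [Store.setEntry_arr, if_neg (by tauto), g5 m hm]
      · rw [exec_ite_of_not_holds _ _ (by
          simp [Test.Holds, ComplexExpr.eval, NatExpr.eval, g1, e 13 (by decide),
            e 16 (by decide), e 0 (by decide), e15, c2, hτ, hT]), exec_skip]
        simp only [hsplit, Store.setReg_arr, c2, and_false, or_false]
        exact ⟨g4, g5⟩)
  intro m hm
  rw [exec_seq, Store.setReg_arr, ← hs1]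
  rcases Nat.lt_succ_iff_lt_or_eq.1 hm with hm | rfl
  · rw [key.2 m hm.ne, h4 m hm]
  · rw [key.1]
    split_ifs with h
    · rfl
    · have : A m = 0 := by
        by_contra hne
        exact h (hA' m hn hne)
      simp [this]

/-- Insert the triplets that correspond to the output of Prony's method for one delay. -/
def emitTriplets : Program :=
  forLoop 15 (.reg 3) <| .ite (.eq (.entry 12 (.reg 15) (.const 0)) (.ofNat (.const 0))) .skip <|
    .seq (.setEntry 4 (.const 0) (.const 0) (.entry 16 (.const 0) (.const 0))) <|
    .seq (.setEntry 4 (.const 0) (.const 1) (.div (.arg (.entry 11 (.reg 15) (.const 0)))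
      (.mul twoPi (.entry 0 (.const 0) (.const 0))))) <|
    .seq (.setEntry 4 (.const 0) (.const 2) (.entry 12 (.reg 15) (.const 0))) insertRow

/-- The finite set R, later the set of true triplets, bounds the length of the list by P, so that
`insertRow` compares with the whole list. -/
theorem exec_emitTriplets {S : Set (ℂ × ℂ × ℂ)} (hS : s.Lists S) {P' P : ℕ} (hP' : s.nat 3 = P')
    (hP : s.nat 2 = P) {τ T : ℂ} (hτ : s.arr 16 0 0 = τ) (hT : s.arr 0 0 0 = T)
    {R : Set (ℂ × ℂ × ℂ)} (hRf : R.Finite) (hRP : R.ncard ≤ P) (hSR : S ⊆ R)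
    (hR : ∀ j < P', s.arr 12 j 0 ≠ 0 →
      (τ, ((s.arr 11 j 0).arg : ℂ) / (2 * Real.pi * T), s.arr 12 j 0) ∈ R) :
    ∃ S', (emitTriplets.exec s).Lists S' ∧ S ⊆ S' ∧ S' ⊆ R ∧ ∀ j < P', s.arr 12 j 0 ≠ 0 →
      (τ, ((s.arr 11 j 0).arg : ℂ) / (2 * Real.pi * T), s.arr 12 j 0) ∈ S' := by
  refine exec_forLoop_induct (fun k s' => ∃ S', s'.Lists S' ∧ S ⊆ S' ∧ S' ⊆ R ∧
      ∀ j < k, s.arr 12 j 0 ≠ 0 →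
      (τ, ((s.arr 11 j 0).arg : ℂ) / (2 * Real.pi * T), s.arr 12 j 0) ∈ S')
    (by simp [NatExpr.eval, Store.setReg_nat, hP']) rfl
    ⟨S, hS.congr rfl rfl, subset_rfl, hSR, by simp⟩ ?_
  rintro k s' hk h1 h2 h3 ⟨S', g1, g2, g3, g4⟩
  by_cases c : s.arr 12 k 0 = 0
  · rw [exec_ite_of_holds _ _ (by
      simp [Test.Holds, ComplexExpr.eval, NatExpr.eval, h1, h3 12 rfl, c]), exec_skip]
    refine ⟨S', g1.congr rfl rfl, g2, g3, fun j hj hj0 => ?_⟩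
    rcases Nat.lt_succ_iff_lt_or_eq.1 hj with hj | rfl
    · exact g4 j hj hj0
    · exact absurd c hj0
  · rw [exec_ite_of_not_holds _ _ (by
      simp [Test.Holds, ComplexExpr.eval, NatExpr.eval, h1, h3 12 rfl, c]), exec_seq, exec_seq,
      exec_seq]
    set s1 := exec _ (exec _ (exec _ s')) with hs1
    have hn : s1.nat = s'.nat := rfl
    have ha : s1.arr 3 = s'.arr 3 := by
      rw [hs1, exec_arr _ rfl, exec_arr _ rfl, exec_arr _ rfl]
    have hl := g1.congr (s' := s1) (by rw [hn]) ha
    have hq := exec_insertRow hl (P := P) (by rw [hn, h2 2 (by decide) rfl, hP]) (by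
        rw [← hl.ncard]
        exact (Set.ncard_le_ncard g3 hRf).trans hRP)
      (q := (τ, ((s.arr 11 k 0).arg : ℂ) / (2 * Real.pi * T), s.arr 12 k 0)) (by
        simp [hs1, Store.setEntry_arr, ComplexExpr.eval, NatExpr.eval, eval_twoPi, h1,
          h3 16 rfl, h3 11 rfl, h3 12 rfl, h3 0 rfl, hτ, hT]) c
    refine ⟨_, hq.congr rfl rfl, g2.trans (Set.subset_insert _ _),
      Set.insert_subset (hR k hk c) g3, fun j hj hj0 => ?_⟩
    rcases Nat.lt_succ_iff_lt_or_eq.1 hj with hj | rfl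
    · exact Set.mem_insert_of_mem _ (g4 j hj hj0)
    · exact Set.mem_insert _ _

end Program

/-! ### Pulse weights and nodes -/

namespace ParametricSystem

variable (H : ParametricSystem)

/-- The triplets as the range of an injective family. -/
theorem triplets_eq_range : H.triplets =
    Set.range fun p : (i : Fin H.numDelays) × Fin (H.numDopplers i) =>
      ((H.τ p.1 : ℂ), (H.ν p.1 p.2 : ℂ), H.α p.1 p.2) := by
  ext q
  simp [triplets, eq_comm]

theorem triplets_finite : H.triplets.Finite := by
  rw [triplets_eq_range]
  exact Set.finite_range _

theorem mem_triplets (i : Fin H.numDelays) (j : Fin (H.numDopplers i)) :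
    ((H.τ i : ℂ), (H.ν i j : ℂ), H.α i j) ∈ H.triplets := ⟨i, j, rfl⟩

theorem ncard_triplets : H.triplets.ncard = H.numPairs := by
  rw [triplets_eq_range, Set.ncard_range_of_injective, Nat.card_eq_fintype_card]
  · simp [numPairs]
  · rintro ⟨i, j⟩ ⟨i', j'⟩ h
    simp only [Prod.mk.injEq, Complex.ofReal_inj] at h
    obtain rfl := H.τ_injective h.1
    obtain rfl := H.ν_injective i h.2.1
    rfl

theorem numDopplers_le_maxDopplers (i : Fin H.numDelays) : H.numDopplers i ≤ H.maxDopplers :=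
  Finset.le_sup (f := H.numDopplers) (Finset.mem_univ i)

theorem maxDopplers_pos : 0 < H.maxDopplers :=
  (H.numDopplers_pos ⟨0, H.numDelays_pos⟩).trans_le (H.numDopplers_le_maxDopplers _)

theorem numPairs_le : H.numPairs ≤ H.numDelays * H.maxDopplers := by
  refine (Finset.sum_le_card_nsmul _ _ _ fun i _ => H.numDopplers_le_maxDopplers i).trans ?_
  simp

/-- The weight of the echo of the `n`-th pulse with the `i`-th delay. -/
def pulseWeight (T : ℝ) (x : ℕ → ℂ) (i : Fin H.numDelays) (n : ℕ) : ℂ :=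
  ∑ j, H.α i j * x n * Complex.exp (2 * Real.pi * Complex.I * H.ν i j * (n * T))

/-- The phase rotation of a Doppler shift from one pulse to the next. -/
def dopplerNode (T : ℝ) (i : Fin H.numDelays) (j : Fin (H.numDopplers i)) : ℂ :=
  Complex.exp ((2 * Real.pi * H.ν i j * T : ℝ) * Complex.I)

variable {H} {T : ℝ} {x : ℕ → ℂ}

theorem pulseWeight_eq (i : Fin H.numDelays) (n : ℕ) :
    H.pulseWeight T x i n = (∑ j, H.α i j * H.dopplerNode T i j ^ n) * x n := by
  rw [pulseWeight, Finset.sum_mul]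
  refine Finset.sum_congr rfl fun j _ => ?_
  rw [dopplerNode, ← Complex.exp_nat_mul, mul_right_comm]
  congr 3
  push_cast
  ring

/-- The phase 2πνT lies in (-π, π), so the principal argument has no ambiguity. -/
theorem arg_dopplerNode {i : Fin H.numDelays} {j : Fin (H.numDopplers i)}
    (h : |H.ν i j * T| < 1 / 2) : (H.dopplerNode T i j).arg = 2 * Real.pi * H.ν i j * T := by
  rw [abs_lt] at h
  rw [dopplerNode, Complex.arg_exp_mul_I, toIocMod_eq_self]
  have := Real.pi_pos
  constructor <;> nlinarith

theorem dopplerNode_injective (hT : 0 < T) {i : Fin H.numDelays}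
    (h : ∀ j, |H.ν i j * T| < 1 / 2) : Function.Injective (H.dopplerNode T i) := by
  intro j k hjk
  apply H.ν_injective i
  have h1 := congrArg Complex.arg hjk
  rw [arg_dopplerNode (h j), arg_dopplerNode (h k)] at h1
  have := Real.pi_pos
  have h2 : 2 * Real.pi * T ≠ 0 := by positivity
  exact mul_left_cancel₀ h2 (by linarith)

/-- Single pulses may cancel, but not all of them: by the Vandermonde argument with p = 1, the
vanishing of N ≥ K_ν,i consecutive weights would force every α_ij to vanish. So every delay leaves a
visible echo. -/
theorem exists_pulseWeight_ne_zero (hT : 0 < T) {i : Fin H.numDelays}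
    (h : ∀ j, |H.ν i j * T| < 1 / 2) {N : ℕ} (hN : H.numDopplers i ≤ N) (hx : ∀ n < N, x n ≠ 0) :
    ∃ n < N, H.pulseWeight T x i n ≠ 0 := by
  by_contra! hcon
  have h1 := mul_eval_eq_zero_of_nodeSum (P := N) (b := H.α i) (p := 1) (dopplerNode_injective hT h)
    (by simpa using hN) (fun m hm => by
      have := hcon m hm
      rw [pulseWeight_eq] at this
      rw [nodeSum_apply]
      simpa [hx m hm] using this) ⟨0, H.numDopplers_pos i⟩
  simp [H.α_ne_zero] at h1

end ParametricSystem

theorem eq_of_add_nat_mul_eq {T a b : ℝ} (ha : a ∈ Set.Ico 0 T) (hb : b ∈ Set.Ico 0 T) {m n : ℕ}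
    (h : a + m * T = b + n * T) : m = n ∧ a = b := by
  have hT : 0 < T := ha.1.trans_lt ha.2
  have h1 : m = n := by
    rcases lt_trichotomy m n with hmn | hmn | hmn
    · have : (m : ℝ) + 1 ≤ n := by exact_mod_cast hmn
      nlinarith [ha.1, ha.2, hb.1, hb.2]
    · exact hmn
    · have : (n : ℝ) + 1 ≤ m := by exact_mod_cast hmn
      nlinarith [ha.1, ha.2, hb.1, hb.2]
  subst h1
  exact ⟨rfl, by linarith⟩

/-! ### From the echoes to the triplets -/

/-- The memory holds the delays `τ i + n T` and the weights of all echoes. -/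
structure Store.HasEchoes (s : Store) (H : ParametricSystem) (T : ℝ) (N P P' : ℕ) (x : ℕ → ℂ) :
    Prop where
  nat_one : s.nat 1 = N
  nat_two : s.nat 2 = P
  nat_three : s.nat 3 = P'
  interval : s.arr 0 0 0 = T
  probe : ∀ n < N, s.arr 1 n 0 = x n
  echo : ∀ u w : ℂ, w ≠ 0 → ((∃ l < P, s.arr 13 l 0 = u ∧ s.arr 14 l 0 = w) ↔
    ∃ i, ∃ n < N, H.τ i + n * T = u ∧ H.pulseWeight T x i n = w)

theorem Store.HasEchoes.congr {s s' : Store} {H : ParametricSystem} {T : ℝ} {N P P' : ℕ}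
    {x : ℕ → ℂ} (h : s.HasEchoes H T N P P' x) (h1 : s'.nat 1 = s.nat 1) (h2 : s'.nat 2 = s.nat 2)
    (h3 : s'.nat 3 = s.nat 3) (ha0 : s'.arr 0 = s.arr 0) (ha1 : s'.arr 1 = s.arr 1)
    (ha2 : s'.arr 13 = s.arr 13) (ha3 : s'.arr 14 = s.arr 14) : s'.HasEchoes H T N P P' x :=
  ⟨h1 ▸ h.nat_one, h2 ▸ h.nat_two, h3 ▸ h.nat_three, ha0 ▸ h.interval, ha1 ▸ h.probe,
    ha2 ▸ ha3 ▸ h.echo⟩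

namespace Program

/-- Find the triplets with the delay `t - n T`, where `t` is entry `l` of array 13. -/
def delayStep : Program :=
  .seq (.setEntry 16 (.const 0) (.const 0) (.sub (.entry 13 (.reg 13) (.const 0))
    (.mul (.ofNat (.reg 14)) (.entry 0 (.const 0) (.const 0))))) <|
  .ite (.reLe (.ofNat (.const 0)) (.entry 16 (.const 0) (.const 0)))
    (.ite (.reLe (.entry 0 (.const 0) (.const 0)) (.entry 16 (.const 0) (.const 0))) .skip
      (.seq collectPulses (.seq (prony 3 (.const 0)) emitTriplets))) .skip

/-- Find all triplets. -/
def findTriplets : Program := forLoop 13 (.reg 2) (forLoop 14 (.reg 1) delayStep)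

variable {s : Store} {H : ParametricSystem} {T : ℝ} {N P P' : ℕ} {x : ℕ → ℂ}

/-- For a candidate τ with real part in [0, T), uniqueness of the quotient and remainder modulo T
shows that an echo at time τ + nT belongs to the n-th pulse and to the delay τ. Soundness holds for
every candidate, completeness for those that are delays. -/
theorem exec_delayStep (hs : s.HasEchoes H T N P P' x) (hτ : ∀ i, H.τ i ∈ Set.Ico 0 T)
    (hν : ∀ i j, |H.ν i j * T| < 1 / 2) (hx : ∀ n < N, x n ≠ 0) (hP' : ∀ i, H.numDopplers i ≤ P')
    (hN : 2 * P' ≤ N) (hP : H.numPairs ≤ P) {S : Set (ℂ × ℂ × ℂ)} (hS : s.Lists S)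
    (hSH : S ⊆ H.triplets) {l n₀ : ℕ} (hl : s.nat 13 = l) (hn₀ : s.nat 14 = n₀) :
    ∃ S', (delayStep.exec s).Lists S' ∧ S ⊆ S' ∧ S' ⊆ H.triplets ∧
      ∀ i, s.arr 13 l 0 = H.τ i + n₀ * T → ∀ j, ((H.τ i : ℂ), (H.ν i j : ℂ), H.α i j) ∈ S' := by
  have i₀ : Fin H.numDelays := ⟨0, H.numDelays_pos⟩
  have hT : 0 < T := (hτ i₀).1.trans_lt (hτ i₀).2
  have hP'0 : 0 < P' := (H.numDopplers_pos i₀).trans_le (hP' i₀)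
  set τ : ℂ := s.arr 13 l 0 - n₀ * T with hτdef
  have hiff : ∀ i, s.arr 13 l 0 = H.τ i + n₀ * T ↔ τ = H.τ i := fun i => by
    rw [hτdef, sub_eq_iff_eq_add]
  simp only [hiff]
  rw [delayStep, exec_seq]
  set s1 := exec _ s with hs1
  have hn1 : s1.nat = s.nat := rfl
  have ha1 : ∀ a, a ≠ 16 → s1.arr a = s.arr a := fun a ha =>
    exec_arr _ (by simpa [writesArr] using ha) s
  have h16 : s1.arr 16 0 0 = τ := by
    simp [hs1, ComplexExpr.eval, NatExpr.eval, hl, hn₀, hs.interval, hτdef]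
  have hs1E : s1.HasEchoes H T N P P' x :=
    hs.congr (by rw [hn1]) (by rw [hn1]) (by rw [hn1]) (ha1 _ (by decide)) (ha1 _ (by decide))
      (ha1 _ (by decide)) (ha1 _ (by decide))
  have hS1 : s1.Lists S := hS.congr (by rw [hn1]) (ha1 _ (by decide))
  by_cases c1 : 0 ≤ τ.re
  swap
  · rw [exec_ite_of_not_holds _ _ (by simpa [Test.Holds, ComplexExpr.eval, NatExpr.eval, h16] using c1)]
    refine ⟨S, hS1, subset_rfl, hSH, fun i hi => ?_⟩
    rw [hi] at c1
    exact absurd (hτ i).1 (by simpa using c1)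
  rw [exec_ite_of_holds _ _ (by simpa [Test.Holds, ComplexExpr.eval, NatExpr.eval, h16] using c1)]
  by_cases c2 : T ≤ τ.re
  · rw [exec_ite_of_holds _ _ (by
      simpa [Test.Holds, ComplexExpr.eval, NatExpr.eval, h16, hs1E.interval] using c2)]
    refine ⟨S, hS1, subset_rfl, hSH, fun i hi => ?_⟩
    rw [hi] at c2
    exact absurd (hτ i).2 (by simpa using c2)
  rw [exec_ite_of_not_holds _ _ (by
    simpa [Test.Holds, ComplexExpr.eval, NatExpr.eval, h16, hs1E.interval] using c2), exec_seq,
    exec_seq]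
  have hmatch : ∀ n < N, ∀ k < P, s1.arr 14 k 0 ≠ 0 → s1.arr 13 k 0 = τ + n * T →
      ∃ i, τ = H.τ i ∧ s1.arr 14 k 0 = H.pulseWeight T x i n := by
    intro n _ k hk h0 h1
    obtain ⟨i, m, hm, h2, h3⟩ := (hs1E.echo _ _ h0).1 ⟨k, hk, h1, rfl⟩
    have h4 := congrArg Complex.re h2
    simp only [Complex.add_re, Complex.ofReal_re, Complex.mul_re, Complex.natCast_re,
      Complex.natCast_im, Complex.ofReal_im, mul_zero, sub_zero] at h4
    obtain ⟨rfl, -⟩ := eq_of_add_nat_mul_eq (hτ i) ⟨c1, not_le.1 c2⟩ h4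
    exact ⟨i, (add_right_cancel h2).symm, h3.symm⟩
  set s2 := collectPulses.exec s1 with hs2
  set s3 := (prony 3 (.const 0)).exec s2 with hs3
  have hn2 : s2.nat 3 = P' := by rw [hs2, exec_nat _ rfl, hs1E.nat_three]
  -- Stated for a general exponential sum, since it is used for the Doppler nodes of a true delay
  -- and, with no nodes at all, for a candidate that is no delay: then the collected sequence is
  -- zero and nothing is emitted.
  have emit : ∀ {ι : Type} [Fintype ι] (z b : ι → ℂ), Function.Injective z → Fintype.card ι ≤ P' →
      (∀ n < 2 * P', s2.arr 10 n 0 = ∑ i, b i * z i ^ n) →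
      (∀ i, b i ≠ 0 → (τ, ((z i).arg : ℂ) / (2 * Real.pi * T), b i) ∈ H.triplets) →
      ∃ S', (emitTriplets.exec s3).Lists S' ∧ S ⊆ S' ∧ S' ⊆ H.triplets ∧
        ∀ i, b i ≠ 0 → (τ, ((z i).arg : ℂ) / (2 * Real.pi * T), b i) ∈ S' := by
    intro ι _ z b hz hcard hc hmem
    have hpr := fun v w (hw : w ≠ 0) => exec_prony (s := s2) (rP := 3) (o := .const 0) (o' := 0)
      (by decide) hn2 (fun _ _ => rfl) hP'0 hz hcard hc v w hw
    rw [← hs3] at hpr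
    obtain ⟨S', h1, h2, h3, h4⟩ := exec_emitTriplets (s := s3) (S := S) (P' := P') (P := P)
      (τ := τ) (T := T) (R := H.triplets)
      (hS1.congr (by rw [hs3, exec_nat _ rfl, hs2, exec_nat _ rfl])
        (by rw [hs3, exec_arr _ rfl, hs2, exec_arr _ rfl]))
      (by rw [hs3, exec_nat _ rfl, hn2])
      (by rw [hs3, exec_nat _ rfl, hs2, exec_nat _ rfl, hs1E.nat_two])
      (by rw [hs3, exec_arr _ rfl, hs2, exec_arr _ rfl, h16])
      (by rw [hs3, exec_arr _ rfl, hs2, exec_arr _ rfl, hs1E.interval])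
      H.triplets_finite (by rw [H.ncard_triplets]; exact hP) hSH (by
        intro j hj hj0
        obtain ⟨i, hi1, hi2⟩ := (hpr _ _ hj0).1 ⟨j, hj, rfl, rfl⟩
        rw [pow_zero, mul_one] at hi2
        rw [← hi1, ← hi2]
        exact hmem i (by rwa [hi2]))
    refine ⟨S', h1, h2, h3, fun i hi => ?_⟩
    obtain ⟨j, hj, hj1, hj2⟩ := (hpr (z i) (b i) hi).2 ⟨i, rfl, by simp⟩
    have := h4 j hj (by rwa [hj2])
    rwa [hj1, hj2] at this
  have hcollect := fun A => exec_collectPulses (s := s1) (A := A) hs1E.nat_one hs1E.nat_two h16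
    hs1E.interval
  rw [← hs2] at hcollect
  by_cases hex : ∃ i, τ = H.τ i
  · obtain ⟨i, hi⟩ := hex
    have harg : ∀ j, ((H.dopplerNode T i j).arg : ℂ) / (2 * Real.pi * T) = H.ν i j := by
      intro j
      rw [H.arg_dopplerNode (hν i j)]
      have hT' : (T : ℂ) ≠ 0 := by exact_mod_cast hT.ne'
      have hpi : (Real.pi : ℂ) ≠ 0 := by exact_mod_cast Real.pi_ne_zero
      push_cast
      field_simp
    obtain ⟨S', h1, h2, h3, h4⟩ := emit (H.dopplerNode T i) (H.α i)
      (H.dopplerNode_injective hT (hν i)) (by simpa using hP' i) (by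
        intro n hn
        rw [hcollect (H.pulseWeight T x i) _ _ n (hn.trans_le hN), hs1E.probe n (hn.trans_le hN),
          H.pulseWeight_eq, mul_div_cancel_right₀ _ (hx n (hn.trans_le hN))]
        · intro n hn k hk h0 hk'
          obtain ⟨i', hi', h'⟩ := hmatch n hn k hk h0 hk'
          rw [hi] at hi'
          obtain rfl := H.τ_injective (by exact_mod_cast hi')
          exact h'
        · intro n hn h0
          obtain ⟨k, hk, hk1, hk2⟩ := (hs1E.echo (τ + n * T) _ h0).2 ⟨i, n, hn, by rw [hi], rfl⟩
          exact ⟨k, hk, by rwa [hk2], hk1⟩)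
      (by
        intro j _
        rw [harg, hi]
        exact H.mem_triplets i j)
    refine ⟨S', h1, h2, h3, fun i' hi' j => ?_⟩
    rw [hi] at hi'
    obtain rfl := H.τ_injective (by exact_mod_cast hi')
    have := h4 j (H.α_ne_zero i j)
    rwa [harg, hi] at this
  · obtain ⟨S', h1, h2, h3, -⟩ := emit (ι := Empty) (fun _ => 0) (fun _ => 0)
      (fun a => a.elim) (by simp) (by
        intro n hn
        rw [hcollect (fun _ => 0) _ (by simp) n (hn.trans_le hN)]
        · simp
        · intro n hn k hk h0 hk'
          obtain ⟨i', hi', -⟩ := hmatch n hn k hk h0 hk'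
          exact absurd ⟨i', hi'⟩ hex) (fun i => i.elim)
    exact ⟨S', h1, h2, h3, fun i hi => absurd ⟨i, hi⟩ hex⟩

/-- The pulse number of an echo is not computed; all pairs (l, n) are tried, and those with t_l - nT
outside [0, T) are discarded. Every delay is reached, because it has at least one echo of nonzero
weight. -/
theorem exec_findTriplets (hs : s.HasEchoes H T N P P' x) (hτ : ∀ i, H.τ i ∈ Set.Ico 0 T)
    (hν : ∀ i j, |H.ν i j * T| < 1 / 2) (hx : ∀ n < N, x n ≠ 0) (hP' : ∀ i, H.numDopplers i ≤ P')
    (hN : 2 * P' ≤ N) (hP : H.numPairs ≤ P) (hS : s.Lists ∅) :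
    (findTriplets.exec s).Lists H.triplets := by
  have i₀ : Fin H.numDelays := ⟨0, H.numDelays_pos⟩
  have hT : 0 < T := (hτ i₀).1.trans_lt (hτ i₀).2
  have key := exec_forLoop_induct (s := s) (i := 13) (e := .reg 2) (n := P)
    (c := forLoop 14 (.reg 1) delayStep)
    (fun k s' => ∃ S, s'.Lists S ∧ S ⊆ H.triplets ∧ ∀ l < k, ∀ n < N, ∀ i,
      s.arr 13 l 0 = H.τ i + n * T → ∀ j, ((H.τ i : ℂ), (H.ν i j : ℂ), H.α i j) ∈ S)
    (by simp [NatExpr.eval, Store.setReg_nat, hs.nat_two]) rfl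
    ⟨∅, hS.congr rfl rfl, by simp, by simp⟩ (by
      rintro l s' hl h1 h2 h3 ⟨S, g1, g2, g3⟩
      have key' := exec_forLoop_induct (s := s') (i := 14) (e := .reg 1) (n := N)
        (c := delayStep)
        (fun k s'' => ∃ S', s''.Lists S' ∧ S' ⊆ H.triplets ∧ S ⊆ S' ∧ ∀ n < k, ∀ i,
          s.arr 13 l 0 = H.τ i + n * T → ∀ j, ((H.τ i : ℂ), (H.ν i j : ℂ), H.α i j) ∈ S')
        (by simp [NatExpr.eval, Store.setReg_nat, h2 1 (by decide) rfl, hs.nat_one]) rfl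
        ⟨S, g1.congr rfl rfl, g2, subset_rfl, by simp⟩ (by
          rintro n s'' hn f1 f2 f3 ⟨S', e1, e2, e3, e4⟩
          have hs'' : s''.HasEchoes H T N P P' x := hs.congr
            (by rw [f2 1 (by decide) rfl, h2 1 (by decide) rfl])
            (by rw [f2 2 (by decide) rfl, h2 2 (by decide) rfl])
            (by rw [f2 3 (by decide) rfl, h2 3 (by decide) rfl])
            (by rw [f3 0 rfl, h3 0 rfl]) (by rw [f3 1 rfl, h3 1 rfl])
            (by rw [f3 13 rfl, h3 13 rfl]) (by rw [f3 14 rfl, h3 14 rfl])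
          obtain ⟨S'', d1, d2, d3, d4⟩ := exec_delayStep hs'' hτ hν hx hP' hN hP e1 e2
            (by rw [f2 13 (by decide) rfl, h1]) f1
          rw [f3 13 rfl, h3 13 rfl] at d4
          refine ⟨S'', d1.congr rfl rfl, d3, e3.trans d2, fun m hm i hi j => ?_⟩
          rcases Nat.lt_succ_iff_lt_or_eq.1 hm with hm | rfl
          · exact d2 (e4 m hm i hi j)
          · exact d4 i hi j)
      obtain ⟨S', e1, e2, e3, e4⟩ := key'
      refine ⟨S', e1.congr rfl rfl, e2, fun k hk n hn i hi j => ?_⟩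
      rcases Nat.lt_succ_iff_lt_or_eq.1 hk with hk | rfl
      · exact e3 (g3 k hk n hn i hi j)
      · exact e4 n hn i hi j)
  obtain ⟨S, h1, h2, h3⟩ := key
  have : S = H.triplets := by
    refine h2.antisymm ?_
    rintro _ ⟨i, j, rfl⟩
    obtain ⟨n, hn, hn0⟩ := H.exists_pulseWeight_ne_zero hT (hν i) (N := N)
      (by have := hP' i; omega) hx
    obtain ⟨l, hl, hl1, -⟩ := (hs.echo _ _ hn0).2 ⟨i, n, hn, rfl, rfl⟩
    exact h3 l hl n hn i hl1 j
  rwa [this] at h1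

end Program

/-! ### Nodes of the echoes -/

/-- The node of an echo with delay `s`, for a pulse train of duration `D`. -/
def echoNode (D s : ℝ) : ℂ := Complex.exp ((-(2 * Real.pi * s / D) : ℝ) * Complex.I)

/-- The factor that a sampling kernel contributes to the weight of the echo with delay `s`. -/
def echoWindow (D s : ℝ) : ℂ :=
  if s = 0 then 1 else (1 - echoNode D s) / (Complex.I * (2 * Real.pi * s / D : ℝ))

/-- The angle in `[0, 2π)` with `z = ‖z‖ * exp (-i angle)`. -/
def wrapAngle (z : ℂ) : ℝ :=
  if 0 ≤ (conj z).arg then (conj z).arg else (conj z).arg + 2 * Real.pi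

/-- The weight of an echo, recovered from its node and the weight that Prony's method finds. -/
def decodeWeight (z w : ℂ) : ℂ :=
  open Classical in if z = 1 then w * z else w * z * (Complex.I * wrapAngle z) / (1 - z)

theorem echoNode_ne_zero (D s : ℝ) : echoNode D s ≠ 0 := Complex.exp_ne_zero _

theorem wrapAngle_echoNode {D s : ℝ} (hs : s ∈ Set.Ico 0 D) :
    wrapAngle (echoNode D s) = 2 * Real.pi * s / D := by
  have hpi := Real.pi_pos
  have hD : 0 < D := hs.1.trans_lt hs.2
  have h0 : 0 ≤ 2 * Real.pi * s / D := by have := hs.1; positivity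
  have h1 : 2 * Real.pi * s / D < 2 * Real.pi := by
    rw [div_lt_iff₀ hD]
    have := hs.2
    gcongr
  set θ := 2 * Real.pi * s / D with hθ
  have hc : conj (echoNode D s) = Complex.exp ((θ : ℝ) * Complex.I) := by
    rw [echoNode, ← Complex.exp_conj, map_mul, Complex.conj_ofReal, Complex.conj_I, hθ]
    congr 1
    push_cast
    ring
  unfold wrapAngle
  rw [hc, Complex.arg_exp_mul_I]
  by_cases hle : θ ≤ Real.pi
  · rw [(toIocMod_eq_self _).2 ⟨by linarith, by linarith⟩, if_pos h0]
  -- For θ > π the principal argument is θ - 2π; the branch of `wrapAngle` for negative arguments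
  -- undoes this.
  · have : toIocMod Real.two_pi_pos (-Real.pi) θ = θ - 2 * Real.pi := by
      rw [← toIocMod_sub]
      exact (toIocMod_eq_self _).2 ⟨by linarith, by linarith⟩
    rw [this, if_neg (by linarith)]
    ring

theorem eq_of_echoNode_eq {D s t : ℝ} (hs : s ∈ Set.Ico 0 D) (ht : t ∈ Set.Ico 0 D)
    (h : echoNode D s = echoNode D t) : s = t := by
  have h1 := wrapAngle_echoNode hs
  rw [h, wrapAngle_echoNode ht] at h1
  have hpi := Real.pi_pos
  have hD : 0 < D := hs.1.trans_lt hs.2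
  field_simp at h1
  exact h1.symm

theorem echoNode_zero (D : ℝ) : echoNode D 0 = 1 := by simp [echoNode]

theorem echoNode_eq_one_iff {D s : ℝ} (hs : s ∈ Set.Ico 0 D) : echoNode D s = 1 ↔ s = 0 := by
  constructor
  · intro h
    rw [← echoNode_zero D] at h
    exact eq_of_echoNode_eq hs ⟨le_rfl, hs.1.trans_lt hs.2⟩ h
  · rintro rfl
    exact echoNode_zero D

theorem echoWindow_ne_zero {D s : ℝ} (hs : s ∈ Set.Ico 0 D) : echoWindow D s ≠ 0 := by
  unfold echoWindow
  split_ifs with h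
  · exact one_ne_zero
  · have h1 : echoNode D s ≠ 1 := fun h' => h ((echoNode_eq_one_iff hs).1 h')
    have hpi := Real.pi_pos
    have hD : 0 < D := hs.1.trans_lt hs.2
    refine div_ne_zero (sub_ne_zero.2 h1.symm) (mul_ne_zero Complex.I_ne_zero ?_)
    exact_mod_cast div_ne_zero (mul_ne_zero (by positivity) h) hD.ne'

/-- The samples start at frequency -P/D, which puts a factor z^(-P) into each weight. Prony's method
at the largest admissible offset P - 1 removes all of it but one factor z^(-1), whence the extra
multiplication by z in `decodeWeight`. What remains is the window factor, known from the angle of z.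
-/
theorem decodeWeight_echoNode {D s : ℝ} (hs : s ∈ Set.Ico 0 D) {P : ℕ} (hP : 0 < P) (w : ℂ) :
    decodeWeight (echoNode D s)
      (w * (echoNode D s ^ P)⁻¹ * echoWindow D s * echoNode D s ^ (P - 1)) = w := by
  have hz := echoNode_ne_zero D s
  have h1 : w * (echoNode D s ^ P)⁻¹ * echoWindow D s * echoNode D s ^ (P - 1) * echoNode D s =
      w * echoWindow D s := by
    rw [mul_assoc _ (_ ^ (P - 1)), ← pow_succ, Nat.sub_add_cancel hP]
    field_simp
  unfold decodeWeight
  rw [h1, wrapAngle_echoNode hs]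
  have hwin := echoWindow_ne_zero hs
  simp only [echoNode_eq_one_iff hs]
  unfold echoWindow at *
  split_ifs with h
  · rw [mul_one]
  · rw [if_neg h] at hwin
    obtain ⟨h2, h3⟩ := div_ne_zero_iff.1 hwin
    rw [mul_div_assoc', div_mul_eq_mul_div, div_div, mul_comm (Complex.I * _) (1 - _),
      mul_assoc w, mul_div_cancel_right₀ _ (mul_ne_zero h2 h3)]

/-! ### The program -/

namespace Program

/-- Arrange the samples in a single sequence. -/
def gatherSamples : Program :=
  .seq (.setReg 17 (.const 0)) <| forLoop 13 (.add (.reg 0) (.reg 0)) <| forLoop 14 (.reg 1) <|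
    .seq (.setEntry 10 (.reg 17) (.const 0) (.entry 2 (.reg 13) (.reg 14)))
      (.setReg 17 (.add (.reg 17) (.const 1)))

/-- Convert the nodes and weights in arrays 11 and 12 to delays and weights of echoes. -/
def decodeEchoes : Program :=
  forLoop 13 (.reg 2) <|
    .seq (.setEntry 15 (.const 0) (.const 0)
      (.arg (.conjugate (.entry 11 (.reg 13) (.const 0))))) <|
    .seq (.ite (.reLe (.ofNat (.const 0)) (.entry 15 (.const 0) (.const 0))) .skip
      (.setEntry 15 (.const 0) (.const 0) (.add (.entry 15 (.const 0) (.const 0)) twoPi))) <|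
    .seq (.setEntry 13 (.reg 13) (.const 0) (.div (.mul (.entry 15 (.const 0) (.const 0))
      (.mul (.ofNat (.reg 1)) (.entry 0 (.const 0) (.const 0)))) twoPi)) <|
    .ite (.eq (.entry 11 (.reg 13) (.const 0)) (.ofNat (.const 1)))
      (.setEntry 14 (.reg 13) (.const 0)
        (.mul (.entry 12 (.reg 13) (.const 0)) (.entry 11 (.reg 13) (.const 0))))
      (.setEntry 14 (.reg 13) (.const 0) (.div
        (.mul (.mul (.entry 12 (.reg 13) (.const 0)) (.entry 11 (.reg 13) (.const 0)))
          (.mul .imagUnit (.entry 15 (.const 0) (.const 0))))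
        (.sub (.ofNat (.const 1)) (.entry 11 (.reg 13) (.const 0)))))

/-- Compute `QN` in register 2 and `⌊N / 2⌋` in register 3. -/
def computeSizes : Program :=
  .seq (forLoop 13 (.reg 0) (.setReg 2 (.add (.reg 2) (.reg 1)))) <|
    forLoop 13 (.reg 1) <|
      .ite (.natLe (.add (.add (.reg 3) (.reg 3)) (.const 2)) (.reg 1))
        (.setReg 3 (.add (.reg 3) (.const 1))) .skip

/-- The steps after the computation of the sizes. -/
def identifyCore : Program :=
  .seq gatherSamples <| .seq (prony 2 (.sub (.reg 2) (.const 1))) <| .seq decodeEchoes findTriplets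

/-- The identification of a parametric system from the samples. -/
def identify : Program := .seq computeSizes <| .seq identifyCore (.setReg 0 (.reg 20))

variable {s : Store}

theorem exec_gatherSamples {Q N : ℕ} (hQ : s.nat 0 = Q) (hN : s.nat 1 = N) {c : ℕ → ℂ}
    (hc : ∀ m < 2 * Q, ∀ n < N, s.arr 2 m n = c (m * N + n)) :
    ∀ k < 2 * (Q * N), (gatherSamples.exec s).arr 10 k 0 = c k := by
  rw [gatherSamples, exec_seq]
  set s1 := exec _ s with hs1
  have key := exec_forLoop_induct (s := s1) (i := 13) (e := .add (.reg 0) (.reg 0)) (n := 2 * Q)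
    (c := forLoop 14 (.reg 1) <|
      .seq (.setEntry 10 (.reg 17) (.const 0) (.entry 2 (.reg 13) (.reg 14)))
      (.setReg 17 (.add (.reg 17) (.const 1))))
    (fun m s' => s'.nat 17 = m * N ∧ ∀ k < m * N, s'.arr 10 k 0 = c k)
    (by simp [NatExpr.eval, Store.setReg_nat, hs1, hQ]; omega) rfl
    (by simp [Store.setReg_nat, hs1, NatExpr.eval]) (by
      rintro m s' hm h1 h2 h3 ⟨h4, h5⟩
      have key' := exec_forLoop_induct (s := s') (i := 14) (e := .reg 1) (n := N)
        (c := .seq (.setEntry 10 (.reg 17) (.const 0) (.entry 2 (.reg 13) (.reg 14)))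
          (.setReg 17 (.add (.reg 17) (.const 1))))
        (fun n s'' => s''.nat 17 = m * N + n ∧ ∀ k < m * N + n, s''.arr 10 k 0 = c k)
        (by
          simp only [NatExpr.eval]
          rw [Store.setReg_nat_of_ne _ _ (by decide), h2 1 (by decide) rfl]
          exact hN) rfl
        ⟨by simp [Store.setReg_nat, h4], by simpa using h5⟩ (by
          rintro n s'' hn g1 g2 g3 ⟨g4, g5⟩
          have e : s''.arr 2 m n = c (m * N + n) := by
            rw [g3 2 rfl, h3 2 rfl]
            exact hc m hm n hn
          refine ⟨by simp [Store.setReg_nat, NatExpr.eval, g4]; omega, fun k hk => ?_⟩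
          simp only [exec_seq, exec_setEntry, exec_setReg, Store.setReg_arr, Store.setEntry_arr,
            NatExpr.eval, ComplexExpr.eval, g4, g1, g2 13 (by decide) rfl, h1, e]
          replace hk : k < m * N + n + 1 := hk
          rcases Nat.lt_succ_iff_lt_or_eq.1 hk with hk | rfl
          · rw [if_neg (by omega), g5 k hk]
          · simp)
      rw [Store.setReg_arr, Store.setReg_nat_of_ne _ _ (by decide), add_mul, one_mul]
      exact key')
  intro k hk
  exact key.2 k (by rwa [mul_assoc])

theorem exec_decodeEchoes {N P : ℕ} (hN : s.nat 1 = N) (hP : s.nat 2 = P) {T : ℂ}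
    (hT : s.arr 0 0 0 = T) : ∀ l < P,
      (decodeEchoes.exec s).arr 13 l 0 = wrapAngle (s.arr 11 l 0) * (N * T) / (2 * Real.pi) ∧
      (decodeEchoes.exec s).arr 14 l 0 = decodeWeight (s.arr 11 l 0) (s.arr 12 l 0) := by
  refine exec_forLoop_induct (fun k s' => ∀ l < k,
      s'.arr 13 l 0 = wrapAngle (s.arr 11 l 0) * (N * T) / (2 * Real.pi) ∧
      s'.arr 14 l 0 = decodeWeight (s.arr 11 l 0) (s.arr 12 l 0))
    (by simp [NatExpr.eval, Store.setReg_nat, hP]) rfl (by simp) ?_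
  intro k s' hk h1 h2 h3 h4
  rw [exec_seq, exec_seq, exec_seq]
  set s1 := exec _ (exec _ s') with hs1
  have h15 : s1.arr 15 0 0 = wrapAngle (s.arr 11 k 0) := by
    have : s'.arr 11 k 0 = s.arr 11 k 0 := by rw [h3 11 rfl]
    simp only [hs1, exec_ite, Test.Holds, ComplexExpr.eval, NatExpr.eval, exec_setEntry, exec_skip,
      h1, eval_twoPi, Store.setEntry_arr_self, this, wrapAngle]
    split_ifs with c c' c' <;> simp_all
  have hn1 : s1.nat = s'.nat := funext fun r => by rw [hs1, exec_nat _ rfl, exec_nat _ rfl]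
  have ha1 : ∀ a, a ≠ 15 → s1.arr a = s'.arr a := fun a ha => by
    rw [hs1, exec_arr _ (by simp [writesArr, ha]), exec_arr _ (by simp [writesArr, ha])]
  set s2 := exec _ s1 with hs2
  have hs2' : s2 = s1.setEntry 13 k 0 (wrapAngle (s.arr 11 k 0) * (N * T) / (2 * Real.pi)) := by
    simp [hs2, NatExpr.eval, ComplexExpr.eval, hn1, h1, h15, eval_twoPi, h2 1 (by decide) rfl, hN,
      ha1 0 (by decide), h3 0 rfl, hT]
  have e : ∀ a, a ≠ 15 → a ≠ 13 → s2.arr a = s'.arr a := fun a ha ha' => by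
    rw [hs2', Store.setEntry_arr_of_ne _ _ _ _ ha', ha1 a ha]
  have e11 : s2.arr 11 = s.arr 11 := by rw [e 11 (by decide) (by decide), h3 11 rfl]
  have e12 : s2.arr 12 = s.arr 12 := by rw [e 12 (by decide) (by decide), h3 12 rfl]
  have e15 : s2.arr 15 0 0 = wrapAngle (s.arr 11 k 0) := by
    rw [hs2', Store.setEntry_arr_of_ne _ _ _ _ (by decide), h15]
  have e13 : s2.nat 13 = k := by rw [hs2', Store.setEntry_nat, hn1, h1]
  set s3 := exec _ s2 with hs3
  have hs3' : s3 = s2.setEntry 14 k 0 (decodeWeight (s.arr 11 k 0) (s.arr 12 k 0)) := by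
    simp only [hs3, exec_ite, Test.Holds, ComplexExpr.eval, NatExpr.eval, exec_setEntry, e13, e11,
      e12, e15, decodeWeight, Nat.cast_one]
    split_ifs <;> rfl
  intro l hl
  rw [Store.setReg_arr, hs3', Store.setEntry_arr, Store.setEntry_arr, if_neg (by simp), hs2',
    Store.setEntry_arr, Store.setEntry_arr, ha1 13 (by decide), ha1 14 (by decide)]
  rcases Nat.lt_succ_iff_lt_or_eq.1 hl with hl | rfl
  · rw [if_neg (by omega), if_neg (by omega), if_neg (by omega)]
    exact h4 l hl
  · simp

theorem exec_computeSizes (h2 : s.nat 2 = 0) (h3 : s.nat 3 = 0) :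
    (computeSizes.exec s).nat 2 = s.nat 0 * s.nat 1 ∧ (computeSizes.exec s).nat 3 = s.nat 1 / 2 := by
  rw [computeSizes, exec_seq]
  have key := exec_forLoop_induct (s := s) (i := 13) (e := .reg 0) (n := s.nat 0)
    (c := .setReg 2 (.add (.reg 2) (.reg 1))) (fun k s' => s'.nat 2 = k * s.nat 1) rfl rfl
    (by simp [Store.setReg_nat, h2]) (by
      intro k s' _ _ g2 _ g4
      simp [Store.setReg_nat, NatExpr.eval, g4, g2 1 (by decide) rfl, add_mul])
  set s1 := exec _ s with hs1
  have e1 : s1.nat 1 = s.nat 1 := exec_nat _ rfl _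
  have e3 : s1.nat 3 = 0 := (exec_nat _ rfl _).trans h3
  have key' := exec_forLoop_induct (s := s1) (i := 13) (e := .reg 1) (n := s.nat 1)
    (c := .ite (.natLe (.add (.add (.reg 3) (.reg 3)) (.const 2)) (.reg 1))
        (.setReg 3 (.add (.reg 3) (.const 1))) .skip)
    -- Halving by counting: the register grows while twice its successor is at most N, so after k
    -- rounds it is min k ⌊N/2⌋.
    (fun k s' => s'.nat 3 = min k (s.nat 1 / 2)) e1 rfl
    (by simp [Store.setReg_nat, e3]) (by
      intro k s' _ _ g2 _ g4
      have e1' : s'.nat 1 = s.nat 1 := (g2 1 (by decide) rfl).trans e1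
      rw [Store.setReg_nat_of_ne _ _ (by decide), exec_ite]
      simp only [Test.Holds, NatExpr.eval, g4, e1', exec_setReg, exec_skip]
      split_ifs with h
      · rw [Store.setReg_nat_self]
        omega
      · rw [g4]
        omega)
  refine ⟨?_, ?_⟩
  · rw [exec_nat _ rfl, key]
  · rw [key']
    omega

/-- The pairs (i, n) index at most QN nodes, distinct because the echo times are distinct in [0,
NT), so 2QN numbers suffice for Prony's method. Only echoes of nonzero weight are found, and
`HasEchoes` asks for no more. -/
theorem exec_identify {Q N : ℕ} {T : ℝ} {x : ℕ → ℂ} {c : ℕ → ℂ} {H : ParametricSystem}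
    (hτ : ∀ i, H.τ i ∈ Set.Ico 0 T) (hν : ∀ i j, |H.ν i j * T| < 1 / 2) (hx : ∀ n < N, x n ≠ 0)
    (hQ : H.numDelays ≤ Q) (hN : 2 * H.maxDopplers ≤ N)
    (hc : ∀ k < 2 * (Q * N), c k = ∑ i, ∑ n ∈ Finset.range N, H.pulseWeight T x i n *
      (echoNode (N * T) (H.τ i + n * T) ^ (Q * N))⁻¹ * echoWindow (N * T) (H.τ i + n * T) *
        echoNode (N * T) (H.τ i + n * T) ^ k) :
    (identify.exec (inputStore Q N T x fun m n => c (m * N + n))).Describes H := by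
  set s := inputStore Q N T x fun m n => c (m * N + n) with hs
  have i₀ : Fin H.numDelays := ⟨0, H.numDelays_pos⟩
  have hT : 0 < T := (hτ i₀).1.trans_lt (hτ i₀).2
  have hM := H.maxDopplers_pos
  have hP0 : 0 < Q * N := Nat.mul_pos (H.numDelays_pos.trans_le hQ) (by omega)
  have hTc : (T : ℂ) ≠ 0 := by exact_mod_cast hT.ne'
  have hNc : (N : ℂ) ≠ 0 := by exact_mod_cast (show N ≠ 0 by omega)
  have hpic : (Real.pi : ℂ) ≠ 0 := by exact_mod_cast Real.pi_ne_zero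
  obtain ⟨hn2, hn3⟩ := exec_computeSizes (s := s) rfl rfl
  have hQs : s.nat 0 = Q := rfl
  have hNs : s.nat 1 = N := rfl
  rw [hQs, hNs] at hn2
  rw [hNs] at hn3
  set s1 := computeSizes.exec s with hs1
  have hn0 : s1.nat 0 = Q := exec_nat _ rfl _
  have hn1 : s1.nat 1 = N := exec_nat _ rfl _
  have hn20 : s1.nat 20 = 0 := exec_nat _ rfl _
  have ha : ∀ a, s1.arr a = s.arr a := fun a => exec_arr _ rfl _
  have hgather := exec_gatherSamples (s := s1) hn0 hn1 (c := c) (by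
    intro m hm n hn
    rw [ha, hs]
    simp [inputStore, hm, hn])
  set s2 := gatherSamples.exec s1 with hs2
  have hech : ∀ i, ∀ n < N, H.τ i + n * T ∈ Set.Ico 0 (N * T) := by
    intro i n hn
    have h1 := (hτ i).1
    have h2 := (hτ i).2
    refine ⟨by positivity, ?_⟩
    have : (n : ℝ) + 1 ≤ N := by exact_mod_cast hn
    nlinarith
  have hpr := fun v w (hw : w ≠ 0) => exec_prony (s := s2) (rP := 2) (P := Q * N)
    (o := .sub (.reg 2) (.const 1)) (o' := Q * N - 1)
    (z := fun p : Fin H.numDelays × Fin N => echoNode (N * T) (H.τ p.1 + (p.2 : ℕ) * T))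
    (b := fun p => H.pulseWeight T x p.1 p.2 *
      (echoNode (N * T) (H.τ p.1 + (p.2 : ℕ) * T) ^ (Q * N))⁻¹ *
        echoWindow (N * T) (H.τ p.1 + (p.2 : ℕ) * T))
    (by decide) (by rw [hs2, exec_nat _ rfl, hn2]) (fun s' hs' => by simp [NatExpr.eval, hs'])
    (by omega) (by
      rintro ⟨i, n⟩ ⟨j, m⟩ h
      obtain ⟨h1, h2⟩ := eq_of_add_nat_mul_eq (hτ i) (hτ j)
        (eq_of_echoNode_eq (hech i n n.2) (hech j m m.2) h)
      exact Prod.ext (H.τ_injective h2) (Fin.ext h1))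
    (by simpa using Nat.mul_le_mul_right N hQ) (by
      intro k hk
      rw [hgather k hk, hc k hk, Fintype.sum_prod_type]
      exact Finset.sum_congr rfl fun i _ => (Finset.sum_range _)) v w hw
  set s3 := (prony 2 (.sub (.reg 2) (.const 1))).exec s2 with hs3
  have hdec := exec_decodeEchoes (s := s3) (N := N) (P := Q * N) (T := T)
    (by rw [hs3, exec_nat _ rfl, hs2, exec_nat _ rfl, hn1])
    (by rw [hs3, exec_nat _ rfl, hs2, exec_nat _ rfl, hn2])
    (by
      rw [hs3, exec_arr _ rfl, hs2, exec_arr _ rfl, ha, hs]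
      simp [inputStore])
  set s4 := decodeEchoes.exec s3 with hs4
  have hE : s4.HasEchoes H T N (Q * N) (N / 2) x := by
    refine ⟨?_, ?_, ?_, ?_, ?_, ?_⟩
    · rw [hs4, exec_nat _ rfl, hs3, exec_nat _ rfl, hs2, exec_nat _ rfl, hn1]
    · rw [hs4, exec_nat _ rfl, hs3, exec_nat _ rfl, hs2, exec_nat _ rfl, hn2]
    · rw [hs4, exec_nat _ rfl, hs3, exec_nat _ rfl, hs2, exec_nat _ rfl, hn3]
    · rw [hs4, exec_arr _ rfl, hs3, exec_arr _ rfl, hs2, exec_arr _ rfl, ha, hs]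
      simp [inputStore]
    · intro n hn
      rw [hs4, exec_arr _ rfl, hs3, exec_arr _ rfl, hs2, exec_arr _ rfl, ha, hs]
      simp [inputStore, hn]
    · have htime : ∀ i, ∀ n < N, (wrapAngle (echoNode (N * T) (H.τ i + n * T)) : ℂ) * (N * T) /
          (2 * Real.pi) = H.τ i + n * T := by
        intro i n hn
        rw [wrapAngle_echoNode (hech i n hn)]
        push_cast
        field_simp
      intro u w hw
      constructor
      · rintro ⟨l, hl, hu, hlw⟩
        rw [(hdec l hl).1] at hu
        rw [(hdec l hl).2] at hlw
        have h12 : s3.arr 12 l 0 ≠ 0 := by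
          intro h0
          rw [h0] at hlw
          apply hw
          rw [← hlw]
          simp [decodeWeight]
        obtain ⟨⟨i, n⟩, hz, hb⟩ := (hpr _ _ h12).1 ⟨l, hl, rfl, rfl⟩
        refine ⟨i, n, n.2, ?_, ?_⟩
        · rw [← hu, ← hz, htime i n n.2]
        · rw [← hlw, ← hb, ← hz, decodeWeight_echoNode (hech i n n.2) hP0]
      · rintro ⟨i, n, hn, hu, hiw⟩
        obtain ⟨l, hl, hl1, hl2⟩ := (hpr _ _ (by
          refine mul_ne_zero (mul_ne_zero (mul_ne_zero ?_ ?_) ?_) ?_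
          · rw [hiw]; exact hw
          · exact inv_ne_zero (pow_ne_zero _ (echoNode_ne_zero _ _))
          · exact echoWindow_ne_zero (hech i n hn)
          · exact pow_ne_zero _ (echoNode_ne_zero _ _))).2 ⟨(i, ⟨n, hn⟩), rfl, rfl⟩
        refine ⟨l, hl, ?_, ?_⟩
        · rw [(hdec l hl).1, hl1, htime i n hn, hu]
        · rw [(hdec l hl).2, hl1, hl2, decodeWeight_echoNode (hech i n hn) hP0, hiw]
  have h20 : s4.nat 20 = 0 := by
    rw [hs4, exec_nat _ rfl, hs3, exec_nat _ rfl, hs2, exec_nat _ rfl, hn20]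
  have h3 : s4.arr 3 = fun _ _ => 0 := by
    rw [hs4, exec_arr _ rfl, hs3, exec_arr _ rfl, hs2, exec_arr _ rfl, ha, hs]
    simp [inputStore]
  have hlist := exec_findTriplets hE hτ hν hx
    (fun i => by have := H.numDopplers_le_maxDopplers i; omega) (by omega)
    (H.numPairs_le.trans (Nat.mul_le_mul hQ (by omega)))
    ⟨by simp [h20], by simp [h20], by simp [h3]⟩
  have hex : identify.exec s = (findTriplets.exec s4).setReg 0 ((findTriplets.exec s4).nat 20) := by
    simp only [identify, identifyCore, exec_seq, exec_setReg, NatExpr.eval, s4, s3, s2, s1]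
  rw [hex]
  have hcard := hlist.ncard
  rw [H.ncard_triplets] at hcard
  rw [Store.Describes, Store.setReg_nat_self, Store.setReg_arr]
  refine And.intro hcard.symm ?_
  rw [hlist.eq_image, hcard]
  ext q
  simp [Store.row, eq_comm]

/-- Two bounds are needed, because registers 2 and 3 control the main part but are written by
`computeSizes`: the latter is bounded in terms of registers 0 and 1, the main part in terms of
registers 0 to 3. All of them are at most QN. The summand 2 is the cost of the final assignment. -/
theorem exists_identify_steps_le : ∃ C d : ℕ, ∀ (Q N : ℕ) (T : ℝ) (x : ℕ → ℂ) (c : ℕ → ℕ → ℂ),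
    0 < Q → 0 < N → (identify.run (inputStore Q N T x c)).2 ≤ C * (Q * N) ^ d := by
  obtain ⟨C₁, d₁, h₁⟩ := exists_steps_le (b := 2) computeSizes rfl
  obtain ⟨C₂, d₂, h₂⟩ := exists_steps_le (b := 4) identifyCore rfl
  refine ⟨C₁ + C₂ + 2, d₁ + d₂, fun Q N T x c hQ hN => ?_⟩
  set s := inputStore Q N T x c with hs
  have hM : 1 ≤ Q * N := Nat.mul_pos hQ hN
  have hQM : Q ≤ Q * N := Nat.le_mul_of_pos_right Q hN
  have hNM : N ≤ Q * N := Nat.le_mul_of_pos_left N hQ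
  have e₁ := h₁ s (Q * N) hM (by
    intro r hr
    interval_cases r
    exacts [hQM, hNM])
  have e₂ := h₂ (computeSizes.exec s) (Q * N) hM (by
    intro r hr
    obtain ⟨hn2, hn3⟩ := exec_computeSizes (s := s) rfl rfl
    interval_cases r
    · rw [exec_nat _ rfl]; exact hQM
    · rw [exec_nat _ rfl]; exact hNM
    · rw [hn2]; exact le_rfl
    · rw [hn3]; exact (Nat.div_le_self _ _).trans hNM)
  have e₃ : (identify.run s).2 = (computeSizes.run s).2 +
      ((identifyCore.run (computeSizes.exec s)).2 + 2) := rfl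
  have f₁ := e₁.trans (mul_pow_le_mul_pow hM le_rfl (Nat.le_add_right d₁ d₂))
  have f₂ := e₂.trans (mul_pow_le_mul_pow hM le_rfl (Nat.le_add_left d₂ d₁))
  have f₃ : 2 ≤ 2 * (Q * N) ^ (d₁ + d₂) := Nat.le_mul_of_pos_right 2 (Nat.pow_pos hM)
  rw [e₃, add_mul, add_mul]
  omega

end Program

/-! ### Sampling kernels -/

theorem SchwartzMap.fourier_compSubConst (φ : SchwartzMap ℝ ℂ) (s ξ : ℝ) :
    (𝓕 (φ.compSubConstCLM ℂ s) : SchwartzMap ℝ ℂ) ξ =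
      Complex.exp (-(2 * Real.pi * ξ * s : ℝ) * Complex.I) * (𝓕 φ : SchwartzMap ℝ ℂ) ξ := by
  rw [SchwartzMap.fourier_coe, SchwartzMap.fourier_coe, Real.fourier_real_eq_integral_exp_smul,
    Real.fourier_real_eq_integral_exp_smul, ← integral_const_mul]
  conv_rhs => rw [← integral_sub_right_eq_self _ s]
  refine integral_congr_ae (Filter.Eventually.of_forall fun t => ?_)
  simp only [SchwartzMap.compSubConstCLM_apply, smul_eq_mul, ← mul_assoc]
  rw [← Complex.exp_add]
  congr 2
  push_cast
  ring

/-- The translation of a square integrable function. -/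
def translateLp (s : ℝ) : Lp ℂ 2 (volume : Measure ℝ) →ₗᵢ[ℂ] Lp ℂ 2 (volume : Measure ℝ) :=
  Lp.compMeasurePreservingₗᵢ ℂ (fun t => t - s) (measurePreserving_sub_right volume s)

theorem coeFn_translateLp (s : ℝ) (f : Lp ℂ 2 (volume : Measure ℝ)) :
    translateLp s f =ᵐ[volume] fun t => f (t - s) :=
  Lp.coeFn_compMeasurePreserving f (measurePreserving_sub_right volume s)

theorem MeasureTheory.MemLp.modulate {ψ : ℝ → ℂ} (hψ : MemLp ψ 2 volume) (s : ℝ) :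
    MemLp (fun ξ : ℝ => Complex.exp ((2 * Real.pi * ξ * s : ℝ) * Complex.I) * ψ ξ) 2 volume := by
  refine hψ.of_le ((Continuous.aestronglyMeasurable (by fun_prop)).mul hψ.1)
    (Filter.Eventually.of_forall fun ξ => ?_)
  rw [norm_mul, Complex.norm_exp_ofReal_mul_I, one_mul]

/-- A translation is a modulation of the Fourier transform, tested against an `L²` function. -/
theorem inner_fourier_translateLp {ψ : ℝ → ℂ} (hψ : MemLp ψ 2 volume) (s : ℝ)
    (f : Lp ℂ 2 (volume : Measure ℝ)) :
    inner ℂ (hψ.toLp ψ) (𝓕 (translateLp s f)) = inner ℂ ((hψ.modulate s).toLp _) (𝓕 f) := by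
  -- Both sides are continuous in `f`, so it suffices to take Schwartz functions, for which the
  -- Fourier transform is an integral.
  refine DenseRange.induction_on
    (p := fun f => inner ℂ (hψ.toLp ψ) (𝓕 (translateLp s f)) =
      inner ℂ ((hψ.modulate s).toLp _) (𝓕 f))
    (SchwartzMap.denseRange_toLpCLM (p := 2) ENNReal.ofNat_ne_top) f ?_ ?_
  · have hF : Continuous fun f : Lp ℂ 2 (volume : Measure ℝ) => 𝓕 f :=
      (Lp.fourierTransformₗᵢ ℝ ℂ).continuous
    exact isClosed_eq (continuous_const.inner (hF.comp (translateLp s).continuous))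
      (continuous_const.inner hF)
  · intro φ
    have h1 : translateLp s (φ.toLp 2) = (φ.compSubConstCLM ℂ s).toLp 2 := by
      apply Lp.ext
      refine (coeFn_translateLp s _).trans ?_
      have h2 := (measurePreserving_sub_right (volume : Measure ℝ) s).quasiMeasurePreserving.ae_eq
        (φ.coeFn_toLp 2 volume)
      refine h2.trans ?_
      filter_upwards [(φ.compSubConstCLM ℂ s).coeFn_toLp 2 volume] with t ht
      rw [ht]
      rfl
    rw [SchwartzMap.toLpCLM_apply, h1, SchwartzMap.toLp_fourier_eq, SchwartzMap.toLp_fourier_eq,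
      L2.inner_def, L2.inner_def]
    refine integral_congr_ae ?_
    filter_upwards [hψ.coeFn_toLp, (hψ.modulate s).coeFn_toLp,
      (𝓕 φ : SchwartzMap ℝ ℂ).coeFn_toLp 2 volume,
      (𝓕 (φ.compSubConstCLM ℂ s) : SchwartzMap ℝ ℂ).coeFn_toLp 2 volume] with ξ e1 e2 e3 e4
    rw [e1, e2, e3, e4, SchwartzMap.fourier_compSubConst]
    simp only [RCLike.inner_apply, map_mul, ← Complex.exp_conj, Complex.conj_ofReal,
      Complex.conj_I]
    ring_nf

/-- Plancherel: the kernel is prescribed by its Fourier transform ψ, and the translation of the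
pulse becomes a modulation. -/
theorem sample_comp_sub {g ψ : ℝ → ℂ} (hg : MemLp g 2 volume) (hψ : MemLp ψ 2 volume) (s : ℝ) :
    sample (fun t => g (t - s)) (𝓕⁻ (hψ.toLp ψ) : Lp ℂ 2 (volume : Measure ℝ)) =
      ∫ ξ : ℝ, conj (ψ ξ) * Complex.exp (-(2 * Real.pi * ξ * s : ℝ) * Complex.I) *
        (𝓕 (hg.toLp g) : Lp ℂ 2 (volume : Measure ℝ)) ξ := by
  have h1 : sample (fun t => g (t - s)) (𝓕⁻ (hψ.toLp ψ) : Lp ℂ 2 (volume : Measure ℝ)) =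
      inner ℂ (𝓕⁻ (hψ.toLp ψ)) (translateLp s (hg.toLp g)) := by
    rw [L2.inner_def, sample]
    refine integral_congr_ae ?_
    have h2 := (measurePreserving_sub_right (volume : Measure ℝ) s).quasiMeasurePreserving.ae_eq
      hg.coeFn_toLp
    filter_upwards [coeFn_translateLp s (hg.toLp g), h2] with t e1 e2
    rw [e1]
    simp only [Function.comp_apply] at e2
    rw [e2, RCLike.inner_apply]
  rw [h1, ← Lp.inner_fourier_eq, FourierTransform.fourier_fourierInv_eq, inner_fourier_translateLp,
    L2.inner_def]
  refine integral_congr_ae ?_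
  filter_upwards [(hψ.modulate s).coeFn_toLp] with ξ e1
  rw [e1]
  simp only [RCLike.inner_apply, map_mul, ← Complex.exp_conj, Complex.conj_ofReal, Complex.conj_I]
  ring_nf

/-- `echoWindow` is the integral over the cell [0, 1/D]; moving the cell by 1/D multiplies the
integral by the node. Cell k is reached by k - P such moves. -/
theorem integral_exp_modulation {D : ℝ} (hD : 0 < D) (k P : ℕ) (s : ℝ) :
    ∫ ξ in ((k : ℝ) - P) / D..((k : ℝ) - P + 1) / D,
        (D : ℂ) * Complex.exp (-(2 * Real.pi * ξ * s : ℝ) * Complex.I) =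
      (echoNode D s ^ P)⁻¹ * echoWindow D s * echoNode D s ^ k := by
  have hDc : (D : ℂ) ≠ 0 := by exact_mod_cast hD.ne'
  rw [intervalIntegral.integral_const_mul]
  unfold echoWindow
  split_ifs with hs
  · subst hs
    simp only [mul_zero, Complex.ofReal_zero, neg_zero, zero_mul, Complex.exp_zero, echoNode_zero,
      one_pow, inv_one, mul_one, intervalIntegral.integral_const]
    rw [← sub_div, add_sub_cancel_left, Complex.real_smul]
    push_cast
    field_simp
  · have hsc : (s : ℂ) ≠ 0 := by exact_mod_cast hs
    have hpi : (Real.pi : ℂ) ≠ 0 := by exact_mod_cast Real.pi_ne_zero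
    set c : ℂ := -(2 * Real.pi * s) * Complex.I with hc
    have hc0 : c ≠ 0 := by
      rw [hc]
      simp [hsc, hpi]
    have h1 : ∀ ξ : ℝ, Complex.exp (-(2 * Real.pi * ξ * s : ℝ) * Complex.I) =
        Complex.exp (c * ξ) := fun ξ => by
      rw [hc]
      congr 1
      push_cast
      ring
    simp_rw [h1]
    rw [integral_exp_mul_complex hc0]
    have hnode : ∀ m : ℕ, echoNode D s ^ m = Complex.exp (c * (m / D)) := fun m => by
      rw [echoNode, ← Complex.exp_nat_mul, hc]
      congr 1
      push_cast
      ring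
    have e1 : Complex.exp (c * (((k : ℝ) - P) / D : ℝ)) =
        (echoNode D s ^ P)⁻¹ * echoNode D s ^ k := by
      rw [hnode, hnode, ← Complex.exp_neg, ← Complex.exp_add]
      congr 1
      push_cast
      ring
    have e2 : Complex.exp (c * (((k : ℝ) - P + 1) / D : ℝ)) =
        (echoNode D s ^ P)⁻¹ * echoNode D s ^ k * echoNode D s := by
      nth_rw 3 [← pow_one (echoNode D s)]
      rw [hnode, hnode, hnode, ← Complex.exp_neg, ← Complex.exp_add, ← Complex.exp_add]
      congr 1
      push_cast
      ring
    rw [e1, e2, hc]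
    have hI := Complex.I_ne_zero
    push_cast
    field_simp
    ring

/-- Kernels that turn translates of the pulse into powers of nodes. -/
theorem exists_sampling_kernels {g : ℝ → ℂ} (hg : MemLp g 2 volume) {W D : ℝ} (hD : 0 < D) {P : ℕ}
    (hPW : 2 * Real.pi * (P / D) ≤ W / 2) (hfill : FillsBand g hg W) :
    ∃ h : ℕ → ℝ → ℂ, (∀ k, MemLp (h k) 2 volume) ∧ ∀ k < 2 * P, ∀ s : ℝ,
      sample (fun t => g (t - s)) (h k) =
        (echoNode D s ^ P)⁻¹ * echoWindow D s * echoNode D s ^ k := by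
  obtain ⟨a, ha, hfill⟩ := hfill
  set G : ℝ → ℂ := ⇑(𝓕 (hg.toLp g) : Lp ℂ 2 (volume : Measure ℝ)) with hG
  have hGm : AEStronglyMeasurable G volume := Lp.aestronglyMeasurable _
  set I : ℕ → Set ℝ := fun k => Set.Ioc (((k : ℝ) - P) / D) (((k : ℝ) - P + 1) / D) with hI
  have hIm : ∀ k, MeasurableSet (I k) := fun k => measurableSet_Ioc
  -- The cells 0, ..., 2P - 1 tile (-P/D, P/D], which lies in the band by `hPW`.
  have hband : ∀ k < 2 * P, ∀ᵐ ξ : ℝ, ξ ∈ I k → a ≤ ‖G ξ‖ := by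
    intro k hk
    filter_upwards [hfill] with ξ hξ hmem
    refine hξ (le_trans ?_ hPW)
    rw [abs_mul, abs_of_pos Real.two_pi_pos]
    refine mul_le_mul_of_nonneg_left ?_ Real.two_pi_pos.le
    have h1 : (k : ℝ) + 1 ≤ 2 * P := by exact_mod_cast hk
    rw [abs_le]
    constructor
    · refine le_trans ?_ hmem.1.le
      rw [← neg_div]
      gcongr
      have : (0 : ℝ) ≤ k := k.cast_nonneg
      linarith
    · refine hmem.2.trans ?_
      gcongr
      linarith
  -- Division by the spectrum cancels the pulse on one cell; the lower bound a makes the quotient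
  -- bounded there. For k ≥ 2P no such bound is available, and 0 keeps the kernel in L².
  set ψ : ℕ → ℝ → ℂ := fun k => open Classical in if k < 2 * P then
    (I k).indicator fun ξ => (D : ℂ) * conj (G ξ)⁻¹ else 0 with hψdef
  have hψ : ∀ k, MemLp (ψ k) 2 volume := by
    intro k
    by_cases hk : k < 2 * P
    · simp only [hψdef, if_pos hk]
      rw [memLp_indicator_iff_restrict (hIm k)]
      have : IsFiniteMeasure (volume.restrict (I k)) := ⟨by simp [hI]⟩
      have hm : AEStronglyMeasurable (fun ξ => (D : ℂ) * conj (G ξ)⁻¹) (volume.restrict (I k)) :=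
        ((Complex.continuous_conj.comp_aestronglyMeasurable
          (hGm.aemeasurable.inv.aestronglyMeasurable)).const_mul _).restrict
      refine MemLp.of_bound hm (D * a⁻¹) ?_
      rw [ae_restrict_iff' (hIm k)]
      filter_upwards [hband k hk] with ξ hξ hmem
      rw [norm_mul, Complex.norm_real, Real.norm_of_nonneg hD.le, RCLike.norm_conj, norm_inv]
      have := hξ hmem
      gcongr
    · simp only [hψdef, if_neg hk]
      exact MemLp.zero
  refine ⟨fun k => (𝓕⁻ ((hψ k).toLp (ψ k)) : Lp ℂ 2 (volume : Measure ℝ)),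
    fun k => Lp.memLp _, fun k hk s => ?_⟩
  rw [sample_comp_sub hg (hψ k), ← integral_exp_modulation hD,
    intervalIntegral.integral_of_le (by gcongr; linarith), ← integral_indicator measurableSet_Ioc]
  refine integral_congr_ae ?_
  filter_upwards [hband k hk] with ξ hξ
  by_cases hmem : ξ ∈ I k
  · have hG0 : G ξ ≠ 0 := norm_pos_iff.1 (ha.trans_le (hξ hmem))
    have hmem' := hmem
    rw [hI] at hmem'
    simp only [hψdef, if_pos hk, Set.indicator_of_mem hmem, Set.indicator_of_mem hmem', map_mul,
      Complex.conj_conj, Complex.conj_ofReal]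
    rw [← hG]
    field_simp
  · have hmem' := hmem
    rw [hI] at hmem'
    simp only [hψdef, if_pos hk, Set.indicator_of_notMem hmem, Set.indicator_of_notMem hmem',
      map_zero, zero_mul]

namespace ParametricSystem

variable (H : ParametricSystem)

theorem slowResponse_eq (g : ℝ → ℂ) (T : ℝ) (N : ℕ) (x : ℕ → ℂ) (t : ℝ) :
    H.slowResponse g T N x t = ∑ i, ∑ n ∈ Finset.range N,
      H.pulseWeight T x i n * g (t - (H.τ i + n * T)) := by
  unfold slowResponse pulseWeight
  refine Finset.sum_congr rfl fun i _ => ?_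
  rw [Finset.sum_comm]
  refine Finset.sum_congr rfl fun n _ => ?_
  rw [Finset.sum_mul]
  simp only [sub_sub]

theorem sample_slowResponse {g h : ℝ → ℂ} (hg : MemLp g 2 volume) (hh : MemLp h 2 volume)
    (T : ℝ) (N : ℕ) (x : ℕ → ℂ) : sample (H.slowResponse g T N x) h =
      ∑ i, ∑ n ∈ Finset.range N,
        H.pulseWeight T x i n * sample (fun t => g (t - (H.τ i + n * T))) h := by
  have hint : ∀ s : ℝ, Integrable (fun t => g (t - s) * conj (h t)) := fun s =>
    (hg.comp_measurePreserving (measurePreserving_sub_right volume s)).integrable_mul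
      (q := 2) (by exact hh.star)
  simp only [sample, slowResponse_eq, Finset.sum_mul, mul_assoc]
  rw [integral_finsetSum _ fun i _ => integrable_finsetSum _ fun n _ => (hint _).const_mul _]
  refine Finset.sum_congr rfl fun i _ => ?_
  rw [integral_finsetSum _ fun n _ => (hint _).const_mul _]
  exact Finset.sum_congr rfl fun n _ => integral_const_mul _ _

end ParametricSystem

/-! ### The number of delay--Doppler pairs -/

namespace ParametricSystem

variable (H : ParametricSystem)

/-- Apart from one delay with the most Doppler shifts, each of the remaining K_τ - 1 delays
contributes at least one pair. -/
theorem numDelays_add_maxDopplers_le : H.numDelays + H.maxDopplers ≤ H.numPairs + 1 := by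
  obtain ⟨i, -, hi⟩ := Finset.exists_mem_eq_sup (Finset.univ : Finset (Fin H.numDelays))
    ⟨⟨0, H.numDelays_pos⟩, Finset.mem_univ _⟩ H.numDopplers
  have h1 : H.numPairs = H.numDopplers i + ∑ k ∈ Finset.univ.erase i, H.numDopplers k :=
    (Finset.add_sum_erase _ _ (Finset.mem_univ i)).symm
  have h2 : (Finset.univ.erase i).card • 1 ≤ ∑ k ∈ Finset.univ.erase i, H.numDopplers k :=
    Finset.card_nsmul_le_sum _ _ _ fun k _ => H.numDopplers_pos k
  rw [Finset.card_erase_of_mem (Finset.mem_univ i), Finset.card_univ, Fintype.card_fin,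
    smul_eq_mul, mul_one] at h2
  have h3 : H.maxDopplers = H.numDopplers i := hi
  omega

theorem eight_pi_mul_le {𝒯 W : ℝ} (h : 2 * Real.pi * ((H.numPairs : ℝ) + 1) ^ 2 ≤ 𝒯 * W) :
    8 * Real.pi * H.numDelays * H.maxDopplers ≤ 𝒯 * W := by
  refine le_trans ?_ h
  have h1 : (H.numDelays : ℝ) + H.maxDopplers ≤ H.numPairs + 1 := by
    exact_mod_cast H.numDelays_add_maxDopplers_le
  have h2 : (4 : ℝ) * (H.numDelays * H.maxDopplers) ≤ ((H.numPairs : ℝ) + 1) ^ 2 :=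
    calc (4 : ℝ) * (H.numDelays * H.maxDopplers)
        ≤ ((H.numDelays : ℝ) + H.maxDopplers) ^ 2 := by
          nlinarith [sq_nonneg ((H.numDelays : ℝ) - H.maxDopplers)]
      _ ≤ _ := by gcongr
  nlinarith [Real.pi_pos]

/-! ### The slow modulation -/

theorem response_sub_slowResponse (g : ℝ → ℂ) (T : ℝ) (N : ℕ) (x : ℕ → ℂ) (t : ℝ) :
    H.response (pulseTrain g T N x) t - H.slowResponse g T N x t =
      ∑ i, ∑ j, ∑ n ∈ Finset.range N, H.α i j * x n * g (t - (H.τ i + n * T)) *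
        (Complex.exp (2 * Real.pi * Complex.I * H.ν i j * t) -
          Complex.exp (2 * Real.pi * Complex.I * H.ν i j * (n * T))) := by
  simp only [response, slowResponse, pulseTrain, Finset.mul_sum, Finset.sum_mul,
    ← Finset.sum_sub_distrib]
  refine Finset.sum_congr rfl fun i _ => Finset.sum_congr rfl fun j _ =>
    Finset.sum_congr rfl fun n _ => ?_
  rw [sub_sub]
  ring

end ParametricSystem

theorem norm_exp_sub_exp_le (ν a b : ℝ) :
    ‖Complex.exp (2 * Real.pi * Complex.I * ν * a) - Complex.exp (2 * Real.pi * Complex.I * ν * b)‖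
      ≤ 2 * Real.pi * |ν| * |a - b| := by
  have h1 : Complex.exp (2 * Real.pi * Complex.I * ν * a) -
      Complex.exp (2 * Real.pi * Complex.I * ν * b) =
      Complex.exp ((2 * Real.pi * ν * b : ℝ) * Complex.I) *
        (Complex.exp (Complex.I * (2 * Real.pi * ν * (a - b) : ℝ)) - 1) := by
    rw [mul_sub, ← Complex.exp_add, mul_one]
    congr 2 <;> push_cast <;> ring
  rw [h1, norm_mul, Complex.norm_exp_ofReal_mul_I, one_mul]
  refine Real.norm_exp_I_mul_ofReal_sub_one_le.trans_eq ?_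
  rw [Real.norm_eq_abs, abs_mul, abs_mul, abs_of_pos Real.two_pi_pos]

theorem eLpNorm_eq_one_of_integral {g : ℝ → ℂ} (hg : MemLp g 2 volume)
    (h : (∫ t, ‖g t‖ ^ 2) = 1) : eLpNorm g 2 volume = 1 := by
  rw [hg.eLpNorm_eq_integral_rpow_norm two_ne_zero ENNReal.ofNat_ne_top]
  simp [h]

theorem ParametricSystem.eLpNorm_response_sub_le (H : ParametricSystem) {τmax νmax T : ℝ} {N : ℕ}
    {g : ℝ → ℂ} {x : ℕ → ℂ} (hg : MemLp g 2 volume) (hg1 : (∫ t, ‖g t‖ ^ 2) = 1)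
    (hsupp : ∀ᵐ t, t ∉ Set.Icc 0 T → g t = 0) (hH : H.SupportedIn τmax νmax) (hT : τmax < T) :
    eLpNorm (fun t => H.response (pulseTrain g T N x) t - H.slowResponse g T N x t) 2 volume ≤
      ENNReal.ofReal (2 * Real.pi * (νmax * T) *
        ((∑ i, ∑ j, ‖H.α i j‖) * ∑ n ∈ Finset.range N, ‖x n‖)) := by
  have i₀ : Fin H.numDelays := ⟨0, H.numDelays_pos⟩
  have hT0 : 0 < T := ((hH.1 i₀).1.trans (hH.1 i₀).2).trans_lt hT
  have hν0 : 0 ≤ νmax := by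
    obtain ⟨h1, h2⟩ := hH.2 i₀ ⟨0, H.numDopplers_pos i₀⟩
    linarith
  have hpi := Real.pi_pos
  set F : (i : Fin H.numDelays) → Fin (H.numDopplers i) → ℕ → ℝ → ℂ := fun i j n t =>
    H.α i j * x n * g (t - (H.τ i + n * T)) *
      (Complex.exp (2 * Real.pi * Complex.I * H.ν i j * t) -
        Complex.exp (2 * Real.pi * Complex.I * H.ν i j * (n * T))) with hF
  have hshift : ∀ s : ℝ, MemLp (fun t => g (t - s)) 2 volume := fun s =>
    hg.comp_measurePreserving (measurePreserving_sub_right volume s)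
  have hFm : ∀ i j n, AEStronglyMeasurable (F i j n) volume := fun i j n =>
    ((hshift _).1.const_mul _).mul (Continuous.aestronglyMeasurable (by fun_prop))
  have hFle : ∀ i j n, eLpNorm (F i j n) 2 volume ≤
      ENNReal.ofReal (2 * Real.pi * (νmax * T) * (‖H.α i j‖ * ‖x n‖)) := by
    intro i j n
    have h1 : eLpNorm (fun t => g (t - (H.τ i + n * T))) 2 volume = 1 :=
      (eLpNorm_comp_measurePreserving hg.1 (measurePreserving_sub_right volume _)).trans
        (eLpNorm_eq_one_of_integral hg hg1)
    refine (eLpNorm_le_mul_eLpNorm_of_ae_le_mul (g := fun t => g (t - (H.τ i + n * T)))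
      (c := 2 * Real.pi * (νmax * T) * (‖H.α i j‖ * ‖x n‖)) ?_ 2).trans (by rw [h1, mul_one])
    have hae := (measurePreserving_sub_right (volume : Measure ℝ)
      (H.τ i + n * T)).quasiMeasurePreserving.ae hsupp
    filter_upwards [hae] with t ht
    by_cases hmem : t - (H.τ i + n * T) ∈ Set.Icc 0 T
    · have hexp := norm_exp_sub_exp_le (H.ν i j) t (n * T)
      push_cast at hexp
      -- On the support of the echo, t - nT lies in [τ_i, τ_i + T] with 0 ≤ τ_i < T. With |ν_ij| ≤
      -- νmax/2, the two factors 2 cancel.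
      have h2 : |t - n * T| ≤ 2 * T := by
        have := hH.1 i
        rw [abs_le]
        constructor <;> linarith [hmem.1, hmem.2, this.1, this.2]
      have h3 : |H.ν i j| ≤ νmax / 2 := by
        have := hH.2 i j
        rw [abs_le]
        constructor <;> linarith [this.1, this.2]
      have h4 : 2 * Real.pi * |H.ν i j| * |t - n * T| ≤ 2 * Real.pi * (νmax * T) :=
        calc 2 * Real.pi * |H.ν i j| * |t - n * T| ≤ 2 * Real.pi * (νmax / 2) * (2 * T) := by gcongr
          _ = _ := by ring
      rw [hF]
      simp only [norm_mul]
      calc ‖H.α i j‖ * ‖x n‖ * ‖g (t - (H.τ i + n * T))‖ * _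
          ≤ ‖H.α i j‖ * ‖x n‖ * ‖g (t - (H.τ i + n * T))‖ * (2 * Real.pi * (νmax * T)) := by
            gcongr
            exact hexp.trans h4
        _ = _ := by ring
    · simp [hF, ht hmem]
  have hsum : (fun t => H.response (pulseTrain g T N x) t - H.slowResponse g T N x t) =
      ∑ i, ∑ j, ∑ n ∈ Finset.range N, F i j n := by
    funext t
    rw [H.response_sub_slowResponse]
    simp [hF]
  rw [hsum]
  calc eLpNorm (∑ i, ∑ j, ∑ n ∈ Finset.range N, F i j n) 2 volume
      ≤ ∑ i, eLpNorm (∑ j, ∑ n ∈ Finset.range N, F i j n) 2 volume :=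
        eLpNorm_sum_le (fun i _ => Finset.aestronglyMeasurable_sum _ fun j _ =>
          Finset.aestronglyMeasurable_sum _ fun n _ => hFm i j n) one_le_two
    _ ≤ ∑ i, ∑ j, eLpNorm (∑ n ∈ Finset.range N, F i j n) 2 volume :=
        Finset.sum_le_sum fun i _ => eLpNorm_sum_le (fun j _ =>
          Finset.aestronglyMeasurable_sum _ fun n _ => hFm i j n) one_le_two
    _ ≤ ∑ i, ∑ j, ∑ n ∈ Finset.range N, eLpNorm (F i j n) 2 volume :=
        Finset.sum_le_sum fun i _ => Finset.sum_le_sum fun j _ =>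
          eLpNorm_sum_le (fun n _ => hFm i j n) one_le_two
    _ ≤ ∑ i, ∑ j, ∑ n ∈ Finset.range N,
          ENNReal.ofReal (2 * Real.pi * (νmax * T) * (‖H.α i j‖ * ‖x n‖)) :=
        Finset.sum_le_sum fun i _ => Finset.sum_le_sum fun j _ => Finset.sum_le_sum fun n _ =>
          hFle i j n
    _ = _ := by
        rw [Finset.sum_mul, Finset.mul_sum, ENNReal.ofReal_sum_of_nonneg fun i _ => by positivity]
        refine Finset.sum_congr rfl fun i _ => ?_
        rw [Finset.sum_mul, Finset.mul_sum, ENNReal.ofReal_sum_of_nonneg fun j _ => by positivity]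
        refine Finset.sum_congr rfl fun j _ => ?_
        rw [Finset.mul_sum, Finset.mul_sum, ENNReal.ofReal_sum_of_nonneg fun n _ => by positivity]

/-! ### Independence of time--frequency shifts -/

/-- The character `t ↦ exp (2πi ν t)`. -/
def modulation (ν : ℝ) : Multiplicative ℝ →* ℂ where
  toFun t := Complex.exp (2 * Real.pi * Complex.I * ν * (t.toAdd : ℝ))
  map_one' := by simp
  map_mul' s t := by
    rw [← Complex.exp_add, toAdd_mul]
    congr 1
    push_cast
    ring

theorem modulation_injective : Function.Injective modulation := by
  intro ν μ h
  by_contra hne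
  have hsub : ((ν : ℂ) - μ) ≠ 0 := by
    rw [sub_ne_zero]
    exact_mod_cast hne
  have h1 := DFunLike.congr_fun h (Multiplicative.ofAdd (1 / (2 * (ν - μ))))
  have h2 : Complex.exp (2 * Real.pi * Complex.I * ν * ((1 / (2 * (ν - μ)) : ℝ) : ℂ)) =
      Complex.exp (2 * Real.pi * Complex.I * μ * ((1 / (2 * (ν - μ)) : ℝ) : ℂ)) := h1
  have h3 : (2 * Real.pi * Complex.I * ν * ((1 / (2 * (ν - μ)) : ℝ) : ℂ)) =
      2 * Real.pi * Complex.I * μ * ((1 / (2 * (ν - μ)) : ℝ) : ℂ) + Real.pi * Complex.I := by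
    push_cast
    field_simp
    ring
  rw [h3, Complex.exp_add, Complex.exp_pi_mul_I] at h2
  have h4 := Complex.exp_ne_zero (2 * Real.pi * Complex.I * μ * ((1 / (2 * (ν - μ)) : ℝ) : ℂ))
  apply h4
  linear_combination (-1 / 2 : ℂ) * h2

/-- A trigonometric polynomial with a nonzero coefficient has only a null set of zeros. -/
theorem ae_trigPolynomial_ne_zero {s : Finset ℝ} {c : ℝ → ℂ} {μ : ℝ} (hμ : μ ∈ s) (hc : c μ ≠ 0) :
    ∀ᵐ t : ℝ, ∑ ν ∈ s, c ν * Complex.exp (2 * Real.pi * Complex.I * ν * t) ≠ 0 := by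
  set p : ℝ → ℂ := fun t => ∑ ν ∈ s, c ν * Complex.exp (2 * Real.pi * Complex.I * ν * t) with hp
  have hexp : ∀ ν : ℝ, AnalyticOnNhd ℝ
      (fun t : ℝ => Complex.exp (2 * Real.pi * Complex.I * ν * t)) Set.univ := by
    intro ν t _
    have h1 : AnalyticAt ℝ (fun t : ℝ => 2 * Real.pi * Complex.I * ν * (t : ℂ)) t :=
      analyticAt_const.mul (Complex.ofRealCLM.analyticAt t)
    exact (analyticAt_cexp.restrictScalars (𝕜 := ℝ)).comp h1
  have han : AnalyticOnNhd ℝ p Set.univ := by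
    intro t ht
    have := Finset.analyticAt_fun_sum s (𝕜 := ℝ)
      (f := fun ν (t : ℝ) => c ν * Complex.exp (2 * Real.pi * Complex.I * ν * t)) (c := t)
      (fun ν _ => analyticAt_const.mul (hexp ν t ht))
    exact this
  -- By analyticity either p vanishes identically, which contradicts Dedekind's independence of
  -- characters, or its zeros are isolated and therefore countable.
  rcases han.eqOn_zero_or_eventually_ne_zero_of_preconnected isPreconnected_univ with h | h
  · exfalso
    have hind := (linearIndependent_monoidHom (Multiplicative ℝ) ℂ).comp modulation
      modulation_injective
    rw [linearIndependent_iff'] at hind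
    refine hc (hind s c ?_ μ hμ)
    funext t
    have := h (Set.mem_univ t.toAdd)
    simpa [modulation, hp] using this
  · have hcount : {t | p t ≠ 0}ᶜ.Countable := by
      have h1 : {t | p t ≠ 0} ∈ Filter.codiscrete ℝ := h
      rw [← compl_compl {t | p t ≠ 0}, compl_mem_codiscrete_iff] at h1
      exact (h1.1.isLindelof).countable_of_isDiscrete h1.2
    exact hcount.measure_zero volume

/-- The time--frequency shifts of a nonzero function that vanishes on a half-line are linearly
independent. -/
theorem eq_zero_of_sum_timeFrequencyShift {f : ℝ → ℂ} (h0 : ∀ᵐ t, t < 0 → f t = 0)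
    (hne : ¬ ∀ᵐ t, f t = 0) {d : ℝ × ℝ →₀ ℂ}
    (hd : ∀ᵐ t : ℝ, (d.sum fun p c =>
      c * f (t - p.1) * Complex.exp (2 * Real.pi * Complex.I * p.2 * t)) = 0) : d = 0 := by
  classical
  by_contra hd0
  -- The supremum a of A is the left end of the support of f. It is finite because f is not zero
  -- almost everywhere, and it belongs to A by a countable union of null sets.
  set A : Set ℝ := {t | ∀ᵐ u, u < t → f u = 0} with hA
  have hA0 : (0 : ℝ) ∈ A := h0
  have hAbdd : BddAbove A := by
    by_contra hb
    apply hne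
    have h1 : ∀ n : ℕ, ∀ᵐ u : ℝ, u < n → f u = 0 := by
      intro n
      obtain ⟨t, ht, hnt⟩ := not_bddAbove_iff.1 hb n
      filter_upwards [show ∀ᵐ u, u < t → f u = 0 from ht] with u hu hun
      exact hu (hun.trans hnt)
    rw [← ae_all_iff] at h1
    filter_upwards [h1] with u hu
    obtain ⟨n, hn⟩ := exists_nat_gt u
    exact hu n hn
  set a := sSup A with ha
  have haA : ∀ᵐ u, u < a → f u = 0 := by
    have h1 : ∀ n : ℕ, ∀ᵐ u, u < a - 1 / (n + 1) → f u = 0 := by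
      intro n
      obtain ⟨t, ht, hnt⟩ := exists_lt_of_lt_csSup ⟨0, hA0⟩
        (show a - 1 / ((n : ℝ) + 1) < sSup A from sub_lt_self _ Nat.one_div_pos_of_nat)
      filter_upwards [show ∀ᵐ u, u < t → f u = 0 from ht] with u hu hun
      exact hu (hun.trans hnt)
    rw [← ae_all_iff] at h1
    filter_upwards [h1] with u hu hua
    obtain ⟨n, hn⟩ := exists_nat_one_div_lt (sub_pos.2 hua)
    exact hu n (by linarith)
  have hne_supp : d.support.Nonempty := Finsupp.support_nonempty_iff.2 hd0
  obtain ⟨p₀, hp₀, hmin⟩ := d.support.exists_min_image Prod.fst hne_supp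
  -- ε separates the smallest delay from the others; for t < p₀.1 + a + ε, all shifts with a larger
  -- delay still vanish.
  obtain ⟨ε, hε, hgap⟩ : ∃ ε > 0, ∀ p ∈ d.support, p.1 ≠ p₀.1 → p₀.1 + ε ≤ p.1 := by
    by_cases hs : (d.support.filter fun p => p.1 ≠ p₀.1).Nonempty
    · obtain ⟨q, hq, hqmin⟩ := Finset.exists_min_image _ Prod.fst hs
      rw [Finset.mem_filter] at hq
      refine ⟨q.1 - p₀.1, sub_pos.2 ((hmin q hq.1).lt_of_ne' hq.2), fun p hp hpp => ?_⟩
      have := hqmin p (Finset.mem_filter.2 ⟨hp, hpp⟩)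
      linarith
    · refine ⟨1, one_pos, fun p hp hpp => absurd ⟨p, Finset.mem_filter.2 ⟨hp, hpp⟩⟩ hs⟩
  have hpoly := ae_trigPolynomial_ne_zero
    (s := (d.support.filter fun p => p.1 = p₀.1).image Prod.snd) (c := fun ν => d (p₀.1, ν))
    (μ := p₀.2) (Finset.mem_image.2 ⟨p₀, Finset.mem_filter.2 ⟨hp₀, rfl⟩, rfl⟩)
    (Finsupp.mem_support_iff.1 hp₀)
  have hzero : ∀ᵐ t, ∀ p ∈ d.support, t - p.1 < a → f (t - p.1) = 0 := by
    rw [Filter.eventually_all_finset]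
    intro p _
    exact (measurePreserving_sub_right (volume : Measure ℝ) p.1).quasiMeasurePreserving.ae haA
  -- Only the smallest delay is left, where the sum is f(t - p₀.1) times a trigonometric polynomial
  -- that is nonzero almost everywhere. So f vanishes up to a + ε, against the choice of a.
  have hstep : ∀ᵐ t, t - p₀.1 < a + ε → f (t - p₀.1) = 0 := by
    filter_upwards [hd, hpoly, hzero] with t e1 e2 e3 ht
    have h1 : (d.sum fun p c =>
        c * f (t - p.1) * Complex.exp (2 * Real.pi * Complex.I * p.2 * t)) =
        f (t - p₀.1) * ∑ ν ∈ (d.support.filter fun p => p.1 = p₀.1).image Prod.snd,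
          d (p₀.1, ν) * Complex.exp (2 * Real.pi * Complex.I * ν * t) := by
      rw [Finsupp.sum, ← Finset.sum_filter_add_sum_filter_not _ fun p => p.1 = p₀.1]
      rw [Finset.sum_eq_zero (s := d.support.filter fun p => ¬ p.1 = p₀.1), add_zero,
        Finset.sum_image, Finset.mul_sum]
      · refine Finset.sum_congr rfl fun p hp => ?_
        have hp1 := (Finset.mem_filter.1 hp).2
        rw [← hp1]
        ring
      · intro p hp q hq hpq
        exact Prod.ext ((Finset.mem_filter.1 hp).2.trans (Finset.mem_filter.1 hq).2.symm) hpq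
      · intro p hp
        obtain ⟨hp1, hp2⟩ := Finset.mem_filter.1 hp
        rw [e3 p hp1 (by have := hgap p hp1 hp2; linarith)]
        simp
    rw [h1] at e1
    exact (mul_eq_zero.1 e1).resolve_right e2
  have hmem : a + ε ∈ A := by
    have h1 := (measurePreserving_sub_right (volume : Measure ℝ)
      (-p₀.1)).quasiMeasurePreserving.ae hstep
    filter_upwards [h1] with u hu
    simpa using hu
  have := le_csSup hAbdd hmem
  linarith

namespace ParametricSystem

variable (H : ParametricSystem)

/-- The attenuation factors as a finitely supported function of delay and Doppler shift. -/
def attenuation : ℝ × ℝ →₀ ℂ :=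
  ∑ p : (i : Fin H.numDelays) × Fin (H.numDopplers i),
    Finsupp.single (H.τ p.1, H.ν p.1 p.2) (H.α p.1 p.2)

theorem response_eq_sum (f : ℝ → ℂ) (t : ℝ) : H.response f t = H.attenuation.sum fun p c =>
    c * f (t - p.1) * Complex.exp (2 * Real.pi * Complex.I * p.2 * t) := by
  rw [attenuation, ← Finsupp.sum_finsetSum_index (by simp) (by intros; ring)]
  simp [response, Fintype.sum_sigma]

theorem attenuation_apply (i : Fin H.numDelays) (j : Fin (H.numDopplers i)) :
    H.attenuation (H.τ i, H.ν i j) = H.α i j := by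
  rw [attenuation, Finsupp.finsetSum_apply, Finset.sum_eq_single ⟨i, j⟩]
  · simp
  · rintro ⟨i', j'⟩ _ hne
    refine Finsupp.single_eq_of_ne' fun h => hne ?_
    rw [Prod.mk.injEq] at h
    obtain rfl := H.τ_injective h.1
    obtain rfl := H.ν_injective _ h.2
    rfl
  · simp

/-- The attenuation function forgets how delays and Doppler shifts are numbered, so systems with
different index types can be compared through it. -/
theorem triplets_eq_attenuation : H.triplets =
    {q | ∃ p, H.attenuation p ≠ 0 ∧ q = ((p.1 : ℂ), (p.2 : ℂ), H.attenuation p)} := by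
  ext q
  constructor
  · rintro ⟨i, j, rfl⟩
    exact ⟨(H.τ i, H.ν i j), by rw [attenuation_apply]; exact H.α_ne_zero i j,
      by rw [attenuation_apply]⟩
  · rintro ⟨p, hp, rfl⟩
    have h1 : ∃ s : (i : Fin H.numDelays) × Fin (H.numDopplers i), (H.τ s.1, H.ν s.1 s.2) = p := by
      by_contra! hcon
      apply hp
      rw [attenuation, Finsupp.finsetSum_apply]
      exact Finset.sum_eq_zero fun s _ => Finsupp.single_eq_of_ne' (hcon s)
    obtain ⟨⟨i, j⟩, rfl⟩ := h1
    rw [attenuation_apply]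
    exact H.mem_triplets i j

end ParametricSystem

theorem pulseTrain_vanishes_left {g : ℝ → ℂ} {T : ℝ} (hT : 0 < T) {N : ℕ} (x : ℕ → ℂ)
    (hsupp : ∀ᵐ t, t ∉ Set.Icc 0 T → g t = 0) : ∀ᵐ t, t < 0 → pulseTrain g T N x t = 0 := by
  have h1 : ∀ n : ℕ, ∀ᵐ t : ℝ, t - n * T ∉ Set.Icc 0 T → g (t - n * T) = 0 := fun n =>
    (measurePreserving_sub_right (volume : Measure ℝ) (n * T)).quasiMeasurePreserving.ae hsupp
  rw [← ae_all_iff] at h1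
  filter_upwards [h1] with t ht ht0
  refine Finset.sum_eq_zero fun n _ => ?_
  have : 0 ≤ n * T := by positivity
  rw [ht n fun h => by linarith [h.1], mul_zero]

theorem pulseTrain_not_ae_zero {g : ℝ → ℂ} {T : ℝ} (hT : 0 < T) {N : ℕ} (hN : 0 < N) {x : ℕ → ℂ}
    (hx : x 0 ≠ 0) (hg : ¬ ∀ᵐ t, g t = 0) (hsupp : ∀ᵐ t, t ∉ Set.Icc 0 T → g t = 0) :
    ¬ ∀ᵐ t, pulseTrain g T N x t = 0 := by
  intro h
  apply hg
  have h1 : ∀ n : ℕ, ∀ᵐ t : ℝ, t - n * T ∉ Set.Icc 0 T → g (t - n * T) = 0 := fun n =>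
    (measurePreserving_sub_right (volume : Measure ℝ) (n * T)).quasiMeasurePreserving.ae hsupp
  rw [← ae_all_iff] at h1
  have h2 : ∀ᵐ t : ℝ, t ≠ T := by simp [ae_iff]
  filter_upwards [h, h1, h2, hsupp] with t e1 e2 e3 e4
  by_cases ht : t ∈ Set.Icc 0 T
  · have hlt : t < T := lt_of_le_of_ne ht.2 e3
    -- On [0, T) only the pulse n = 0 is present, so a vanishing train would force g to vanish.
    rw [pulseTrain, Finset.sum_eq_single_of_mem 0 (Finset.mem_range.2 hN)] at e1
    · simpa [hx] using e1
    · intro n _ hn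
      have hn1 : (1 : ℝ) ≤ n := by exact_mod_cast Nat.one_le_iff_ne_zero.2 hn
      rw [e2 n fun hmem => by nlinarith [hmem.1], mul_zero]
  · exact e4 ht

theorem ParametricSystem.triplets_eq_of_response_ae_eq {H H' : ParametricSystem} {T : ℝ} {N : ℕ}
    {g : ℝ → ℂ} {x : ℕ → ℂ} (hg1 : (∫ t, ‖g t‖ ^ 2) = 1)
    (hsupp : ∀ᵐ t, t ∉ Set.Icc 0 T → g t = 0) (hN : 0 < N) (hx : x 0 ≠ 0)
    (h : H.response (pulseTrain g T N x) =ᵐ[volume] H'.response (pulseTrain g T N x)) :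
    H.triplets = H'.triplets := by
  have hg0 : ¬ ∀ᵐ t, g t = 0 := by
    intro h0
    have h1 : (∫ t, ‖g t‖ ^ 2) = 0 := by
      rw [integral_eq_zero_of_ae]
      filter_upwards [h0] with t ht
      simp [ht]
    rw [h1] at hg1
    exact zero_ne_one hg1
  -- For T ≤ 0 the interval [0, T] is a null set, and g could not have unit energy.
  have hT : 0 < T := by
    by_contra hT
    apply hg0
    have h2 : ∀ᵐ t : ℝ, t ≠ 0 := by simp [ae_iff]
    filter_upwards [hsupp, h2] with t e1 e2
    exact e1 fun hmem => e2 (by linarith [hmem.1, hmem.2])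
  have key := eq_zero_of_sum_timeFrequencyShift (d := H.attenuation - H'.attenuation)
    (pulseTrain_vanishes_left (N := N) hT x hsupp) (pulseTrain_not_ae_zero hT hN hx hg0 hsupp) (by
      filter_upwards [h] with t ht
      rw [Finsupp.sum_sub_index (by intros; ring), ← H.response_eq_sum, ← H'.response_eq_sum, ht,
        sub_self])
  rw [H.triplets_eq_attenuation, H'.triplets_eq_attenuation, sub_eq_zero.1 key]

/-! ### Identification -/

/-- The samples with suitable kernels determine the system by means of the program `identify`. -/
theorem exists_kernels_identify {Q N : ℕ} {W T : ℝ} {g : ℝ → ℂ} (hg : MemLp g 2 volume)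
    (x : ℕ → ℂ) (hQ : 0 < Q) (hW : 0 < W) (hT : T = 4 * Real.pi * Q / W) (hfill : FillsBand g hg W)
    (hx : ∀ n < N, x n ≠ 0) :
    ∃ h : ℕ → ℕ → ℝ → ℂ, (∀ m n, MemLp (h m n) 2 volume) ∧
      ∀ (H : ParametricSystem) (τmax νmax : ℝ),
        H.SupportedIn τmax νmax → τmax < T → νmax * T < 1 → H.numDelays ≤ Q →
        2 * H.maxDopplers ≤ N →
        (Program.identify.exec (inputStore Q N T x
          fun m n => sample (H.slowResponse g T N x) (h m n))).Describes H := by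
  have hpi := Real.pi_pos
  have hQr : (0 : ℝ) < Q := by exact_mod_cast hQ
  have hT0 : 0 < T := by rw [hT]; positivity
  -- For N = 0 no system is admissible, because every system has a Doppler shift; any kernels will
  -- do.
  rcases Nat.eq_zero_or_pos N with rfl | hN
  · refine ⟨fun _ _ => 0, fun _ _ => MemLp.zero, fun H _ _ _ _ _ _ hM => ?_⟩
    have := H.maxDopplers_pos
    omega
  have hNr : (0 : ℝ) < N := by exact_mod_cast hN
  have hD : 0 < N * T := by positivity
  -- P/D = Q/T = W/(4π), so the 2P cells fill the band |ω| ≤ W/2 exactly; this is the reason for the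
  -- choice T = 4πQ/W.
  obtain ⟨h, hh, hs⟩ := exists_sampling_kernels hg hD (P := Q * N) (W := W) (by
    rw [hT]
    push_cast
    apply le_of_eq
    field_simp
    ring) hfill
  refine ⟨fun m n => h (m * N + n), fun m n => hh _, fun H τmax νmax hH hτT hνT hHQ hHN => ?_⟩
  refine Program.exec_identify (c := fun k => sample (H.slowResponse g T N x) (h k))
    (fun i => ⟨(hH.1 i).1, (hH.1 i).2.trans_lt hτT⟩) (fun i j => ?_) hx hHQ hHN fun k hk => ?_
  · obtain ⟨h1, h2⟩ := hH.2 i j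
    rw [abs_lt]
    -- |ν_ij T| ≤ νmax T / 2 < 1/2.
    constructor <;> nlinarith
  · rw [H.sample_slowResponse hg (hh k)]
    refine Finset.sum_congr rfl fun i _ => Finset.sum_congr rfl fun n _ => ?_
    rw [hs k hk]
    ring

end

/-! ### The four assertions together -/

theorem theorem1 :
    -- one program, with polynomially many steps, identifies all systems
    (∃ (prog : Program) (C d : ℕ),
      ∀ (Q N : ℕ) (W 𝒯 T : ℝ) (g : ℝ → ℂ) (hg : MemLp g 2 volume) (x : ℕ → ℂ),
        0 < Q → 0 < W → T = 4 * Real.pi * Q / W → N = ⌊𝒯 / T⌋₊ →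
        (∫ t, ‖g t‖ ^ 2) = 1 → FillsBand g hg W →
        (∀ n < N, 0 < ‖x n‖) →
        ∃ h : ℕ → ℕ → ℝ → ℂ, (∀ m n, MemLp (h m n) 2 volume) ∧
          ∀ (H : ParametricSystem) (τmax νmax : ℝ),
            H.SupportedIn τmax νmax → τmax < T → νmax * T < 1 →
            H.numDelays ≤ Q → 8 * Real.pi * Q * H.maxDopplers ≤ 𝒯 * W →
            ((prog.run (inputStore Q N T x
                (fun m n => sample (H.slowResponse g T N x) (h m n)))).1.Describes H ∧
              ((prog.run (inputStore Q N T x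
                (fun m n => sample (H.slowResponse g T N x) (h m n)))).2 : ℝ)
                ≤ C * (𝒯 * W) ^ d)) ∧
    -- the condition in terms of the total number of delay--Doppler pairs
    (∀ (H : ParametricSystem) (𝒯 W : ℝ), 2 * Real.pi * ((H.numPairs : ℝ) + 1) ^ 2 ≤ 𝒯 * W →
      8 * Real.pi * H.numDelays * H.maxDopplers ≤ 𝒯 * W) ∧
    -- for a pulse supported on `[0, T]`: the observed signal differs from the response by a
    -- multiple of `νmax * T`
    (∀ (H : ParametricSystem) (τmax νmax T : ℝ) (N : ℕ) (g : ℝ → ℂ) (x : ℕ → ℂ),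
      MemLp g 2 volume → (∫ t, ‖g t‖ ^ 2) = 1 → (∀ᵐ t, t ∉ Set.Icc 0 T → g t = 0) →
      H.SupportedIn τmax νmax → τmax < T →
      eLpNorm (fun t => H.response (pulseTrain g T N x) t - H.slowResponse g T N x t) 2 volume ≤
        ENNReal.ofReal (2 * Real.pi * (νmax * T) *
          ((∑ i, ∑ j, ‖H.α i j‖) * ∑ n ∈ Finset.range N, ‖x n‖))) ∧
    -- and the response itself determines the system
    (∀ (H H' : ParametricSystem) (T : ℝ) (N : ℕ) (g : ℝ → ℂ) (x : ℕ → ℂ),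
      MemLp g 2 volume → (∫ t, ‖g t‖ ^ 2) = 1 → (∀ᵐ t, t ∉ Set.Icc 0 T → g t = 0) →
      0 < N → (∀ n < N, 0 < ‖x n‖) →
      H.response (pulseTrain g T N x) =ᵐ[volume] H'.response (pulseTrain g T N x) →
      H.triplets = H'.triplets) := by
  refine ⟨?_, fun H 𝒯 W h => H.eight_pi_mul_le h, fun H τmax νmax T N g x hg hg1 hsupp hH hT =>
    H.eLpNorm_response_sub_le hg hg1 hsupp hH hT, fun H H' T N g x _ hg1 hsupp hN hx h =>
    ParametricSystem.triplets_eq_of_response_ae_eq hg1 hsupp hN (norm_pos_iff.1 (hx 0 hN)) h⟩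
  obtain ⟨C, d, hsteps⟩ := Program.exists_identify_steps_le
  refine ⟨Program.identify, C, d, fun Q N W 𝒯 T g hg x hQ hW hT hN _ hfill hx => ?_⟩
  obtain ⟨h, hh, hid⟩ := exists_kernels_identify (N := N) hg x hQ hW hT hfill
    fun n hn => norm_pos_iff.1 (hx n hn)
  refine ⟨h, hh, fun H τmax νmax hH hτ hν hHQ hM => ?_⟩
  have hpi := Real.pi_gt_three
  have hQr : (0 : ℝ) < Q := by exact_mod_cast hQ
  have hT0 : 0 < T := by rw [hT]; positivity
  have hTW : T * W = 4 * Real.pi * Q := by rw [hT]; field_simp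
  have hMr : (1 : ℝ) ≤ H.maxDopplers := by exact_mod_cast H.maxDopplers_pos
  -- As TW = 4πQ, the assumption 8πQ K_νmax ≤ 𝒯W says exactly that 2 K_νmax ≤ 𝒯/T; the left side is
  -- an integer, so it is at most N.
  have hdiv : 2 * (H.maxDopplers : ℝ) ≤ 𝒯 / T := by
    rw [le_div_iff₀ hT0]
    refine le_of_mul_le_mul_right ?_ hW
    calc 2 * (H.maxDopplers : ℝ) * T * W = 2 * H.maxDopplers * (T * W) := by ring
      _ = 8 * Real.pi * Q * H.maxDopplers := by rw [hTW]; ring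
      _ ≤ 𝒯 * W := hM
  have hHN : 2 * H.maxDopplers ≤ N := by
    rw [hN]
    exact Nat.le_floor (by exact_mod_cast hdiv)
  have hN0 : 0 < N := by have := H.maxDopplers_pos; omega
  -- This turns the step bound in QN into one in the time--bandwidth product: QN ≤ 4πQN = NTW ≤ 𝒯W.
  have hQN : (Q : ℝ) * N ≤ 𝒯 * W := by
    have h1 : (N : ℝ) ≤ 𝒯 / T := by
      rw [hN]
      exact Nat.floor_le (by linarith)
    have h2 : (N : ℝ) * T ≤ 𝒯 := (le_div_iff₀ hT0).1 h1
    calc (Q : ℝ) * N ≤ 4 * Real.pi * (Q * N) := le_mul_of_one_le_left (by positivity) (by linarith)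
      _ = N * T * W := by rw [mul_assoc (N : ℝ), hTW]; ring
      _ ≤ 𝒯 * W := by gcongr
  refine ⟨hid H τmax νmax hH hτ hν hHQ hHN, ?_⟩
  have h1 := hsteps Q N T x (fun m n => sample (H.slowResponse g T N x) (h m n)) hQ hN0
  calc (((Program.identify.run (inputStore Q N T x
        fun m n => sample (H.slowResponse g T N x) (h m n))).2 : ℕ) : ℝ)
      ≤ ((C * (Q * N) ^ d : ℕ) : ℝ) := by exact_mod_cast h1
    _ = C * ((Q : ℝ) * N) ^ d := by push_cast; ring
    _ ≤ C * (𝒯 * W) ^ d := by gcongr
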